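/- Let $G=(V,E)$ be a finite simple graph embedded in the plane such that the vertices are distinct points, the edges are straight line segments, and no vertex lies on an edge other than at its endpoints. Two edges may *cross*, i.e. intersect in a point that is not a vertex. Let $E_A\subset E$ be a set of *additional* edges such that $(V,E_A)$ has no cycles; the edges in $E\setminus E_A$ are called *representative*. Let $x=(x_{uv})_{uv\in E}$ be a vector of real or complex edge weights. For two consecutive edges $uv$, $vw$ with $u\ne w$ let $\angle(v-u,w-v)\in(-\pi,\pi)$ be the turning angle from $v-u$ to $w-v$. *Generating function.* A set $F\subset E$ is even if every vertex has even degree in $(V,F)$; let $C_F$ be the number of unordered pairs of edges in $F$ that cross, and $$Z(x)=\sum_{\text{even }F\subset E}(-1)^{C_F}\prod_{uv\in F}x_{uv}.$$ *Loops.* A closed path is a sequence $(v_0,\dots,v_{n-1})$ of vertices, $n\ge 3$, with indices taken modulo $n$, such that $v_iv_{i+1}\in E$ and $v_{i+2}\neq v_i$ for all $i$. Order the vertices lexicographically by their coordinates. A loop is a closed path that is lexicographically smallest among all its rotations and all rotations of its reversal. The length of a loop $\ell=(v_0,\dots,v_{n-1})$ is the number of $i\in\{0,\dots,n-1\}$ with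 $v_iv_{i+1}\in E\setminus E_A$, its multiplicity $m(\ell)$ is $n$ divided by the smallest period of the sequence, its winding angle is $\alpha(\ell)=\sum_{i=0}^{n-1}\angle(v_{i+1}-v_i,v_{i+2}-v_{i+1})$, and its weight is $$w(\ell;x)=\frac{-e^{i\alpha(\ell)/2}}{m(\ell)}\prod_{i=0}^{n-1}x_{v_iv_{i+1}}.$$ Let $f_r(x)$ be the sum of $w(\ell;x)$ over all loops $\ell$ of length $r$. *Transition matrix.* $\Lambda(x)$ is indexed by the directed representative edges. The entry in row $\overrightarrow{uv}$ and column $\overrightarrow{wz}$ is $x_{uv}e^{i\angle(v-u,z-v)/2}$ if $v=w$ and $u\ne z$; it is $x_{uv}\prod_{i=1}^{n-1}x_{v_iv_{i+1}}\,e^{i\theta/2}$ if $v\neq w$ and $v=v_1,v_2,\dots,v_n=w$ is the (necessarily unique) path from $v$ to $w$ along additional edges, where $\theta$ is the sum of the turning angles along $(u,v_1,\dots,v_n,z)$; and it is $0$ otherwise. Let $\lambda_i(x)$ be the eigenvalues of $\Lambda(x)$, counted with algebraic multiplicity, and $\rho(x)$ its spectral radius. **Theorem.** For every $r$ there are finitely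 many loops of length $r$. If $\rho(x)<1$, then $\sum_{r\ge1}|f_r(x)|<\infty$ and $$Z(x)=\exp\Bigl(\sum_{r=1}^\infty f_r(x)\Bigr)=\sqrt{\det(I-\Lambda(x))}.$$ Here the square root is $\prod_i(1-\lambda_i(x))^{1/2}$ with principal square roots of the factors; in particular $Z(x)^2=\det(I-\Lambda(x))$. If all edge weights are real, then $\det(I-\Lambda(x))$ is a positive real number and $\sqrt{\cdot}$ is the usual positive square root. -/

import Mathlib

/-- A graph with straight edges in the plane `ℂ`, without loops and multiple edges. Edges may cross
each other, but no vertex lies on an edge other than at its endpoints. Some of the edges, forming a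
graph without cycles, are singled out as additional edges; the other edges are called
representative. -/
structure PlaneGraph (V : Type*) where
  /-- All edges. -/
  graph : SimpleGraph V
  /-- The additional edges. -/
  additional : SimpleGraph V
  /-- The positions of the vertices. -/
  pos : V → ℂ
  pos_injective : Function.Injective pos
  mem_of_pos_mem_edge : ∀ e ∈ graph.edgeSet, ∀ w : V,
    pos w ∈ convexHull ℝ (pos '' {v | v ∈ e}) → w ∈ e
  additional_le : additional ≤ graph
  additional_isAcyclic : additional.IsAcyclic

namespace PlaneGraph

noncomputable section

variable {V : Type*} (G : PlaneGraph V)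

/-- The graph of the representative edges. -/
abbrev representative : SimpleGraph V := G.graph \ G.additional

/-- The closed line segment that represents an edge. -/
def edgeSegment (e : Sym2 V) : Set ℂ := convexHull ℝ (G.pos '' {v | v ∈ e})

/-! ### The generating function of even subgraphs -/

open Classical in
/-- A set of edges is even if every vertex is incident to an even number of its edges. -/
def IsEven (F : Finset (Sym2 V)) : Prop :=
  ∀ v : V, Even (F.filter (fun e => v ∈ e)).card

open Classical in
/-- The number of unordered pairs of distinct edges of `F` that cross, i.e. that have a common point
which is not a vertex. -/
def crossings (F : Finset (Sym2 V)) : ℕ :=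
  ((F.powersetCard 2).filter
    (fun P => ∃ y : ℂ, (∀ e ∈ P, y ∈ G.edgeSegment e) ∧ y ∉ Set.range G.pos)).card

open Classical in
/-- The signed generating function `Z(x)` of even subgraphs. -/
def Z [Fintype V] (x : Sym2 V → ℂ) : ℂ :=
  ∑ F ∈ G.graph.edgeFinset.powerset.filter (fun F => IsEven F),
    (-1) ^ G.crossings F * ∏ e ∈ F, x e

/-! ### Loops -/

/-- The turning angle at `v` when going from `u` via `v` to `w`, counterclockwise positive. -/
def turn (u v w : V) : ℝ :=
  Complex.arg ((G.pos w - G.pos v) / (G.pos v - G.pos u))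

/-- Non-backtracking paths, given by their vertices. -/
def IsPath (l : List V) : Prop :=
  l.IsChain G.graph.Adj ∧ ∀ (i : ℕ) (h : i + 2 < l.length), l[i + 2] ≠ l[i]

/-- Closed paths `(v₀, …, vₙ₋₁)`: all rotations are paths. Going along one edge and back again
(`n = 2`) is backtracking. -/
def IsClosedPath (l : List V) : Prop :=
  3 ≤ l.length ∧ ∀ k : ℕ, G.IsPath (l.rotate k)

/-- The coordinates of the vertices of a path. Vertices are ordered lexicographically by their
coordinates, and paths lexicographically by their vertices. -/
def key (l : List V) : List (ℝ ×ₗ ℝ) :=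
  l.map fun v => toLex ((G.pos v).re, (G.pos v).im)

/-- A loop is a closed path which is the smallest one among its rotations and the rotations of its
reversal. -/
def IsLoop (l : List V) : Prop :=
  G.IsClosedPath l ∧ ∀ k : ℕ, G.key l ≤ G.key (l.rotate k) ∧ G.key l ≤ G.key (l.reverse.rotate k)

/-- The edges `v₀v₁, …, vₙ₋₁v₀` of a closed path, in order and with repetitions. -/
def cyclicEdges (l : List V) : List (Sym2 V) :=
  List.zipWith (fun u v => s(u, v)) l (l.rotate 1)

/-- The sum of the turning angles along a closed path. -/
def windingAngle (l : List V) : ℝ :=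
  (List.zipWith3 G.turn l (l.rotate 1) (l.rotate 2)).sum

/-- The sign `-exp(iα/2)` of a closed path with winding angle `α`. -/
def sign (l : List V) : ℂ :=
  -Complex.exp (Complex.I / 2 * (G.windingAngle l : ℂ))

/-- The number of steps divided by the smallest period. -/
def multiplicity (l : List V) : ℕ :=
  l.length / Function.minimalPeriod (fun l' : List V => l'.rotate 1) l

/-- The signed weight of a loop. -/
def loopWeight (x : Sym2 V → ℂ) (l : List V) : ℂ :=
  G.sign l / (multiplicity l : ℂ) * ((cyclicEdges l).map x).prod

open Classical in
/-- The length of a loop: the number of its steps along representative edges. -/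
def loopLength (l : List V) : ℕ :=
  (cyclicEdges l).countP (fun e => e ∈ G.representative.edgeSet)

/-- The loops of length `r`. -/
def loops (r : ℕ) : Set (List V) :=
  {l | G.IsLoop l ∧ G.loopLength l = r}

/-- The sum `f_r(x)` of the signed weights of all loops of length `r`. -/
def f (r : ℕ) (x : Sym2 V → ℂ) : ℂ :=
  ∑ᶠ l ∈ G.loops r, G.loopWeight x l

/-! ### The transition matrix -/

/-- The sum of the turning angles along a path that is not closed. -/
def pathAngle : List V → ℝ
  | u :: v :: w :: l => G.turn u v w + pathAngle (v :: w :: l)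
  | _ => 0

open Classical in
/-- The transition matrix `Λ(x)`, indexed by the directed representative edges. From `uv` one can
step directly to `vz` if `z ≠ u`, and to `wz` with `w ≠ v` if there is a path from `v` to `w` along
additional edges; this path is unique, since the additional edges form no cycles. -/
def transitionMatrix (x : Sym2 V → ℂ) :
    Matrix G.representative.Dart G.representative.Dart ℂ :=
  fun d e =>
    if d.snd = e.fst then
      if d.fst ≠ e.snd then
        x d.edge * Complex.exp (Complex.I / 2 * (G.turn d.fst d.snd e.snd : ℂ))
      else 0
    else if h : ∃ p : G.additional.Walk d.snd e.fst, p.IsPath then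
      x d.edge * (h.choose.edges.map x).prod *
        Complex.exp
          (Complex.I / 2 * (G.pathAngle (d.fst :: (h.choose.support ++ [e.snd])) : ℂ))
    else 0

end

end PlaneGraph

section PfaffianFunctional

open CliffordAlgebra

variable {R M : Type*} [CommRing R] [AddCommGroup M] [Module R M]

/-- The linear functional on the exterior algebra whose value at `v₁ ∧ ⋯ ∧ vₙ` is the Pfaffian of
the matrix `B vᵢ vⱼ`. -/
noncomputable def pfaffianFunctional (B : LinearMap.BilinForm R M) (hB : B.IsAlt) :
    ExteriorAlgebra R M →ₗ[R] R :=
  (ExteriorAlgebra.algebraMapInv (R := R) (M := M)).toLinearMap ∘ₗ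
    changeForm (Q := (0 : QuadraticForm R M)) (Q' := (0 : QuadraticForm R M)) (B := -B)
      (by ext m; simp [hB m])

variable {B : LinearMap.BilinForm R M} (hB : B.IsAlt)

@[simp]
theorem pfaffianFunctional_one : pfaffianFunctional B hB 1 = 1 := by
  simp only [pfaffianFunctional, LinearMap.comp_apply]
  erw [changeForm_one]
  simp

theorem pfaffianFunctional_ι_mul (m : M) (y : ExteriorAlgebra R M) :
    pfaffianFunctional B hB (ExteriorAlgebra.ι R m * y) =
      pfaffianFunctional B hB (contractLeft (Q := (0 : QuadraticForm R M)) (B m) y) := by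
  simp only [pfaffianFunctional, LinearMap.comp_apply]
  erw [changeForm_ι_mul, changeForm_contractLeft]
  rw [map_sub]
  have : (ExteriorAlgebra.algebraMapInv (R := R) (M := M)).toLinearMap
      ((CliffordAlgebra.ι (0 : QuadraticForm R M)) m *
        changeForm (Q := (0 : QuadraticForm R M)) (Q' := (0 : QuadraticForm R M)) (B := -B)
      (by ext m; simp [hB m]) y) = 0 := by
    rw [AlgHom.toLinearMap_apply, map_mul]
    have : ExteriorAlgebra.algebraMapInv (CliffordAlgebra.ι (0 : QuadraticForm R M) m) = 0 := by
      simp [ExteriorAlgebra.algebraMapInv]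
    rw [this, zero_mul]
  rw [this]
  simp

/-- The product of the factors `1 + x • h ∧ k`. -/
noncomputable def pairProd (L : List (R × M × M)) : ExteriorAlgebra R M :=
  (L.map fun p => 1 + p.1 • (ExteriorAlgebra.ι R p.2.1 * ExteriorAlgebra.ι R p.2.2)).prod

theorem ι_mul_pair_comm (m h k : M) :
    ExteriorAlgebra.ι R m * (ExteriorAlgebra.ι R h * ExteriorAlgebra.ι R k) =
      (ExteriorAlgebra.ι R h * ExteriorAlgebra.ι R k) * ExteriorAlgebra.ι R m := by
  have a (u v : M) : ExteriorAlgebra.ι R u * ExteriorAlgebra.ι R v =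
      - (ExteriorAlgebra.ι R v * ExteriorAlgebra.ι R u) :=
    eq_neg_of_add_eq_zero_left (ExteriorAlgebra.ι_add_mul_swap u v)
  rw [← mul_assoc, a m h, neg_mul, mul_assoc, a m k, mul_neg, neg_neg, mul_assoc]

theorem ι_mul_pairProd_comm (m : M) (L : List (R × M × M)) :
    ExteriorAlgebra.ι R m * pairProd L = pairProd L * ExteriorAlgebra.ι R m := by
  induction L with
  | nil => simp [pairProd]
  | cons p L ih =>
    have : pairProd (p :: L) = (1 + p.1 • (ExteriorAlgebra.ι R p.2.1 * ExteriorAlgebra.ι R p.2.2)) *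
      pairProd L := by simp [pairProd]
    have hp : ExteriorAlgebra.ι R m *
        (1 + p.1 • (ExteriorAlgebra.ι R p.2.1 * ExteriorAlgebra.ι R p.2.2)) =
        (1 + p.1 • (ExteriorAlgebra.ι R p.2.1 * ExteriorAlgebra.ι R p.2.2)) *
          ExteriorAlgebra.ι R m := by
      rw [mul_add, mul_smul_comm, ι_mul_pair_comm, add_mul, smul_mul_assoc, one_mul, mul_one]
    rw [this, ← mul_assoc, hp, mul_assoc, ih, mul_assoc]

theorem contractLeft_pairProd_mul (d : Module.Dual R M) (L : List (R × M × M))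
    (y : ExteriorAlgebra R M) :
    contractLeft (Q := (0 : QuadraticForm R M)) d (pairProd L * y) =
      ExteriorAlgebra.ι R ((L.map fun p => p.1 • (d p.2.1 • p.2.2 - d p.2.2 • p.2.1)).sum) *
        pairProd L * y + pairProd L * contractLeft (Q := (0 : QuadraticForm R M)) d y := by
  induction L generalizing y with
  | nil => simp [pairProd]
  | cons p L ih =>
    obtain ⟨x, h, k⟩ := p
    have e : pairProd ((x, h, k) :: L) = (1 + x • (ExteriorAlgebra.ι R h * ExteriorAlgebra.ι R k)) *
      pairProd L := by simp [pairProd]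
    have c (m : M) (z : ExteriorAlgebra R M) :
      contractLeft (Q := (0 : QuadraticForm R M)) d (ExteriorAlgebra.ι R m * z) =
        d m • z - ExteriorAlgebra.ι R m * contractLeft (Q := (0 : QuadraticForm R M)) d z :=
      contractLeft_ι_mul d m z
    set a := (L.map fun p => p.1 • (d p.2.1 • p.2.2 - d p.2.2 • p.2.1)).sum with ha
    have hh (z : ExteriorAlgebra R M) : ExteriorAlgebra.ι R h * (ExteriorAlgebra.ι R h * z) = 0 := by
      rw [← mul_assoc, ExteriorAlgebra.ι_sq_zero, zero_mul]
    have hkh (z : ExteriorAlgebra R M) : ExteriorAlgebra.ι R k * (ExteriorAlgebra.ι R h *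
        (ExteriorAlgebra.ι R k * z)) = 0 := by
      rw [← mul_assoc, ← mul_assoc, mul_assoc (ExteriorAlgebra.ι R k), ι_mul_pair_comm,
        mul_assoc (ExteriorAlgebra.ι R h), ExteriorAlgebra.ι_sq_zero, mul_zero, zero_mul]
    have hc (z : ExteriorAlgebra R M) : ExteriorAlgebra.ι R a * (ExteriorAlgebra.ι R h *
        (ExteriorAlgebra.ι R k * z)) = ExteriorAlgebra.ι R h * (ExteriorAlgebra.ι R k *
          (ExteriorAlgebra.ι R a * z)) := by
      rw [← mul_assoc, ← mul_assoc, mul_assoc (ExteriorAlgebra.ι R a), ι_mul_pair_comm]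
      simp only [mul_assoc]
    rw [e, List.map_cons, List.sum_cons, ← ha]
    clear_value a
    simp only [add_mul, one_mul, smul_mul_assoc, map_add, map_smul,
      mul_assoc, c, ih, map_sub, mul_add, mul_smul_comm, sub_mul, smul_sub, mul_sub,
      hh, hkh, hc, smul_zero]
    simp only [smul_smul, smul_add, mul_comm x, zero_mul, sub_self, zero_add]
    abel

/-- The defining property of the two-point function of the functional `y ↦ φ(g y)`. -/
theorem pfaffianFunctional_pairProd_mul (L : List (R × M × M)) (m : M) (y : ExteriorAlgebra R M) :
    pfaffianFunctional B hB (pairProd L * (ExteriorAlgebra.ι R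
      (m - (L.map fun p => p.1 • (B m p.2.1 • p.2.2 - B m p.2.2 • p.2.1)).sum) * y)) =
    pfaffianFunctional B hB (pairProd L * contractLeft (Q := (0 : QuadraticForm R M)) (B m) y) := by
  rw [map_sub, sub_mul, mul_sub, map_sub, ← mul_assoc, ← ι_mul_pairProd_comm, mul_assoc,
    pfaffianFunctional_ι_mul, contractLeft_pairProd_mul, ι_mul_pairProd_comm, map_add, mul_assoc]
  abel

end PfaffianFunctional

section PfaffianDeterminant

open CliffordAlgebra Matrix

set_option linter.unusedSectionVars false

variable {D : Type*} [Fintype D] [DecidableEq D]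

theorem isAlt_toBilin'_of_skew {S : Matrix D D ℂ} (hS : Sᵀ = -S) : (Matrix.toBilin' S).IsAlt := by
  intro v
  have h : v ⬝ᵥ S *ᵥ v = -(v ⬝ᵥ S *ᵥ v) := by
    conv_lhs => rw [dotProduct_comm, ← vecMul_transpose, hS, vecMul_neg, neg_dotProduct]
    rw [dotProduct_mulVec]
  rw [Matrix.toBilin'_apply']
  exact self_eq_neg.1 h

/-- The skew-symmetric matrix `∑ x (Eₕₖ - Eₖₕ)`. -/
def pairMatrix (L : List (ℂ × D × D)) : Matrix D D ℂ :=
  (L.map fun p => p.1 • (Matrix.single p.2.1 p.2.2 1 - Matrix.single p.2.2 p.2.1 1)).sum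

/-- The product of the factors `1 + x • h ∧ k` for basis vectors `h` and `k`. -/
noncomputable def basisPairProd (L : List (ℂ × D × D)) : ExteriorAlgebra ℂ (D → ℂ) :=
  pairProd (L.map fun p => (p.1, Pi.single p.2.1 1, Pi.single p.2.2 1))

/-- The Pfaffian functional of a skew-symmetric matrix. -/
noncomputable def skewFunctional (S : Matrix D D ℂ) (hS : Sᵀ = -S) :
    ExteriorAlgebra ℂ (D → ℂ) →ₗ[ℂ] ℂ :=
  pfaffianFunctional (Matrix.toBilin' S) (isAlt_toBilin'_of_skew hS)

theorem toBilin'_single_right (S : Matrix D D ℂ) (m : D → ℂ) (k : D) :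
    Matrix.toBilin' S m (Pi.single k 1) = (m ᵥ* S) k := by
  rw [Matrix.toBilin'_apply', dotProduct_mulVec, dotProduct_single_one]

theorem sub_pair_sum_eq_vecMul (S : Matrix D D ℂ) (L : List (ℂ × D × D)) (m : D → ℂ) :
    m - ((L.map fun p : ℂ × D × D => ((p.1, Pi.single p.2.1 1, Pi.single p.2.2 1) :
      ℂ × (D → ℂ) × (D → ℂ))).map fun p => p.1 • (Matrix.toBilin' S m p.2.1 • p.2.2 -
        Matrix.toBilin' S m p.2.2 • p.2.1)).sum = m ᵥ* (1 - S * pairMatrix L) := by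
  rw [vecMul_sub, vecMul_one, ← vecMul_vecMul]
  congr 1
  induction L with
  | nil => simp [pairMatrix]
  | cons p L ih =>
    have : pairMatrix (p :: L) = p.1 • (Matrix.single p.2.1 p.2.2 1 -
      Matrix.single p.2.2 p.2.1 1) + pairMatrix L := by simp [pairMatrix]
    rw [List.map_cons, List.map_cons, List.sum_cons, ih, this, vecMul_add]
    congr 1
    rw [vecMul_smul, vecMul_sub, toBilin'_single_right, toBilin'_single_right]
    generalize m ᵥ* S = n
    congr 1
    ext j
    simp [Matrix.vecMul, dotProduct, Matrix.single_apply, Pi.single_apply, ite_and, eq_comm]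

variable (S : Matrix D D ℂ) (hS : Sᵀ = -S)

theorem skewFunctional_basisPairProd_mul (L : List (ℂ × D × D))
    (hdet : (1 - S * pairMatrix L).det ≠ 0) (h k : D) :
    skewFunctional S hS (basisPairProd L *
      (ExteriorAlgebra.ι ℂ (Pi.single h 1) * ExteriorAlgebra.ι ℂ (Pi.single k 1))) =
      ((1 - S * pairMatrix L)⁻¹ * S) h k * skewFunctional S hS (basisPairProd L) := by
  set N := 1 - S * pairMatrix L with hN
  have hu : IsUnit N.det := isUnit_iff_ne_zero.2 hdet
  have := pfaffianFunctional_pairProd_mul (isAlt_toBilin'_of_skew hS)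
    (L.map fun p : ℂ × D × D => ((p.1, Pi.single p.2.1 1, Pi.single p.2.2 1) :
      ℂ × (D → ℂ) × (D → ℂ))) ((Pi.single h 1 : D → ℂ) ᵥ* N⁻¹) (ExteriorAlgebra.ι ℂ (Pi.single k 1))
  rw [sub_pair_sum_eq_vecMul, ← hN, vecMul_vecMul, Matrix.nonsing_inv_mul _ hu, vecMul_one] at this
  rw [skewFunctional, basisPairProd, this]
  erw [contractLeft_ι]
  rw [← Algebra.commutes, ← Algebra.smul_def, map_smul, smul_eq_mul, toBilin'_single_right,
    vecMul_vecMul, single_one_vecMul]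
  rfl

theorem basisPairProd_cons (x : ℂ) (h k : D) (L : List (ℂ × D × D)) :
    basisPairProd ((x, h, k) :: L) = basisPairProd L + x • (basisPairProd L *
      (ExteriorAlgebra.ι ℂ (Pi.single h 1) * ExteriorAlgebra.ι ℂ (Pi.single k 1))) := by
  have : basisPairProd ((x, h, k) :: L) = (1 + x • (ExteriorAlgebra.ι ℂ (Pi.single h 1) *
      ExteriorAlgebra.ι ℂ (Pi.single k 1))) * basisPairProd L := by
    simp [basisPairProd, pairProd]
  rw [this, add_mul, one_mul, smul_mul_assoc, ← mul_assoc (basisPairProd L), basisPairProd,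
    ← ι_mul_pairProd_comm, mul_assoc, ι_mul_pairProd_comm (Pi.single k 1), mul_assoc]

theorem det_one_sub_skew_pair {c : Matrix D D ℂ} (x : ℂ) (h k : D) (hh : c h h = 0) (hk : c k k = 0)
    (hkh : c k h = -c h k) :
    (1 - c * (x • (Matrix.single h k 1 - Matrix.single k h 1))).det = (1 + x * c h k) ^ 2 := by
  let U : Matrix D (Fin 2) ℂ := Matrix.of fun i j => c i (![h, k] j)
  let W : Matrix (Fin 2) D ℂ := Matrix.of fun j i => if j = 0 then (if i = k then x else 0) else
    (if i = h then -x else 0)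
  have e : c * (x • (Matrix.single h k 1 - Matrix.single k h 1)) = U * W := by
    ext i j
    simp only [Matrix.mul_apply, Fin.sum_univ_two, U, W, Matrix.smul_apply, Matrix.sub_apply,
      Matrix.single_apply, smul_eq_mul, mul_sub, Finset.sum_sub_distrib, Matrix.of_apply]
    simp [ite_and, eq_comm, sub_eq_add_neg]
    split_ifs <;> simp
  rw [e, det_one_sub_mul_comm, det_fin_two]
  simp [U, W, Matrix.mul_apply, hh, hk, hkh]
  ring

theorem skewFunctional_sq_cons_of_det_ne_zero (x : ℂ) (h k : D) (L : List (ℂ × D × D))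
    (hL : skewFunctional S hS (basisPairProd L) ^ 2 = (1 - S * pairMatrix L).det)
    (hdet : (1 - S * pairMatrix L).det ≠ 0) :
    skewFunctional S hS (basisPairProd ((x, h, k) :: L)) ^ 2 =
      (1 - S * pairMatrix ((x, h, k) :: L)).det := by
  have hz : skewFunctional S hS (basisPairProd L) ≠ 0 := by
    intro h0; rw [h0] at hL; exact hdet (by rw [← hL]; simp)
  have key := skewFunctional_basisPairProd_mul S hS L hdet
  set c := (1 - S * pairMatrix L)⁻¹ * S with hc
  have hdiag (i : D) : c i i = 0 := by
    have := key i i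
    rw [ExteriorAlgebra.ι_sq_zero, mul_zero, map_zero] at this
    exact (mul_eq_zero.1 this.symm).resolve_right hz
  have hskew : c k h = - c h k := by
    have h1 := key h k
    have h2 := key k h
    have h3 := ExteriorAlgebra.ι_add_mul_swap (R := ℂ) (Pi.single k 1 : D → ℂ) (Pi.single h 1)
    have h4 : (c k h + c h k) * skewFunctional S hS (basisPairProd L) = 0 := by
      rw [add_mul, ← h1, ← h2, ← map_add, ← mul_add, h3, mul_zero, map_zero]
    exact eq_neg_of_add_eq_zero_left ((mul_eq_zero.1 h4).resolve_right hz)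
  have hN : 1 - S * pairMatrix ((x, h, k) :: L) = (1 - S * pairMatrix L) *
      (1 - c * (x • (Matrix.single h k 1 - Matrix.single k h 1))) := by
    have : pairMatrix ((x, h, k) :: L) = x • (Matrix.single h k 1 -
      Matrix.single k h 1) + pairMatrix L := by simp [pairMatrix]
    rw [mul_sub, mul_one, ← mul_assoc, hc, ← mul_assoc,
      Matrix.mul_nonsing_inv _ (isUnit_iff_ne_zero.2 hdet), one_mul, this, mul_add, sub_sub,
      add_comm]
  rw [hN, det_mul, det_one_sub_skew_pair x h k (hdiag h) (hdiag k) hskew, ← hL, basisPairProd_cons,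
    map_add, map_smul, key, smul_eq_mul]
  ring

/-- The list of pairs with all weights multiplied by `t`. -/
def scalePairs (t : ℂ) (L : List (ℂ × D × D)) : List (ℂ × D × D) :=
  L.map fun p => (t * p.1, p.2)

theorem pairMatrix_scalePairs (t : ℂ) (L : List (ℂ × D × D)) :
    pairMatrix (scalePairs t L) = t • pairMatrix L := by
  induction L with
  | nil => simp [pairMatrix, scalePairs]
  | cons p L ih =>
    simp only [pairMatrix, scalePairs, List.map_cons, List.sum_cons] at ih ⊢
    rw [ih, smul_add, smul_smul]

theorem continuous_functional_basisPairProd (f : ExteriorAlgebra ℂ (D → ℂ) →ₗ[ℂ] ℂ)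
    (L : List (ℂ × D × D)) (y : ExteriorAlgebra ℂ (D → ℂ)) :
    Continuous fun t : ℂ => f (basisPairProd (scalePairs t L) * y) := by
  induction L generalizing y with
  | nil => simpa [scalePairs, basisPairProd, pairProd] using continuous_const
  | cons p L ih =>
    obtain ⟨x, h, k⟩ := p
    have (t : ℂ) : f (basisPairProd (scalePairs t ((x, h, k) :: L)) * y) =
        f (basisPairProd (scalePairs t L) * y) + (t * x) * f (basisPairProd (scalePairs t L) *
          (ExteriorAlgebra.ι ℂ (Pi.single h 1) * ExteriorAlgebra.ι ℂ (Pi.single k 1) * y)) := by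
      have : scalePairs t ((x, h, k) :: L) = (t * x, h, k) :: scalePairs t L := rfl
      rw [this, basisPairProd_cons, add_mul, map_add, smul_mul_assoc, map_smul, smul_eq_mul,
        mul_assoc (basisPairProd _)]
    simp only [this]
    have h1 := ih y
    have h2 := ih (ExteriorAlgebra.ι ℂ (Pi.single h 1) * ExteriorAlgebra.ι ℂ (Pi.single k 1) * y)
    exact h1.add ((continuous_id.mul continuous_const).mul h2)

theorem dense_det_one_sub_smul_ne_zero (A : Matrix D D ℂ) :
    Dense {t : ℂ | (1 - t • A).det ≠ 0} := by
  have h (t : ℂ) : (1 - t • A).det = A.charpolyRev.eval t := by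
    rw [Matrix.charpolyRev, ← Polynomial.coe_evalRingHom, RingHom.map_det]
    congr 1
    ext i j
    simp [Matrix.one_apply, apply_ite, mul_comm t]
  have hf : {t : ℂ | (1 - t • A).det = 0}.Finite := by
    have h0 : A.charpolyRev ≠ 0 := by
      intro h0; have := Matrix.eval_charpolyRev (M := A); rw [h0] at this; simp at this
    refine (A.charpolyRev.roots.toFinset.finite_toSet).subset fun t ht => ?_
    simp only [Set.mem_ofPred_eq, h] at ht
    simp [h0, ht]
  exact Set.Countable.dense_compl ℂ hf.countable

/-- The square of the Pfaffian functional is a determinant. -/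
theorem skewFunctional_basisPairProd_sq (L : List (ℂ × D × D)) :
    skewFunctional S hS (basisPairProd L) ^ 2 = (1 - S * pairMatrix L).det := by
  have main : ∀ t : ℂ, skewFunctional S hS (basisPairProd (scalePairs t L)) ^ 2 =
      (1 - S * pairMatrix (scalePairs t L)).det := by
    induction L with
    | nil => simp [basisPairProd, pairProd, pairMatrix, skewFunctional, scalePairs]
    | cons p L ih =>
      refine congrFun (Continuous.ext_on
        (dense_det_one_sub_smul_ne_zero (S * pairMatrix L)) ?_ ?_ fun t ht => ?_)
      · have := continuous_functional_basisPairProd (skewFunctional S hS) (p :: L) 1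
        simp only [mul_one] at this
        fun_prop
      · simp only [pairMatrix_scalePairs]
        refine Continuous.matrix_det ?_
        fun_prop
      · refine skewFunctional_sq_cons_of_det_ne_zero S hS (t * p.1) p.2.1 p.2.2 (scalePairs t L)
          (ih t) ?_
        simpa [pairMatrix_scalePairs] using ht
  simpa [scalePairs] using main 1

end PfaffianDeterminant

section SortedProducts

open CliffordAlgebra Matrix

variable {D W : Type*} [Fintype D] [LinearOrder D] [DecidableEq W]

/-- The exterior product of the basis vectors of a finite set in increasing order. -/
noncomputable def sortedProd (H : Finset D) : ExteriorAlgebra ℂ (D → ℂ) :=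
  ((H.sort (· ≤ ·)).map fun h => ExteriorAlgebra.ι ℂ (Pi.single h 1 : D → ℂ)).prod

omit [Fintype D] in
@[simp]
theorem sortedProd_empty : sortedProd (∅ : Finset D) = 1 := by simp [sortedProd]

omit [Fintype D] in
theorem sortedProd_insert_of_lt {a : D} {H : Finset D} (ha : ∀ b ∈ H, a < b) :
    sortedProd (insert a H) = ExteriorAlgebra.ι ℂ (Pi.single a 1 : D → ℂ) * sortedProd H := by
  rw [sortedProd, Finset.sort_insert _ (fun b hb => (ha b hb).le) (fun h => lt_irrefl _ (ha a h))]
  simp [sortedProd]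

omit [Fintype D] in
theorem ι_mul_sortedProd {h : D} {H : Finset D} (hh : h ∉ H) :
    ExteriorAlgebra.ι ℂ (Pi.single h 1 : D → ℂ) * sortedProd H =
      (-1 : ℂ) ^ (H.filter (· < h)).card • sortedProd (insert h H) := by
  induction H using Finset.induction_on_min with
  | empty => simp [sortedProd]
  | insert a H ha ih =>
    simp only [Finset.mem_insert, not_or] at hh
    rcases lt_or_gt_of_ne hh.1 with hlt | hlt
    · have h1 : ∀ b ∈ insert a H, h < b := by
        simp only [Finset.mem_insert, forall_eq_or_imp]
        exact ⟨hlt, fun b hb => hlt.trans (ha b hb)⟩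
      have : (insert a H).filter (· < h) = ∅ := by
        rw [Finset.filter_eq_empty_iff]
        exact fun b hb => (h1 b hb).not_gt
      rw [this, sortedProd_insert_of_lt h1]
      simp
    · have h1 : ∀ b ∈ insert h H, a < b := by
        simp only [Finset.mem_insert, forall_eq_or_imp]
        exact ⟨hlt, ha⟩
      have h2 : a ∉ H.filter (· < h) := fun h => lt_irrefl _ (ha a (Finset.mem_filter.1 h).1)
      rw [Finset.filter_insert, if_pos hlt, Finset.card_insert_of_notMem h2,
        Finset.insert_comm, sortedProd_insert_of_lt h1, sortedProd_insert_of_lt ha, ← mul_assoc,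
        eq_neg_of_add_eq_zero_left (ExteriorAlgebra.ι_add_mul_swap (R := ℂ) (Pi.single h 1 : D → ℂ)
          (Pi.single a 1)), neg_mul, mul_assoc, ih hh.2, mul_smul_comm, pow_succ]
      simp

omit [Fintype D] in
theorem contractLeft_sortedProd_eq_zero {d : Module.Dual ℂ (D → ℂ)} {H : Finset D}
    (hd : ∀ k ∈ H, d (Pi.single k 1) = 0) :
    contractLeft (Q := (0 : QuadraticForm ℂ (D → ℂ))) d (sortedProd H) = 0 := by
  induction H using Finset.induction_on_min with
  | empty =>
    rw [sortedProd_empty]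
    exact contractLeft_one _ d
  | insert a H ha ih =>
    rw [sortedProd_insert_of_lt ha]
    refine (contractLeft_ι_mul d (Pi.single a 1) (sortedProd H)).trans ?_
    rw [hd a (Finset.mem_insert_self a H), ih fun k hk => hd k (Finset.mem_insert_of_mem hk)]
    simp

omit [Fintype D] in
theorem contractLeft_sortedProd_congr {d d' : Module.Dual ℂ (D → ℂ)} {H : Finset D}
    (hd : ∀ k ∈ H, d (Pi.single k 1) = d' (Pi.single k 1)) :
    contractLeft (Q := (0 : QuadraticForm ℂ (D → ℂ))) d (sortedProd H) =
      contractLeft (Q := (0 : QuadraticForm ℂ (D → ℂ))) d' (sortedProd H) := by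
  rw [← sub_eq_zero, ← LinearMap.sub_apply, ← map_sub]
  exact contractLeft_sortedProd_eq_zero fun k hk => by simp [hd k hk]

/-- The skew-symmetric matrix with entries `±1` between elements with the same image under `p`. -/
def orderSign (p : D → W) : Matrix D D ℂ :=
  Matrix.of fun h k => if p h = p k then (if h < k then 1 else if k < h then -1 else 0) else 0

omit [Fintype D] in
theorem orderSign_transpose (p : D → W) : (orderSign p)ᵀ = -orderSign p := by
  ext h k
  simp only [orderSign, Matrix.transpose_apply, Matrix.neg_apply, Matrix.of_apply, eq_comm (a := p k)]
  rcases lt_trichotomy h k with hlt | rfl | hlt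
  · simp [hlt, hlt.not_gt]
    split_ifs <;> simp
  · simp
  · simp [hlt, hlt.not_gt]
    split_ifs <;> simp

theorem toBilin'_single_single (S : Matrix D D ℂ) (h k : D) :
    Matrix.toBilin' S (Pi.single h 1) (Pi.single k 1) = S h k := by
  simp

open Classical in
theorem skewFunctional_sortedProd (p : D → W)
    (hp : ∀ a b c : D, a ≤ b → b ≤ c → p a = p c → p b = p a) (H : Finset D) :
    skewFunctional (orderSign p) (orderSign_transpose p) (sortedProd H) =
      if ∀ v : W, Even (H.filter (fun h => p h = v)).card then 1 else 0 := by
  induction hn : H.card using Nat.strong_induction_on generalizing H with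
  | _ n ih =>
  rcases H.eq_empty_or_nonempty with rfl | hne
  · simp [skewFunctional]
  set a := H.min' hne with ha
  set H' := H.erase a with hH'
  have haH : a ∈ H := Finset.min'_mem _ _
  have hins : insert a H' = H := Finset.insert_erase haH
  have hlt : ∀ b ∈ H', a < b := fun b hb => Finset.min'_lt_of_mem_erase_min' _ _ hb
  have haH' : a ∉ H' := Finset.notMem_erase _ _
  by_cases hex : ∃ c ∈ H', p c = p a
  · obtain ⟨c, hc, hpc⟩ := hex
    have hne' : H'.Nonempty := ⟨c, hc⟩
    set b := H'.min' hne' with hb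
    set H'' := H'.erase b with hH''
    have hbH : b ∈ H' := Finset.min'_mem _ _
    have hins' : insert b H'' = H' := Finset.insert_erase hbH
    have hlt' : ∀ k ∈ H'', b < k := fun k hk => Finset.min'_lt_of_mem_erase_min' _ _ hk
    have hbH' : b ∉ H'' := Finset.notMem_erase _ _
    have hpb : p b = p a := hp a b c (hlt b hbH).le (Finset.min'_le _ _ hc) hpc.symm
    have hcard : H''.card < n := by
      rw [← hn, ← hins, ← hins', Finset.card_insert_of_notMem (by rwa [hins']),
        Finset.card_insert_of_notMem hbH']
      omega
    have hS : skewFunctional (orderSign p) (orderSign_transpose p) (sortedProd H) =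
        skewFunctional (orderSign p) (orderSign_transpose p) (sortedProd H'') := by
      have hab : a < b := hlt b hbH
      rw [← hins, ← hins', sortedProd_insert_of_lt (by rwa [hins']), sortedProd_insert_of_lt hlt',
        skewFunctional, pfaffianFunctional_ι_mul]
      have : contractLeft (Q := (0 : QuadraticForm ℂ (D → ℂ)))
          (Matrix.toBilin' (orderSign p) (Pi.single a 1))
          (ExteriorAlgebra.ι ℂ (Pi.single b 1 : D → ℂ) * sortedProd H'') =
          sortedProd H'' - ExteriorAlgebra.ι ℂ (Pi.single b 1 : D → ℂ) *
            contractLeft (Q := (0 : QuadraticForm ℂ (D → ℂ)))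
              (Matrix.toBilin' (orderSign p) (Pi.single b 1)) (sortedProd H'') := by
        refine (contractLeft_ι_mul _ (Pi.single b 1) (sortedProd H'')).trans ?_
        rw [toBilin'_single_single, contractLeft_sortedProd_congr
          (d' := Matrix.toBilin' (orderSign p) (Pi.single b 1))]
        · simp [orderSign, hpb, hab]
        · intro k hk
          have h1 := hlt' k hk
          simp [orderSign, hpb, h1, hab.trans h1]
      rw [this, map_sub, pfaffianFunctional_ι_mul, contractLeft_contractLeft, map_zero, sub_zero]
    rw [hS, ih _ hcard _ rfl]
    congr 1
    refine propext (forall_congr' fun v => ?_)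
    rw [← hins, ← hins', Finset.filter_insert, Finset.filter_insert, hpb]
    split_ifs with hv
    · rw [Finset.card_insert_of_notMem, Finset.card_insert_of_notMem]
      · simp [Nat.even_add_one]
      · simp [hbH']
      · simp only [Finset.mem_insert, Finset.mem_filter, not_or]
        exact ⟨(hlt b hbH).ne, fun h => haH' (Finset.mem_of_mem_erase h.1)⟩
    · rfl
  · push Not at hex
    have h0 : ¬ ∀ v : W, Even (H.filter (fun h => p h = v)).card := by
      intro h
      have := h (p a)
      rw [← hins, Finset.filter_insert, if_pos rfl, Finset.filter_eq_empty_iff.2 (fun c hc => hex c hc)] at this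
      simp at this
    rw [if_neg h0, ← hins, sortedProd_insert_of_lt hlt, skewFunctional, pfaffianFunctional_ι_mul,
      contractLeft_sortedProd_eq_zero, map_zero]
    intro k hk
    simp [orderSign, (hex k hk).symm]

variable {E : Type*} [DecidableEq E]

/-- The number of the ends `lo f`, `hi f` strictly between `lo e` and `hi e`. -/
def endsBetween (lo hi : E → D) (e f : E) : ℕ :=
  (if lo e < lo f ∧ lo f < hi e then 1 else 0) + (if lo e < hi f ∧ hi f < hi e then 1 else 0)

/-- The ends of a set of arcs. -/
def arcEnds (lo hi : E → D) (F : Finset E) : Finset D := F.biUnion fun e => {lo e, hi e}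

omit [Fintype D] in
theorem pair_mul_sortedProd {lo hi : E → D} (hlt : ∀ e, lo e < hi e)
    (hdisj : ∀ e f, e ≠ f → lo e ≠ lo f ∧ lo e ≠ hi f ∧ hi e ≠ lo f ∧ hi e ≠ hi f)
    {e : E} {F : Finset E} (he : e ∉ F) :
    ExteriorAlgebra.ι ℂ (Pi.single (lo e) 1 : D → ℂ) * ExteriorAlgebra.ι ℂ (Pi.single (hi e) 1) *
      sortedProd (arcEnds lo hi F) = (-1 : ℂ) ^ (∑ f ∈ F, endsBetween lo hi e f) •
        sortedProd (arcEnds lo hi (insert e F)) := by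
  have hmem (f : E) (hf : f ∈ F) : e ≠ f := fun h => he (h ▸ hf)
  have h1 : hi e ∉ arcEnds lo hi F := by
    simp only [arcEnds, Finset.mem_biUnion, Finset.mem_insert, Finset.mem_singleton, not_exists,
      not_and, not_or]
    exact fun f hf => ⟨(hdisj e f (hmem f hf)).2.2.1, (hdisj e f (hmem f hf)).2.2.2⟩
  have h2 : lo e ∉ insert (hi e) (arcEnds lo hi F) := by
    simp only [arcEnds, Finset.mem_biUnion, Finset.mem_insert, Finset.mem_singleton, not_exists,
      not_and, not_or]
    exact ⟨(hlt e).ne, fun f hf => ⟨(hdisj e f (hmem f hf)).1, (hdisj e f (hmem f hf)).2.1⟩⟩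
  have h3 : insert (lo e) (insert (hi e) (arcEnds lo hi F)) = arcEnds lo hi (insert e F) := by
    simp [arcEnds, Finset.biUnion_insert, Finset.insert_union]
  have h4 : (insert (hi e) (arcEnds lo hi F)).filter (· < lo e) =
      (arcEnds lo hi F).filter (· < lo e) := by
    rw [Finset.filter_insert, if_neg (hlt e).not_gt]
  have h5 : ((arcEnds lo hi F).filter (· < hi e)).card = ((arcEnds lo hi F).filter (· < lo e)).card +
      ((arcEnds lo hi F).filter (fun k => lo e < k ∧ k < hi e)).card := by
    rw [← Finset.card_union_of_disjoint]
    · congr 1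
      ext k
      simp only [Finset.mem_filter, Finset.mem_union]
      constructor
      · rintro ⟨hk, hk'⟩
        rcases lt_trichotomy k (lo e) with h | h | h
        · exact Or.inl ⟨hk, h⟩
        · exact absurd (Finset.mem_insert_of_mem (h ▸ hk)) h2
        · exact Or.inr ⟨hk, h, hk'⟩
      · rintro (⟨hk, h⟩ | ⟨hk, h, h'⟩)
        · exact ⟨hk, h.trans (hlt e)⟩
        · exact ⟨hk, h'⟩
    · rw [Finset.disjoint_filter]
      exact fun k _ h h' => lt_asymm h h'.1
  have h6 : ((arcEnds lo hi F).filter (fun k => lo e < k ∧ k < hi e)).card =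
      ∑ f ∈ F, endsBetween lo hi e f := by
    rw [arcEnds, Finset.filter_biUnion, Finset.card_biUnion]
    · refine Finset.sum_congr rfl fun f _ => ?_
      rw [endsBetween, Finset.filter_insert, Finset.filter_singleton]
      have := (hlt f).ne
      split_ifs <;> simp [this]
    · intro f _ g _ hfg
      obtain ⟨d1, d2, d3, d4⟩ := hdisj f g hfg
      rw [Function.onFun, Finset.disjoint_left]
      simp only [Finset.mem_filter, Finset.mem_insert, Finset.mem_singleton]
      rintro k ⟨rfl | rfl, -⟩ ⟨h | h, -⟩ <;> contradiction
  rw [mul_assoc, ι_mul_sortedProd h1, mul_smul_comm, ι_mul_sortedProd h2, h3, h4, h5, h6, smul_smul]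
  congr 1
  rw [pow_add, mul_right_comm, ← mul_pow]
  simp

omit [Fintype D] in
theorem basisPairProd_eq_sum {lo hi : E → D} (hlt : ∀ e, lo e < hi e)
    (hdisj : ∀ e f, e ≠ f → lo e ≠ lo f ∧ lo e ≠ hi f ∧ hi e ≠ lo f ∧ hi e ≠ hi f)
    (x : E → ℂ) (s : Finset E → ℂ) (hs0 : s ∅ = 1)
    (hs : ∀ e F, e ∉ F → s (insert e F) = (-1 : ℂ) ^ (∑ f ∈ F, endsBetween lo hi e f) * s F)
    (L : List E) (hL : L.Nodup) :
    basisPairProd (L.map fun e => (x e, lo e, hi e)) =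
      ∑ F ∈ L.toFinset.powerset, (s F * ∏ e ∈ F, x e) • sortedProd (arcEnds lo hi F) := by
  induction L with
  | nil => simp [basisPairProd, pairProd, hs0, arcEnds]
  | cons e L ih =>
    rw [List.nodup_cons] at hL
    have he : e ∉ L.toFinset := by simpa using hL.1
    have h1 : basisPairProd ((e :: L).map fun e => (x e, lo e, hi e)) =
        (1 + x e • (ExteriorAlgebra.ι ℂ (Pi.single (lo e) 1) *
          ExteriorAlgebra.ι ℂ (Pi.single (hi e) 1))) *
          basisPairProd (L.map fun e => (x e, lo e, hi e)) := by
      simp [basisPairProd, pairProd]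
    rw [h1, ih hL.2, List.toFinset_cons, Finset.sum_powerset_insert he, add_mul, one_mul,
      smul_mul_assoc, Finset.mul_sum, Finset.smul_sum]
    congr 1
    refine Finset.sum_congr rfl fun F hF => ?_
    have heF : e ∉ F := fun h => he (Finset.mem_powerset.1 hF h)
    rw [mul_smul_comm, pair_mul_sortedProd hlt hdisj heF, Finset.prod_insert heF, hs e F heF,
      smul_smul, smul_smul]
    congr 1
    ring

end SortedProducts

section SegmentGeometry

/-- The cross product of two plane vectors. -/
def planeCross (z w : ℂ) : ℝ := z.re * w.im - z.im * w.re

/-- Twice the signed area of the triangle `u v w`. -/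
def orient (u v w : ℂ) : ℝ := planeCross (v - u) (w - u)

theorem mem_segment_of_orient_eq_zero {u v y : ℂ} (h : u.im < v.im) (h1 : u.im ≤ y.im)
    (h2 : y.im ≤ v.im) (h0 : orient u v y = 0) : y ∈ segment ℝ u v := by
  have hd : 0 < v.im - u.im := by linarith
  rw [segment_eq_image']
  refine ⟨(y.im - u.im) / (v.im - u.im), ⟨by apply div_nonneg <;> linarith,
    by rw [div_le_one hd]; linarith⟩, ?_⟩
  simp only [orient, planeCross, Complex.sub_re, Complex.sub_im] at h0
  apply Complex.ext
  · simp only [Complex.add_re, Complex.smul_re, smul_eq_mul, Complex.sub_re]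
    field_simp
    linarith
  · simp only [Complex.add_im, Complex.smul_im, smul_eq_mul, Complex.sub_im]
    field_simp
    ring

theorem orient_eq_zero_of_mem_segment {u v y : ℂ} (h : y ∈ segment ℝ u v) : orient u v y = 0 := by
  rw [segment_eq_image'] at h
  obtain ⟨t, -, rfl⟩ := h
  simp [orient, planeCross]
  ring

theorem exists_mem_segments_of_orient_mul_neg {u v p q : ℂ} (h : u.im < v.im) (hp1 : u.im ≤ p.im)
    (hp2 : p.im ≤ v.im) (hq1 : u.im ≤ q.im) (hq2 : q.im ≤ v.im)
    (ho : orient u v p * orient u v q < 0) : ∃ y ∈ segment ℝ u v, y ∈ segment ℝ p q := by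
  set a := orient u v p with ha
  set b := orient u v q with hb
  have hab : a - b ≠ 0 := by
    intro h0
    have : a = b := by linarith
    rw [this] at ho
    nlinarith [mul_self_nonneg b]
  have ht : 0 ≤ a / (a - b) ∧ a / (a - b) ≤ 1 := by
    rcases lt_or_gt_of_ne hab with hlt | hlt
    · refine ⟨div_nonneg_of_nonpos ?_ hlt.le, (div_le_one_of_neg hlt).2 ?_⟩ <;> nlinarith
    · refine ⟨div_nonneg ?_ hlt.le, (div_le_one hlt).2 ?_⟩ <;> nlinarith
  have hta : a / (a - b) * (a - b) = a := div_mul_cancel₀ a hab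
  generalize a / (a - b) = t at ht hta
  have him : (p + t • (q - p)).im = (1 - t) * p.im + t * q.im := by
    simp only [Complex.add_im, Complex.smul_im, smul_eq_mul, Complex.sub_im]
    ring
  refine ⟨p + t • (q - p), mem_segment_of_orient_eq_zero h ?_ ?_ ?_, ?_⟩
  · rw [him]
    nlinarith [ht.1, ht.2]
  · rw [him]
    nlinarith [ht.1, ht.2]
  · have : orient u v (p + t • (q - p)) = a + t * (b - a) := by
      simp only [ha, hb, orient, planeCross, Complex.add_re, Complex.add_im, Complex.smul_re,
        Complex.smul_im, smul_eq_mul, Complex.sub_re, Complex.sub_im]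
      ring
    rw [this]
    linarith
  · rw [segment_eq_image']
    exact ⟨t, ht, rfl⟩

theorem im_mem_of_mem_segment {u v y : ℂ} (h : u.im ≤ v.im) (hy : y ∈ segment ℝ u v) :
    u.im ≤ y.im ∧ y.im ≤ v.im := by
  rw [segment_eq_image'] at hy
  obtain ⟨t, ⟨ht0, ht1⟩, rfl⟩ := hy
  simp
  constructor <;> nlinarith

/-- Segments whose height ranges are nested. -/
theorem exists_mem_segments_iff_of_nested {u v p q : ℂ} (h : u.im < v.im) (hp1 : u.im < p.im)
    (hpq : p.im < q.im) (hq2 : q.im < v.im)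
    (hp : p ∉ segment ℝ u v) (hq : q ∉ segment ℝ u v) :
    (∃ y ∈ segment ℝ u v, y ∈ segment ℝ p q) ↔ ¬ (orient u v p < 0 ↔ orient u v q < 0) := by
  have hp0 : orient u v p ≠ 0 := fun h0 =>
    hp (mem_segment_of_orient_eq_zero h (by linarith) (by linarith) h0)
  have hq0 : orient u v q ≠ 0 := fun h0 =>
    hq (mem_segment_of_orient_eq_zero h (by linarith) (by linarith) h0)
  constructor
  · rintro ⟨y, hy, hy'⟩
    rw [segment_eq_image'] at hy'
    obtain ⟨t, ⟨ht0, ht1⟩, rfl⟩ := hy'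
    have h0 := orient_eq_zero_of_mem_segment hy
    have : orient u v (p + t • (q - p)) = (1 - t) * orient u v p + t * orient u v q := by
      simp [orient, planeCross]
      ring
    rw [this] at h0
    intro hiff
    rcases lt_or_gt_of_ne hp0 with h1 | h1
    · have h2 := hiff.1 h1
      rcases ht0.eq_or_lt with rfl | ht
      · linarith
      · nlinarith
    · have h2 : 0 < orient u v q := lt_of_le_of_ne (not_lt.1 fun h => by linarith [hiff.2 h]) hq0.symm
      rcases ht0.eq_or_lt with rfl | ht
      · linarith
      · nlinarith
  · intro hne
    refine exists_mem_segments_of_orient_mul_neg h hp1.le (by linarith) (by linarith) hq2.le ?_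
    rcases lt_or_gt_of_ne hp0 with h1 | h1 <;> rcases lt_or_gt_of_ne hq0 with h2 | h2
    · exact absurd (iff_of_true h1 h2) hne
    · exact mul_neg_of_neg_of_pos h1 h2
    · exact mul_neg_of_pos_of_neg h1 h2
    · exact absurd (iff_of_false h1.not_gt h2.not_gt) hne

/-- Segments whose height ranges are interleaved. -/
theorem exists_mem_segments_iff_of_interleaved {u v p q : ℂ} (hup : u.im < p.im)
    (hpv : p.im < v.im) (hvq : v.im < q.im)
    (hp : p ∉ segment ℝ u v) (hv : v ∉ segment ℝ p q) :
    (∃ y ∈ segment ℝ u v, y ∈ segment ℝ p q) ↔ (orient u v p < 0 ↔ orient p q v < 0) := by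
  have huv : u.im < v.im := hup.trans hpv
  have hpq : p.im < q.im := hpv.trans hvq
  have hp0 : orient u v p ≠ 0 := fun h0 =>
    hp (mem_segment_of_orient_eq_zero huv (by linarith) (by linarith) h0)
  have hv0 : orient p q v ≠ 0 := fun h0 =>
    hv (mem_segment_of_orient_eq_zero hpq (by linarith) (by linarith) h0)
  constructor
  · rintro ⟨y, hy, hy'⟩
    have h1 := orient_eq_zero_of_mem_segment hy
    have h2 := orient_eq_zero_of_mem_segment hy'
    rw [segment_symm, segment_eq_image'] at hy
    rw [segment_eq_image'] at hy'
    obtain ⟨s, ⟨hs0, hs1⟩, rfl⟩ := hy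
    obtain ⟨t, ⟨ht0, ht1⟩, he⟩ := hy'
    simp only at he
    set c := planeCross (v - u) (q - p) with hc
    have e1 : orient u v p = - t * c := by
      have : orient u v (p + t • (q - p)) = orient u v p + t * c := by
        simp [orient, planeCross, hc]; ring
      rw [he, h1] at this
      linarith
    have e2 : orient p q v = - s * c := by
      have : orient p q (v + s • (u - v)) = orient p q v + s * c := by
        simp [orient, planeCross, hc]; ring
      rw [h2] at this
      linarith
    have ht : 0 < t := lt_of_le_of_ne ht0 (by rintro rfl; simp at e1; exact hp0 e1)
    have hs : 0 < s := lt_of_le_of_ne hs0 (by rintro rfl; simp at e2; exact hv0 e2)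
    rw [e1, e2]
    constructor <;> intro h <;> nlinarith
  · intro hiff
    have hd : 0 < q.im - p.im := by linarith
    set τ := (v.im - p.im) / (q.im - p.im) with hτ
    have hτ0 : 0 ≤ τ := by apply div_nonneg <;> linarith
    have hτ1 : τ ≤ 1 := by rw [hτ, div_le_one hd]; linarith
    have hw : p + τ • (q - p) ∈ segment ℝ p q := by
      rw [segment_eq_image']
      exact ⟨τ, ⟨hτ0, hτ1⟩, rfl⟩
    have him : (p + τ • (q - p)).im = v.im := by
      simp only [Complex.add_im, Complex.smul_im, smul_eq_mul, Complex.sub_im, hτ]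
      field_simp
      ring
    have key : orient u v (p + τ • (q - p)) * (q.im - p.im) = -(orient p q v * (v.im - u.im)) := by
      have : τ * (q.im - p.im) = v.im - p.im := by rw [hτ]; field_simp
      simp only [orient, planeCross, Complex.sub_re, Complex.sub_im, Complex.add_re, Complex.add_im,
        Complex.real_smul, Complex.mul_re, Complex.mul_im, Complex.ofReal_re, Complex.ofReal_im]
      linear_combination ((v.re - u.re) * (q.im - p.im) - (v.im - u.im) * (q.re - p.re)) * this
    have hneg : orient u v p * orient u v (p + τ • (q - p)) < 0 := by
      have hu : 0 < v.im - u.im := by linarith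
      rcases lt_or_gt_of_ne hp0 with h1 | h1
      · have h2 := hiff.1 h1
        exact mul_neg_of_neg_of_pos h1 (by
          by_contra h3
          nlinarith [mul_neg_of_neg_of_pos h2 hu])
      · have h2 : 0 < orient p q v :=
          lt_of_le_of_ne (not_lt.1 fun h => by linarith [hiff.2 h]) hv0.symm
        exact mul_neg_of_pos_of_neg h1 (by
          by_contra h3
          nlinarith [mul_pos h2 hu])
    obtain ⟨y, hy, hy'⟩ := exists_mem_segments_of_orient_mul_neg huv hup.le hpv.le
      (by rw [him]; exact huv.le) (by rw [him]) hneg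
    exact ⟨y, hy, (convex_segment p q).segment_subset (left_mem_segment ℝ p q) hw hy'⟩

/-- Segments with a common end that contain no other end meet in the common end only. -/
theorem eq_of_mem_segments {z v w y : ℂ} (hv : v ∉ segment ℝ z w) (hw : w ∉ segment ℝ z v)
    (h1 : y ∈ segment ℝ z v) (h2 : y ∈ segment ℝ z w) : y = z := by
  rw [segment_eq_image'] at h1 h2 hv hw
  obtain ⟨t, ⟨ht0, ht1⟩, rfl⟩ := h1
  obtain ⟨s, ⟨hs0, hs1⟩, he⟩ := h2
  simp only [add_right_inj] at he
  rcases ht0.eq_or_lt with rfl | ht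
  · simp
  rcases hs0.eq_or_lt with rfl | hs
  · simp only [zero_smul] at he
    simp [← he]
  exfalso
  rcases le_total t s with hts | hts
  · refine hw ⟨t / s, ⟨by positivity, (div_le_one hs).2 hts⟩, ?_⟩
    simp only
    rw [div_eq_inv_mul, mul_smul, ← he, smul_smul, inv_mul_cancel₀ hs.ne', one_smul]
    ring
  · refine hv ⟨s / t, ⟨by positivity, (div_le_one ht).2 hts⟩, ?_⟩
    simp only
    rw [div_eq_inv_mul, mul_smul, he, smul_smul, inv_mul_cancel₀ ht.ne', one_smul]
    ring

theorem arg_lt_arg_iff_of_im_pos {z w : ℂ} (hz : 0 < z.im) (hw : 0 < w.im) :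
    z.arg < w.arg ↔ 0 < planeCross z w := by
  have hz0 : z ≠ 0 := by rintro rfl; simp at hz
  have hw0 : w ≠ 0 := by rintro rfl; simp at hw
  have hzn : 0 < ‖z‖ := norm_pos_iff.2 hz0
  have hwn : 0 < ‖w‖ := norm_pos_iff.2 hw0
  have e : planeCross z w = ‖z‖ * ‖w‖ * Real.sin (w.arg - z.arg) := by
    rw [Real.sin_sub, Complex.sin_arg, Complex.sin_arg, Complex.cos_arg hz0, Complex.cos_arg hw0,
      planeCross]
    field_simp
  have a1 := Complex.arg_lt_pi_iff.2 (Or.inr hz.ne')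
  have a2 := Complex.arg_lt_pi_iff.2 (Or.inr hw.ne')
  have a3 := Complex.arg_nonneg_iff.2 hz.le
  have a4 := Complex.arg_nonneg_iff.2 hw.le
  rw [e]
  constructor
  · intro h
    have := Real.sin_pos_of_pos_of_lt_pi (x := w.arg - z.arg) (by linarith) (by linarith)
    positivity
  · intro h
    by_contra hle
    have := Real.sin_nonpos_of_nonpos_of_neg_pi_le (x := w.arg - z.arg) (by linarith) (by linarith)
    have h3 := mul_pos hzn hwn
    nlinarith

theorem arg_lt_arg_iff_of_im_neg {z w : ℂ} (hz : z.im < 0) (hw : w.im < 0) :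
    z.arg < w.arg ↔ 0 < planeCross z w := by
  have h1 : (-z).arg = z.arg + Real.pi := Complex.arg_neg_eq_arg_add_pi_of_im_neg hz
  have h2 : (-w).arg = w.arg + Real.pi := Complex.arg_neg_eq_arg_add_pi_of_im_neg hw
  have := arg_lt_arg_iff_of_im_pos (z := -z) (w := -w) (by simpa) (by simpa)
  rw [h1, h2, add_lt_add_iff_right] at this
  rw [this]
  simp [planeCross]

end SegmentGeometry

section DartOrder

variable {V : Type*} {H : SimpleGraph V} {q : V → ℂ}

/-- Straight edges in general position with respect to height: the heights of the vertices are
distinct, and edges contain no vertices but their ends. -/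
structure IsGenericDrawing (H : SimpleGraph V) (q : V → ℂ) : Prop where
  im_injective : Function.Injective fun v => (q v).im
  eq_of_mem_segment : ∀ u v w, H.Adj u v → q w ∈ segment ℝ (q u) (q v) → w = u ∨ w = v

/-- Darts are compared by the heights of their origins, then by their directions. -/
noncomputable def dartKey (q : V → ℂ) (d : H.Dart) : ℝ ×ₗ ℝ :=
  toLex ((q d.fst).im, (q d.snd - q d.fst).arg)

theorem IsGenericDrawing.injective (hq : IsGenericDrawing H q) : Function.Injective q :=
  fun u v h => hq.im_injective (by simp [h])

theorem IsGenericDrawing.im_ne (hq : IsGenericDrawing H q) {u v : V} (h : u ≠ v) :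
    (q u).im ≠ (q v).im := fun h' => h (hq.im_injective h')

theorem IsGenericDrawing.eq_of_arg_eq (hq : IsGenericDrawing H q) {u v w : V} (hv : H.Adj u v)
    (hw : H.Adj u w) (h : (q v - q u).arg = (q w - q u).arg) : v = w := by
  have hv0 : q v - q u ≠ 0 := sub_ne_zero.2 fun h => hv.ne (hq.injective h).symm
  have hw0 : q w - q u ≠ 0 := sub_ne_zero.2 fun h => hw.ne (hq.injective h).symm
  rw [Complex.arg_eq_arg_iff hv0 hw0] at h
  have hr : 0 < ‖q w - q u‖ / ‖q v - q u‖ := div_pos (norm_pos_iff.2 hw0) (norm_pos_iff.2 hv0)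
  have h' : (‖q w - q u‖ / ‖q v - q u‖) • (q v - q u) = q w - q u := by
    rw [Complex.real_smul]
    push_cast
    exact h
  generalize ‖q w - q u‖ / ‖q v - q u‖ = r at hr h'
  rcases le_total r 1 with h1 | h1
  · have : q w ∈ segment ℝ (q u) (q v) := by
      rw [segment_eq_image']
      exact ⟨r, ⟨hr.le, h1⟩, by simp [h']⟩
    rcases hq.eq_of_mem_segment u v w hv this with h | h
    · exact absurd h hw.ne'
    · exact h.symm
  · have : q v ∈ segment ℝ (q u) (q w) := by
      rw [segment_eq_image']
      refine ⟨r⁻¹, ⟨by positivity, inv_le_one_of_one_le₀ h1⟩, ?_⟩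
      simp only
      rw [← h', smul_smul, inv_mul_cancel₀ hr.ne', one_smul]
      ring
    rcases hq.eq_of_mem_segment u w v hw this with h | h
    · exact absurd h hv.ne'
    · exact h

theorem IsGenericDrawing.dartKey_injective (hq : IsGenericDrawing H q) :
    Function.Injective (dartKey (H := H) q) := by
  rintro ⟨⟨u, v⟩, huv⟩ ⟨⟨u', w⟩, huw⟩ h
  simp only [dartKey, EmbeddingLike.apply_eq_iff_eq, Prod.mk.injEq] at h
  obtain rfl : u = u' := hq.im_injective h.1
  obtain rfl : v = w := hq.eq_of_arg_eq huv huw h.2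
  rfl

/-- The linear order of the darts by their keys. -/
noncomputable abbrev IsGenericDrawing.dartOrder (hq : IsGenericDrawing H q) : LinearOrder H.Dart :=
  LinearOrder.lift' (dartKey q) hq.dartKey_injective

/-- The darts that go upwards. -/
abbrev UpDart (H : SimpleGraph V) (q : V → ℂ) : Type _ :=
  {d : H.Dart // (q d.fst).im < (q d.snd).im}

/-- Whether a vertex lies to the right of an upward dart, at a height between its ends. -/
def IsRightOf (q : V → ℂ) (w : V) (d : H.Dart) : Prop :=
  (q d.fst).im < (q w).im ∧ (q w).im < (q d.snd).im ∧ orient (q d.fst) (q d.snd) (q w) < 0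

/-- Whether two edges, given as darts, cross. -/
def DartsCross (q : V → ℂ) (d e : H.Dart) : Prop :=
  ∃ y, y ∈ segment ℝ (q d.fst) (q d.snd) ∧ y ∈ segment ℝ (q e.fst) (q e.snd) ∧ y ∉ Set.range q

theorem IsGenericDrawing.notMem_segment (hq : IsGenericDrawing H q) {u v w : V} (h : H.Adj u v)
    (h1 : w ≠ u) (h2 : w ≠ v) : q w ∉ segment ℝ (q u) (q v) := fun hw =>
  (hq.eq_of_mem_segment u v w h hw).elim h1 h2

open Classical in
theorem IsGenericDrawing.dartsCross_iff_of_disjoint (hq : IsGenericDrawing H q) {d e : H.Dart}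
    (h : d.fst ≠ e.fst ∧ d.fst ≠ e.snd ∧ d.snd ≠ e.fst ∧ d.snd ≠ e.snd) :
    DartsCross q d e ↔ ∃ y ∈ segment ℝ (q d.fst) (q d.snd), y ∈ segment ℝ (q e.fst) (q e.snd) := by
  refine ⟨fun ⟨y, h1, h2, _⟩ => ⟨y, h1, h2⟩, fun ⟨y, h1, h2⟩ => ⟨y, h1, h2, ?_⟩⟩
  rintro ⟨w, rfl⟩
  rcases hq.eq_of_mem_segment _ _ _ d.adj h1 with h3 | h3 <;>
  rcases hq.eq_of_mem_segment _ _ _ e.adj h2 with h4 | h4 <;> subst h3 <;> tauto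

theorem DartsCross.symm {d e : H.Dart} (h : DartsCross q d e) : DartsCross q e d :=
  let ⟨y, h1, h2, h3⟩ := h
  ⟨y, h2, h1, h3⟩

theorem dartsCross_comm {d e : H.Dart} : DartsCross q d e ↔ DartsCross q e d :=
  ⟨DartsCross.symm, DartsCross.symm⟩

theorem dartsCross_symm_left {d e : H.Dart} : DartsCross q d.symm e ↔ DartsCross q d e := by
  simp only [DartsCross, segment_symm ℝ (q d.symm.fst)]
  rfl

theorem IsGenericDrawing.not_dartsCross_of_fst_eq (hq : IsGenericDrawing H q) {d e : H.Dart}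
    (h : d.fst = e.fst) (hne : d.snd ≠ e.snd) : ¬ DartsCross q d e := by
  rintro ⟨y, h1, h2, h3⟩
  refine h3 ⟨d.fst, (eq_of_mem_segments ?_ ?_ h1 (h ▸ h2)).symm⟩
  · rw [h]
    exact hq.notMem_segment e.adj (h ▸ d.adj.ne') hne
  · exact hq.notMem_segment d.adj (h ▸ e.adj.ne') hne.symm

theorem IsGenericDrawing.not_dartsCross_of_snd_eq (hq : IsGenericDrawing H q) {d e : H.Dart}
    (h : d.snd = e.snd) (hne : d.fst ≠ e.fst) : ¬ DartsCross q d e := by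
  rw [← dartsCross_symm_left, dartsCross_comm, ← dartsCross_symm_left]
  exact hq.not_dartsCross_of_fst_eq (d := e.symm) (e := d.symm) h.symm hne.symm

theorem IsGenericDrawing.not_dartsCross_of_snd_eq_fst (hq : IsGenericDrawing H q) {d e : H.Dart}
    (h : d.snd = e.fst) (hne : d.fst ≠ e.snd) : ¬ DartsCross q d e := by
  rw [← dartsCross_symm_left]
  exact hq.not_dartsCross_of_fst_eq (d := d.symm) h hne

section Parity

variable (hq : IsGenericDrawing H q)

theorem dartOrder_lt_iff {d e : H.Dart} : hq.dartOrder.lt d e ↔ (q d.fst).im < (q e.fst).im ∨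
    (q d.fst).im = (q e.fst).im ∧ (q d.snd - q d.fst).arg < (q e.snd - q e.fst).arg := by
  change dartKey q d < dartKey q e ↔ _
  simp [dartKey, Prod.Lex.toLex_lt_toLex]

open Classical in
/-- Two edges cross if and only if the parity of the ends of one between the ends of the other
differs from the parity of the vertices of one edge to the right of the other edge. -/
theorem even_cross_add_endsBetween (e f : UpDart H q) (hef : e ≠ f) :
    Even ((if DartsCross q e.1 f.1 then 1 else 0) +
      ((if IsRightOf q f.1.fst e.1 then 1 else 0) + (if IsRightOf q f.1.snd e.1 then 1 else 0)) +
      ((if IsRightOf q e.1.fst f.1 then 1 else 0) + (if IsRightOf q e.1.snd f.1 then 1 else 0)) +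
      @endsBetween H.Dart hq.dartOrder (UpDart H q) (fun d => d.1) (fun d => d.1.symm) e f) := by
  obtain ⟨⟨⟨u, v⟩, huv⟩, he⟩ := e
  obtain ⟨⟨⟨p, r⟩, hpr⟩, hf⟩ := f
  have hne : ¬ (u = p ∧ v = r) := by
    rintro ⟨rfl, rfl⟩; exact hef rfl
  simp only at he hf
  simp only [endsBetween, dartOrder_lt_iff, IsRightOf, SimpleGraph.Dart.symm, Prod.swap]
  change H.Adj u v at huv
  change H.Adj p r at hpr
  have hd : ∀ {z : ℂ}, 0 < z.im → 0 < z.arg := fun {z} h => lt_of_le_of_ne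
    (Complex.arg_nonneg_iff.2 h.le) fun h0 => h.ne' (Complex.arg_eq_zero_iff.1 h0.symm).2
  have hd' : ∀ {z : ℂ}, z.im < 0 → z.arg < 0 := fun {z} h => Complex.arg_neg_iff.2 h
  by_cases h1 : u = p
  · subst h1
    have hvr : v ≠ r := fun h => hne ⟨rfl, h⟩
    have hcr : ¬ DartsCross q (⟨(u, v), huv⟩ : H.Dart) (⟨(u, r), hpr⟩ : H.Dart) :=
      hq.not_dartsCross_of_fst_eq rfl hvr
    have harg := arg_lt_arg_iff_of_im_pos (z := q v - q u) (w := q r - q u) (by simpa) (by simpa)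
    have harg' := arg_lt_arg_iff_of_im_pos (w := q v - q u) (z := q r - q u) (by simpa) (by simpa)
    have hanti : planeCross (q r - q u) (q v - q u) = - planeCross (q v - q u) (q r - q u) := by
      simp only [planeCross]; ring
    have hne0 : (q v - q u).arg ≠ (q r - q u).arg := fun h => hvr (hq.eq_of_arg_eq huv hpr h)
    rcases lt_or_gt_of_ne (hq.im_ne hvr) with h | h
    · simp only [hcr, lt_irrefl, he, hf, h, h.not_gt, h.ne', orient, harg]
      rw [hanti]
      by_cases hc : 0 < planeCross (q v - q u) (q r - q u) <;> simp [hc]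
    · simp only [hcr, lt_irrefl, he, hf, h, h.not_gt, orient, harg]
      rw [hanti] at harg'
      by_cases hc : 0 < planeCross (q v - q u) (q r - q u)
      · simp [hc, hc.not_gt]
      · have : planeCross (q v - q u) (q r - q u) < 0 := by
          rcases lt_or_gt_of_ne hne0 with h3 | h3
          · exact absurd (harg.1 h3) hc
          · linarith [harg'.1 h3]
        simp [hc, this]
  by_cases h2 : v = r
  · subst h2
    have hcr : ¬ DartsCross q (⟨(u, v), huv⟩ : H.Dart) (⟨(p, v), hpr⟩ : H.Dart) :=
      hq.not_dartsCross_of_snd_eq rfl h1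
    have harg := arg_lt_arg_iff_of_im_neg (z := q p - q v) (w := q u - q v) (by simpa) (by simpa)
    have harg' := arg_lt_arg_iff_of_im_neg (w := q p - q v) (z := q u - q v) (by simpa) (by simpa)
    have ho1 : orient (q u) (q v) (q p) = - planeCross (q u - q v) (q p - q v) := by
      simp only [orient, planeCross, Complex.sub_re, Complex.sub_im]; ring
    have ho2 : orient (q p) (q v) (q u) = planeCross (q u - q v) (q p - q v) := by
      simp only [orient, planeCross, Complex.sub_re, Complex.sub_im]; ring
    have hanti : planeCross (q p - q v) (q u - q v) = - planeCross (q u - q v) (q p - q v) := by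
      simp only [planeCross]; ring
    have hne0 : (q u - q v).arg ≠ (q p - q v).arg := fun h =>
      h1 (hq.eq_of_arg_eq huv.symm hpr.symm h)
    rw [hanti] at harg
    rcases lt_or_gt_of_ne (hq.im_ne h1) with h | h
    · simp only [hcr, lt_irrefl, he, hf, h, h.not_gt, harg, ho1, ho2]
      by_cases hc : 0 < planeCross (q u - q v) (q p - q v)
      · simp [hc, hc.not_gt]
      · have : planeCross (q u - q v) (q p - q v) < 0 := by
          rcases lt_or_gt_of_ne hne0 with h3 | h3
          · exact absurd (harg'.1 h3) hc
          · linarith [harg.1 h3]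
        simp [hc, this]
    · simp only [hcr, lt_irrefl, he, hf, h, h.not_gt, h.ne', harg, ho1, ho2]
      by_cases hc : planeCross (q u - q v) (q p - q v) < 0 <;> simp [hc]
  by_cases h3 : v = p
  · subst h3
    have hur : (q u).im < (q r).im := he.trans hf
    have hcr : ¬ DartsCross q (⟨(u, v), huv⟩ : H.Dart) (⟨(v, r), hpr⟩ : H.Dart) :=
      hq.not_dartsCross_of_snd_eq_fst rfl fun h => hur.ne (congrArg (fun w => (q w).im) h)
    have ha1 : ¬ (q r - q v).arg < (q u - q v).arg := by
      have := hd (z := q r - q v) (by simpa)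
      have := hd' (z := q u - q v) (by simpa)
      linarith
    simp [hcr, he, hf, he.not_gt, hf.not_gt, ha1, hf.ne']
  by_cases h4 : u = r
  · subst h4
    have hcr : ¬ DartsCross q (⟨(u, v), huv⟩ : H.Dart) (⟨(p, u), hpr⟩ : H.Dart) := by
      rw [dartsCross_comm]
      exact hq.not_dartsCross_of_snd_eq_fst rfl (Ne.symm h3)
    have ha1 : ¬ (q v - q u).arg < (q p - q u).arg := by
      have := hd (z := q v - q u) (by simpa)
      have := hd' (z := q p - q u) (by simpa)
      linarith
    simp [hcr, he, hf, he.not_gt, hf.not_gt, ha1, hf.ne']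
  rw [hq.dartsCross_iff_of_disjoint (d := ⟨(u, v), huv⟩) (e := ⟨(p, r), hpr⟩) ⟨h1, h4, h3, h2⟩]
  simp only
  have ne1 := hq.im_ne h1
  have ne2 := hq.im_ne h2
  have ne3 := hq.im_ne h3
  have ne4 := hq.im_ne h4
  have m1 := hq.notMem_segment huv (Ne.symm h1) (Ne.symm h3)
  have m2 := hq.notMem_segment huv (Ne.symm h4) (Ne.symm h2)
  have m3 := hq.notMem_segment hpr h1 h4
  have m4 := hq.notMem_segment hpr h3 h2
  have hsymm : (∃ y ∈ segment ℝ (q u) (q v), y ∈ segment ℝ (q p) (q r)) ↔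
      ∃ y ∈ segment ℝ (q p) (q r), y ∈ segment ℝ (q u) (q v) := by
    constructor <;> rintro ⟨y, h, h'⟩ <;> exact ⟨y, h', h⟩
  rcases lt_or_gt_of_ne ne1 with l1 | l1
  · rcases lt_or_gt_of_ne ne3 with l3 | l3
    · have hno : ¬ ∃ y ∈ segment ℝ (q u) (q v), y ∈ segment ℝ (q p) (q r) := by
        rintro ⟨y, hy, hy'⟩
        linarith [(im_mem_of_mem_segment he.le hy).2, (im_mem_of_mem_segment hf.le hy').1]
      have l5 := l3.trans hf
      simp [hno, l1.not_gt, l3.not_gt, l3.ne', l5.ne', l5.not_gt]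
    · rcases lt_or_gt_of_ne ne2 with l2 | l2
      · rw [exists_mem_segments_iff_of_interleaved l1 l3 l2 m1 m4]
        have l5 := l1.trans hf
        by_cases c1 : orient (q u) (q v) (q p) < 0 <;> by_cases c2 : orient (q p) (q r) (q v) < 0 <;>
        simp [l1, l2, l3, l1.not_gt, l2.not_gt, c1, c2, ne2.symm]
        all_goals decide
      · rw [exists_mem_segments_iff_of_nested he l1 hf l2 m1 m2]
        have l5 := l1.trans hf
        by_cases c1 : orient (q u) (q v) (q p) < 0 <;> by_cases c2 : orient (q u) (q v) (q r) < 0 <;>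
        simp [l1, l2, l3, l5, l1.not_gt, l2.not_gt, c1, c2]
        all_goals decide
  · rcases lt_or_gt_of_ne ne4 with l4 | l4
    · rcases lt_or_gt_of_ne ne2 with l2 | l2
      · rw [hsymm, exists_mem_segments_iff_of_nested hf l1 he l2 m3 m4]
        have l5 := l1.trans he
        by_cases c1 : orient (q p) (q r) (q u) < 0 <;> by_cases c2 : orient (q p) (q r) (q v) < 0 <;>
        simp [l1, l2, l4, l5, l1.not_gt, l2.not_gt, ne1, ne2.symm, c1, c2]
      · rw [hsymm, exists_mem_segments_iff_of_interleaved l1 l4 l2 m3 m2]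
        by_cases c1 : orient (q p) (q r) (q u) < 0 <;> by_cases c2 : orient (q u) (q v) (q r) < 0 <;>
        simp [l1, l2, l4, l1.not_gt, l2.not_gt, ne1, c1, c2]
        all_goals decide
    · have hno : ¬ ∃ y ∈ segment ℝ (q u) (q v), y ∈ segment ℝ (q p) (q r) := by
        rintro ⟨y, hy, hy'⟩
        linarith [(im_mem_of_mem_segment he.le hy).1, (im_mem_of_mem_segment hf.le hy').2]
      have l5 := l4.trans he
      simp [hno, l1.not_gt, l4.not_gt, l5.not_gt, ne1, ne4]

end Parity

end DartOrder

section Gauge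

open Complex in
theorem exp_half_arg_div {z w : ℂ} (hz : z.im ≠ 0) (hw : w.im ≠ 0) (hne : w.arg ≠ (-z).arg) :
    exp (I / 2 * ((w / z).arg : ℂ)) = exp (I / 2 * (w.arg : ℂ)) * exp (-(I / 2 * (z.arg : ℂ))) *
      ((if 0 < z.im then 1 else -1) * (if (-z).arg < w.arg then 1 else -1)) := by
  have hz0 : z ≠ 0 := by rintro rfl; simp at hz
  have hw0 : w ≠ 0 := by rintro rfl; simp at hw
  have h1 : ((w / z).arg : Real.Angle) = ((w.arg - z.arg : ℝ) : Real.Angle) := by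
    rw [Complex.arg_div_coe_angle hw0 hz0, Real.Angle.coe_sub]
  obtain ⟨k, hk⟩ := Real.Angle.angle_eq_iff_two_pi_dvd_sub.1 h1
  have hpi := Real.pi_pos
  have a1 := Complex.neg_pi_lt_arg (w / z)
  have a2 := Complex.arg_le_pi (w / z)
  have b1 := Complex.neg_pi_lt_arg w
  have b2 := Complex.arg_lt_pi_iff.2 (Or.inr hw)
  have c1 := Complex.neg_pi_lt_arg z
  have c2 := Complex.arg_lt_pi_iff.2 (Or.inr hz)
  have key : exp (I / 2 * ((w / z).arg : ℂ)) = exp (I / 2 * (w.arg : ℂ)) *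
      exp (-(I / 2 * (z.arg : ℂ))) * (-1) ^ k := by
    have : (w / z).arg = w.arg - z.arg + 2 * Real.pi * k := by linarith
    rw [this, ← Complex.exp_add, ← Complex.exp_pi_mul_I, ← Complex.exp_int_mul, ← Complex.exp_add]
    congr 1
    push_cast
    ring
  rw [key]
  congr 1
  have hk1 : -2 < k := by
    by_contra h
    have : (k : ℝ) ≤ -2 := by exact_mod_cast (not_lt.1 h)
    nlinarith
  have hk2 : k < 2 := by
    by_contra h
    have : (2 : ℝ) ≤ k := by exact_mod_cast (not_lt.1 h)
    nlinarith
  rcases lt_or_gt_of_ne hz with him | him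
  · have e := Complex.arg_neg_eq_arg_add_pi_of_im_neg him
    have c3 := Complex.arg_neg_iff.2 him
    rw [if_neg him.not_gt]
    rcases lt_or_gt_of_ne hne with h | h
    · rw [if_neg h.not_gt]
      rw [e] at h
      interval_cases k <;> push_cast at hk <;> first | (exfalso; linarith) | simp
    · rw [if_pos h]
      rw [e] at h
      interval_cases k <;> push_cast at hk <;> first | (exfalso; linarith) | simp
  · have e := Complex.arg_neg_eq_arg_sub_pi_of_im_pos him
    have c3 := Complex.arg_nonneg_iff.2 him.le
    rw [if_pos him]
    rcases lt_or_gt_of_ne hne with h | h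
    · rw [if_neg h.not_gt]
      rw [e] at h
      interval_cases k <;> push_cast at hk <;> first | (exfalso; linarith) | simp
    · rw [if_pos h]
      rw [e] at h
      interval_cases k <;> push_cast at hk <;> first | (exfalso; linarith) | simp

end Gauge

section KacWard

open Matrix

variable {V : Type*} {H : SimpleGraph V} {q : V → ℂ}

theorem card_filter_powersetCard_two_insert {α : Type*} [DecidableEq α] (P : Finset α → Prop)
    [DecidablePred P] {e : α} {F : Finset α} (he : e ∉ F) :
    (((insert e F).powersetCard 2).filter P).card =
      ((F.powersetCard 2).filter P).card + (F.filter fun f => P {e, f}).card := by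
  rw [Finset.powersetCard_succ_insert he, Finset.filter_union, Finset.card_union_of_disjoint]
  · congr 1
    rw [Finset.powersetCard_one, Finset.filter_image, Finset.filter_map, Finset.card_image_of_injOn]
    · simp
    · intro a ha b hb hab
      simp only [Finset.coe_map, Set.mem_image, Finset.mem_coe, Finset.mem_filter] at ha hb
      obtain ⟨a, ⟨ha, -⟩, rfl⟩ := ha
      obtain ⟨b, ⟨hb, -⟩, rfl⟩ := hb
      simp only [Function.Embedding.coeFn_mk] at hab ⊢
      have h1 : a ∈ ({e, b} : Finset α) := by rw [← hab]; simp
      simp only [Finset.mem_insert, Finset.mem_singleton] at h1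
      rcases h1 with rfl | rfl
      · exact absurd ha he
      · rfl
  · rw [Finset.disjoint_left]
    intro A hA hA'
    simp only [Finset.mem_filter, Finset.mem_powersetCard, Finset.mem_image] at hA hA'
    obtain ⟨⟨B, -, rfl⟩, -⟩ := hA'
    exact he (hA.1.1 (Finset.mem_insert_self e B))

open Classical in
/-- The number of pairs of edges that cross. -/
noncomputable def crossCount (q : V → ℂ) (F : Finset (UpDart H q)) : ℕ :=
  ((F.powersetCard 2).filter fun P => ∃ y, (∀ e ∈ P, y ∈ segment ℝ (q e.1.fst) (q e.1.snd)) ∧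
    y ∉ Set.range q).card

theorem crossCount_empty : crossCount (H := H) q ∅ = 0 := by
  rw [crossCount, Finset.powersetCard_eq_empty.2 (by simp)]
  rfl

open Classical in
theorem crossCount_insert [DecidableEq (UpDart H q)] {e : UpDart H q} {F : Finset (UpDart H q)} (he : e ∉ F) :
    crossCount q (insert e F) = crossCount q F +
      ∑ f ∈ F, if DartsCross q e.1 f.1 then 1 else 0 := by
  rw [crossCount, card_filter_powersetCard_two_insert _ he,
    Finset.card_filter (fun f => ∃ y, (∀ d ∈ ({e, f} : Finset (UpDart H q)),
      y ∈ segment ℝ (q d.1.fst) (q d.1.snd)) ∧ y ∉ Set.range q) F]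
  congr 1
  refine Finset.sum_congr rfl fun f _ => ?_
  simp [DartsCross, and_assoc]

open Classical in
/-- The number of ends of `f` to the right of `e`. -/
noncomputable def rightEnds (e f : UpDart H q) : ℕ :=
  (if IsRightOf q f.1.fst e.1 then 1 else 0) + (if IsRightOf q f.1.snd e.1 then 1 else 0)

theorem rightEnds_self (e : UpDart H q) : rightEnds e e = 0 := by
  simp [rightEnds, IsRightOf]

/-- The number of pairs of edges of `F` and ends of edges of `F` to their right. -/
noncomputable def rightCount (F : Finset (UpDart H q)) : ℕ := ∑ e ∈ F, ∑ f ∈ F, rightEnds e f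

theorem rightCount_insert [DecidableEq (UpDart H q)] {e : UpDart H q} {F : Finset (UpDart H q)}
    (he : e ∉ F) :
    rightCount (insert e F) = rightCount F + ∑ f ∈ F, (rightEnds e f + rightEnds f e) := by
  simp only [rightCount, Finset.sum_insert he, rightEnds_self, Finset.sum_add_distrib]
  ring

variable (hq : IsGenericDrawing H q)

theorem UpDart.lt_symm (e : UpDart H q) : hq.dartOrder.lt e.1 e.1.symm :=
  (dartOrder_lt_iff hq).2 (Or.inl e.2)

theorem UpDart.ne_symm (e f : UpDart H q) : e.1 ≠ f.1.symm := by
  intro h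
  have h1 := e.2
  rw [h] at h1
  exact lt_asymm f.2 h1

theorem UpDart.disjoint (e f : UpDart H q) (h : e ≠ f) :
    e.1 ≠ f.1 ∧ e.1 ≠ f.1.symm ∧ e.1.symm ≠ f.1 ∧ e.1.symm ≠ f.1.symm :=
  ⟨fun h' => h (Subtype.ext h'), UpDart.ne_symm e f, (UpDart.ne_symm f e).symm,
    fun h' => h (Subtype.ext (SimpleGraph.Dart.symm_involutive.injective h'))⟩


section Arcs

variable {D W E : Type*} [LinearOrder D] [DecidableEq W]

/-- Every point is the image of an even number of ends of arcs. -/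
def ArcsEven (p : D → W) (lo hi : E → D) (F : Finset E) : Prop :=
  ∀ v, Even ((F.filter fun e => p (lo e) = v).card + (F.filter fun e => p (hi e) = v).card)

theorem card_filter_arcEnds [DecidableEq E] (p : D → W) {lo hi : E → D} (hlt : ∀ e, lo e < hi e)
    (hdisj : ∀ e f, e ≠ f → lo e ≠ lo f ∧ lo e ≠ hi f ∧ hi e ≠ lo f ∧ hi e ≠ hi f)
    (F : Finset E) (v : W) : ((arcEnds lo hi F).filter fun d => p d = v).card =
      (F.filter fun e => p (lo e) = v).card + (F.filter fun e => p (hi e) = v).card := by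
  rw [Finset.card_filter, Finset.card_filter, Finset.card_filter, arcEnds, Finset.sum_biUnion,
    ← Finset.sum_add_distrib]
  · exact Finset.sum_congr rfl fun f _ => Finset.sum_pair (hlt f).ne
  · intro e _ f _ hef
    obtain ⟨d1, d2, d3, d4⟩ := hdisj e f hef
    rw [Function.onFun, Finset.disjoint_left]
    simp only [Finset.mem_insert, Finset.mem_singleton]
    rintro k (rfl | rfl) (h | h) <;> contradiction

open Classical in
/-- The square of the signed generating function of even sets of arcs is a determinant. -/
theorem sum_arcsEven_sq [Fintype D] [Fintype E] (p : D → W)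
    (hp : ∀ a b c : D, a ≤ b → b ≤ c → p a = p c → p b = p a) {lo hi : E → D}
    (hlt : ∀ e, lo e < hi e)
    (hdisj : ∀ e f, e ≠ f → lo e ≠ lo f ∧ lo e ≠ hi f ∧ hi e ≠ lo f ∧ hi e ≠ hi f)
    (x : E → ℂ) (s : Finset E → ℂ) (hs0 : s ∅ = 1)
    (hs : ∀ e F, e ∉ F → s (insert e F) = (-1 : ℂ) ^ (∑ f ∈ F, endsBetween lo hi e f) * s F)
    {A : Matrix D D ℂ}
    (hA : A = ∑ e, x e • (Matrix.single (lo e) (hi e) 1 - Matrix.single (hi e) (lo e) 1)) :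
    (∑ F : Finset E, if ArcsEven p lo hi F then s F * ∏ e ∈ F, x e else 0) ^ 2 =
      (1 - orderSign p * A).det := by
  have h1 : A = pairMatrix ((Finset.univ : Finset E).toList.map fun e => (x e, lo e, hi e)) := by
    rw [pairMatrix, List.map_map, hA, Finset.sum_map_toList]
    rfl
  rw [h1, ← skewFunctional_basisPairProd_sq _ (orderSign_transpose p),
    basisPairProd_eq_sum hlt hdisj x s hs0 hs _ (Finset.nodup_toList _), map_sum,
    Finset.toList_toFinset, Finset.powerset_univ]
  congr 1
  refine Finset.sum_congr rfl fun F _ => ?_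
  rw [map_smul, skewFunctional_sortedProd p hp, smul_eq_mul, mul_ite, mul_one, mul_zero]
  simp only [ArcsEven, card_filter_arcEnds p hlt hdisj F]
  congr!

end Arcs

open Classical in
theorem even_rightCount [Fintype V] {F : Finset (UpDart H q)}
    (hF : ∀ v, Even ((F.filter fun e => e.1.fst = v).card + (F.filter fun e => e.1.snd = v).card)) :
    Even (rightCount F) := by
  refine Finset.even_sum _ fun e _ => ?_
  have (g : UpDart H q → V) : ∑ f ∈ F, (if IsRightOf q (g f) e.1 then 1 else 0) =
      ∑ v, (F.filter fun f => g f = v).card * (if IsRightOf q v e.1 then 1 else 0) := by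
    rw [← Finset.sum_fiberwise (g := g)]
    refine Finset.sum_congr rfl fun v _ => ?_
    rw [← smul_eq_mul, ← Finset.sum_const]
    refine Finset.sum_congr rfl fun d hd => ?_
    rw [(Finset.mem_filter.1 hd).2]
  simp only [rightEnds, Finset.sum_add_distrib, this]
  rw [← Finset.sum_add_distrib]
  refine Finset.even_sum _ fun v _ => ?_
  rw [← add_mul]
  exact (hF v).mul_right _

/-- The sign matrix of the darts at the vertices. -/
noncomputable def dartSign : Matrix H.Dart H.Dart ℂ :=
  letI := hq.dartOrder
  letI := Classical.decEq V
  orderSign fun d : H.Dart => d.fst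

open Classical in
/-- The skew-symmetric matrix of the edge weights. -/
noncomputable def edgeMatrix (q : V → ℂ) (x : Sym2 V → ℂ) : Matrix H.Dart H.Dart ℂ :=
  Matrix.of fun d e => if e = d.symm then
    (if (q d.fst).im < (q d.snd).im then x d.edge else -x d.edge) else 0

open Classical in
theorem edgeMatrix_eq_sum [Fintype (UpDart H q)] (hq : IsGenericDrawing H q) (x : Sym2 V → ℂ) :
    edgeMatrix (H := H) q x = ∑ e : UpDart H q, x e.1.edge •
      (Matrix.single e.1 e.1.symm 1 - Matrix.single e.1.symm e.1 1) := by
  ext d e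
  simp only [edgeMatrix, Matrix.of_apply, Matrix.sum_apply, Matrix.smul_apply, Matrix.sub_apply,
    Matrix.single_apply, smul_eq_mul]
  have hs : ∀ a b : H.Dart, a.symm = b ↔ a = b.symm := fun a b =>
    ⟨fun h => by rw [← h, SimpleGraph.Dart.symm_symm], fun h => by rw [h, SimpleGraph.Dart.symm_symm]⟩
  rcases lt_or_gt_of_ne (hq.im_ne d.adj.ne) with hd | hd
  · rw [Finset.sum_eq_single (⟨d, hd⟩ : UpDart H q)]
    · have : ¬ (d.symm = d) := SimpleGraph.Dart.symm_ne d
      simp [hd, this, eq_comm]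
    · intro f _ hf
      have h1 : ¬ (f.1 = d) := fun h => hf (Subtype.ext h)
      have h2 : ¬ (f.1.symm = d) := fun h => (UpDart.ne_symm ⟨d, hd⟩ f) h.symm
      simp [h1, h2]
    · simp
  · rw [Finset.sum_eq_single (⟨d.symm, hd⟩ : UpDart H q)]
    · have : ¬ (d.symm = d) := SimpleGraph.Dart.symm_ne d
      simp [hd.not_gt, this, eq_comm]
      split_ifs <;> simp
    · intro f _ hf
      have h1 : ¬ (f.1 = d) := fun h => by
        have := f.2
        rw [h] at this
        exact lt_asymm this hd
      have h2 : ¬ (f.1.symm = d) := fun h => hf (Subtype.ext ((hs _ _).1 h))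
      simp [h1, h2]
    · simp

open Classical in
/-- The generating function of the even subgraphs in terms of upward darts. -/
noncomputable def upDartZ [Fintype (UpDart H q)] (x : Sym2 V → ℂ) : ℂ :=
  ∑ F : Finset (UpDart H q),
    if ∀ v, Even ((F.filter fun e => e.1.fst = v).card + (F.filter fun e => e.1.snd = v).card) then
      (-1) ^ crossCount q F * ∏ e ∈ F, x e.1.edge else 0

theorem upDartZ_sq [Fintype V] [Fintype H.Dart] [DecidableEq H.Dart] [Fintype (UpDart H q)]
    (x : Sym2 V → ℂ) :
    upDartZ (H := H) (q := q) x ^ 2 = (1 - dartSign hq * edgeMatrix q x).det := by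
  classical
  have hp : ∀ a b c : H.Dart, hq.dartOrder.le a b → hq.dartOrder.le b c → a.fst = c.fst →
      b.fst = a.fst := by
    have hle (a b : H.Dart) (hab : hq.dartOrder.le a b) : (q a.fst).im ≤ (q b.fst).im := by
      rcases (@lt_or_eq_of_le _ hq.dartOrder.toPartialOrder _ _ hab) with h | rfl
      · rcases (dartOrder_lt_iff hq).1 h with h | h
        exacts [h.le, h.1.le]
      · rfl
    intro a b c hab hbc hac
    have h2 := hle b c hbc
    rw [← hac] at h2
    exact hq.im_injective (le_antisymm h2 (hle a b hab))
  have := @sum_arcsEven_sq H.Dart V (UpDart H q) hq.dartOrder _ _ _ (fun d => d.fst) hp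
    (fun e => e.1) (fun e => e.1.symm) (UpDart.lt_symm hq) UpDart.disjoint (fun e => x e.1.edge)
    (fun F => (-1) ^ (crossCount q F + rightCount F)) (by simp [crossCount_empty, rightCount])
    (by
      intro e F he
      have he' : e ∉ F := he
      have h1 := @crossCount_insert V H q (fun a b => Classical.propDecidable (a = b)) e F he'
      have h2 := @rightCount_insert V H q (fun a b => Classical.propDecidable (a = b)) e F he'
      have h3 : Even (∑ f ∈ F, ((if DartsCross q e.1 f.1 then 1 else 0) + rightEnds e f +
          rightEnds f e + @endsBetween H.Dart hq.dartOrder (UpDart H q) (fun d => d.1)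
            (fun d => d.1.symm) e f)) :=
        Finset.even_sum _ fun f hf => even_cross_add_endsBetween hq e f fun h => he' (h ▸ hf)
      simp only [Finset.sum_add_distrib] at h2 h3
      have h4 : (-1 : ℂ) ^ (∑ f ∈ F, if DartsCross q e.1 f.1 then 1 else 0) *
          (-1) ^ (∑ f ∈ F, rightEnds e f) * (-1) ^ (∑ f ∈ F, rightEnds f e) =
          (-1) ^ (∑ f ∈ F, @endsBetween H.Dart hq.dartOrder (UpDart H q) (fun d => d.1)
            (fun d => d.1.symm) e f) := by
        have h5 := h3.neg_one_pow (α := ℂ)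
        rw [pow_add, pow_add, pow_add] at h5
        have h6 : (-1 : ℂ) ^ (∑ f ∈ F, @endsBetween H.Dart hq.dartOrder (UpDart H q) (fun d => d.1)
            (fun d => d.1.symm) e f) * (-1) ^ (∑ f ∈ F, @endsBetween H.Dart hq.dartOrder
              (UpDart H q) (fun d => d.1) (fun d => d.1.symm) e f) = 1 := by
          rw [← mul_pow]; simp
        linear_combination ((-1 : ℂ) ^ (∑ f ∈ F, @endsBetween H.Dart hq.dartOrder (UpDart H q)
          (fun d => d.1) (fun d => d.1.symm) e f)) * h5 - (-1 : ℂ) ^ (∑ f ∈ F,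
          if DartsCross q e.1 f.1 then 1 else 0) * (-1) ^ (∑ f ∈ F, rightEnds e f) *
          (-1) ^ (∑ f ∈ F, rightEnds f e) * h6
      rw [← h4]
      rw [h1, h2, pow_add, pow_add, pow_add, pow_add, pow_add]
      ring)
    (A := edgeMatrix q x) (by rw [edgeMatrix_eq_sum hq]; congr!)
  convert this using 2
  · rw [upDartZ]
    refine Finset.sum_congr rfl fun F _ => ?_
    simp only [ArcsEven]
    by_cases hF : ∀ v, Even ((F.filter fun e => e.1.fst = v).card +
      (F.filter fun e => e.1.snd = v).card)
    · have hF' : ∀ v, Even ((F.filter fun e => e.1.fst = v).card +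
        (F.filter fun e => e.1.symm.fst = v).card) := hF
      have h0 := (even_rightCount (by convert hF)).neg_one_pow (α := ℂ)
      rw [if_pos (by convert hF), if_pos (by convert hF'), pow_add, h0, mul_one]
    · have hF' : ¬ ∀ v, Even ((F.filter fun e => e.1.fst = v).card +
        (F.filter fun e => e.1.symm.fst = v).card) := hF
      rw [if_neg (by convert hF), if_neg (by convert hF')]
  · congr!

end KacWard

namespace PlaneGraph

section FullGraph

open Matrix

variable {V : Type*} (G : PlaneGraph V)

theorem edgeSegment_mk (u v : V) : G.edgeSegment s(u, v) = segment ℝ (G.pos u) (G.pos v) := by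
  have : {w | w ∈ s(u, v)} = ({u, v} : Set V) := by
    ext w; simp
  rw [edgeSegment, this, Set.image_pair, convexHull_pair]

theorem mem_segment_mul_iff {a : ℂ} (ha : a ≠ 0) (u v y : ℂ) :
    a * y ∈ segment ℝ (a * u) (a * v) ↔ y ∈ segment ℝ u v := by
  simp only [segment_eq_image', Set.mem_image]
  refine exists_congr fun t => and_congr_right fun _ => ?_
  rw [← mul_sub, ← mul_smul_comm, ← mul_add, mul_right_inj' ha]

/-- Some rotated and scaled copy of the graph is in general position with respect to height. -/
theorem exists_isGenericDrawing [Finite V] :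
    ∃ a : ℂ, a ≠ 0 ∧ IsGenericDrawing G.graph fun v => a * G.pos v := by
  have hfin : (⋃ p : V × V, {t : ℝ | p.1 ≠ p.2 ∧
      (G.pos p.1 - G.pos p.2).im + t * (G.pos p.1 - G.pos p.2).re = 0}).Finite := by
    refine Set.finite_iUnion fun p => Set.Subsingleton.finite ?_
    rintro s ⟨hne, hs⟩ t ⟨-, ht⟩
    have h0 : G.pos p.1 - G.pos p.2 ≠ 0 := sub_ne_zero.2 fun h => hne (G.pos_injective h)
    generalize G.pos p.1 - G.pos p.2 = z at *
    by_cases hz : z.re = 0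
    · exfalso
      apply h0
      apply Complex.ext
      · simpa using hz
      · simpa [hz] using hs
    · have : (s - t) * z.re = 0 := by linarith
      rcases mul_eq_zero.1 this with h | h
      · linarith
      · exact absurd h hz
  obtain ⟨t, ht⟩ := hfin.infinite_compl.nonempty
  have ha : (⟨1, t⟩ : ℂ) ≠ 0 := fun h => one_ne_zero (congrArg Complex.re h)
  refine ⟨⟨1, t⟩, ha, ⟨fun u v huv => ?_, fun u v w huv hw => ?_⟩⟩
  · by_contra hne
    refine ht (Set.mem_iUnion.2 ⟨(u, v), hne, ?_⟩)
    simp only [Complex.mul_im] at huv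
    simp only [Complex.sub_re, Complex.sub_im]
    linarith
  · rw [mem_segment_mul_iff ha, ← edgeSegment_mk] at hw
    simpa using G.mem_of_pos_mem_edge s(u, v) huv w hw

variable {G} {a : ℂ}

/-- The edge of an upward dart. -/
def upDartEdge (_hq : IsGenericDrawing G.graph fun v => a * G.pos v) :
    UpDart G.graph (fun v => a * G.pos v) ↪ Sym2 V :=
  ⟨fun e => e.1.edge, fun e f h => by
    rcases SimpleGraph.dart_edge_eq_iff _ _ |>.1 h with h | h
    · exact Subtype.ext h
    · exact absurd h (UpDart.ne_symm e f)⟩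

theorem crossings_map_upDartEdge (ha : a ≠ 0)
    (hq : IsGenericDrawing G.graph fun v => a * G.pos v)
    (F : Finset (UpDart G.graph fun v => a * G.pos v)) :
    G.crossings (F.map (upDartEdge hq)) = crossCount (fun v => a * G.pos v) F := by
  classical
  rw [crossings, crossCount, Finset.powersetCard_map, Finset.filter_map, Finset.card_map]
  congr 1
  ext P
  simp only [Finset.mem_filter, Function.comp_apply, and_congr_right_iff]
  intro _
  have hseg (e : UpDart G.graph fun v => a * G.pos v) (y : ℂ) : y ∈ G.edgeSegment e.1.edge ↔
      a * y ∈ segment ℝ (a * G.pos e.1.fst) (a * G.pos e.1.snd) := by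
    rw [mem_segment_mul_iff ha, ← edgeSegment_mk]
    rfl
  have hran (y : ℂ) : y ∈ Set.range G.pos ↔ a * y ∈ Set.range fun v => a * G.pos v := by
    simp [Set.mem_range, ha]
  have hmap (y : ℂ) : (∀ e ∈ Finset.mapEmbedding (upDartEdge hq) P, y ∈ G.edgeSegment e) ↔
      ∀ e ∈ P, a * y ∈ segment ℝ (a * G.pos e.1.fst) (a * G.pos e.1.snd) := by
    simp only [Finset.mapEmbedding_apply, Finset.forall_mem_map]
    exact forall₂_congr fun e _ => hseg e y
  constructor
  · rintro ⟨y, h1, h2⟩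
    exact ⟨a * y, (hmap y).1 h1, fun h => h2 ((hran y).2 h)⟩
  · rintro ⟨y, h1, h2⟩
    obtain ⟨y, rfl⟩ : ∃ z, y = a * z := ⟨y / a, by field_simp⟩
    exact ⟨y, (hmap y).2 h1, fun h => h2 ((hran y).1 h)⟩

open Classical in
theorem isEven_map_upDartEdge_iff (hq : IsGenericDrawing G.graph fun v => a * G.pos v)
    (F : Finset (UpDart G.graph fun v => a * G.pos v)) :
    IsEven (F.map (upDartEdge hq)) ↔ ∀ v, Even ((F.filter fun e => e.1.fst = v).card +
      (F.filter fun e => e.1.snd = v).card) := by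
  refine forall_congr' fun v => ?_
  rw [Finset.filter_map, Finset.card_map, ← Finset.card_union_of_disjoint]
  · have : F.filter ((fun e => v ∈ e) ∘ (upDartEdge hq)) = F.filter (fun e => e.1.fst = v) ∪
        F.filter (fun e => e.1.snd = v) := by
      ext e
      have : v ∈ upDartEdge hq e ↔ e.1.fst = v ∨ e.1.snd = v := by
        change v ∈ s(e.1.fst, e.1.snd) ↔ _
        rw [Sym2.mem_iff]
        tauto
      simp [this, and_or_left]
    rw [this]
  · rw [Finset.disjoint_filter]
    rintro e _ rfl h
    exact e.1.adj.ne h.symm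

theorem Z_eq_upDartZ [Fintype V] (ha : a ≠ 0) (hq : IsGenericDrawing G.graph fun v => a * G.pos v)
    [Fintype (UpDart G.graph fun v => a * G.pos v)] (x : Sym2 V → ℂ) :
    G.Z x = upDartZ (H := G.graph) (q := fun v => a * G.pos v) x := by
  classical
  rw [Z, Finset.sum_filter, upDartZ]
  symm
  refine Finset.sum_nbij' (fun F => F.map (upDartEdge hq))
    (fun F => Finset.univ.filter fun e => upDartEdge hq e ∈ F) ?_ ?_ ?_ ?_ ?_
  · intro F _
    rw [Finset.mem_powerset]
    intro e he
    obtain ⟨d, -, rfl⟩ := Finset.mem_map.1 he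
    rw [SimpleGraph.mem_edgeFinset]
    exact d.1.edge_mem
  · simp
  · intro F _
    ext e
    simp
  · intro F hF
    rw [Finset.mem_powerset] at hF
    ext e
    simp only [Finset.mem_map, Finset.mem_filter, Finset.mem_univ, true_and]
    refine ⟨fun ⟨d, hd, he⟩ => he ▸ hd, fun he => ?_⟩
    have hmem := SimpleGraph.mem_edgeFinset.1 (hF he)
    induction e with
    | _ u v =>
    rw [SimpleGraph.mem_edgeSet] at hmem
    rcases lt_or_gt_of_ne (hq.im_ne hmem.ne) with h | h
    · exact ⟨⟨⟨(u, v), hmem⟩, h⟩, he, rfl⟩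
    · have : s(v, u) = s(u, v) := Sym2.eq_swap
      exact ⟨⟨⟨(v, u), hmem.symm⟩, h⟩, by change s(v, u) ∈ F; rwa [this], this⟩
  · intro F _
    rw [crossings_map_upDartEdge ha, Finset.prod_map]
    have := isEven_map_upDartEdge_iff hq F
    by_cases h : IsEven (F.map (upDartEdge hq))
    · rw [if_pos h, if_pos (by convert this.1 h)]
      rfl
    · rw [if_neg h, if_neg fun h' => h (this.2 (by convert h'))]

variable (G)

open Classical in
/-- The transition matrix of the graph in which all edges are representative. -/
noncomputable def fullMatrix (x : Sym2 V → ℂ) : Matrix G.graph.Dart G.graph.Dart ℂ :=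
  Matrix.of fun d e => if d.snd = e.fst ∧ d.fst ≠ e.snd then
    x d.edge * Complex.exp (Complex.I / 2 * (G.turn d.fst d.snd e.snd : ℂ)) else 0

variable {G}

theorem fullMatrix_apply_eq (ha : a ≠ 0) (hq : IsGenericDrawing G.graph fun v => a * G.pos v)
    [Fintype G.graph.Dart] (x : Sym2 V → ℂ) (d e : G.graph.Dart) :
    G.fullMatrix x d e =
      Complex.exp (-(Complex.I / 2 * ((a * G.pos d.snd - a * G.pos d.fst).arg : ℂ))) *
        (edgeMatrix (fun v => a * G.pos v) x * dartSign hq : Matrix G.graph.Dart G.graph.Dart ℂ) d e *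
        Complex.exp (Complex.I / 2 * ((a * G.pos e.snd - a * G.pos e.fst).arg : ℂ)) := by
  classical
  have h1 : (edgeMatrix (fun v => a * G.pos v) x * dartSign hq : Matrix G.graph.Dart G.graph.Dart ℂ) d e =
      (if (a * G.pos d.fst).im < (a * G.pos d.snd).im then x d.edge else -x d.edge) *
        dartSign hq d.symm e := by
    rw [Matrix.mul_apply, Finset.sum_eq_single d.symm]
    · simp [edgeMatrix]
    · intro f _ hf
      simp [edgeMatrix, hf]
    · simp
  rw [h1]
  by_cases h : d.snd = e.fst
  · have hS : dartSign hq d.symm e = if hq.dartOrder.lt d.symm e then 1 else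
        if hq.dartOrder.lt e d.symm then -1 else 0 := by
      simp only [dartSign, orderSign, Matrix.of_apply]
      rw [if_pos (by exact h)]
    have hirr : ¬ (a * G.pos e.fst).im < (a * G.pos e.fst).im := lt_irrefl _
    have hfst : d.symm.fst = e.fst := h
    have hsnd : d.symm.snd = d.fst := rfl
    rw [hS]
    simp only [dartOrder_lt_iff, hfst, hsnd, hirr, false_or, true_and]
    by_cases h2 : d.fst = e.snd
    · simp [fullMatrix, h2]
    have hadj : G.graph.Adj e.fst d.fst := h ▸ d.adj.symm
    have hne : (a * G.pos e.snd - a * G.pos e.fst).arg ≠ (a * G.pos d.fst - a * G.pos e.fst).arg :=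
      fun h' => h2 (hq.eq_of_arg_eq e.adj hadj h').symm
    have him1 : (a * G.pos d.snd - a * G.pos d.fst).im ≠ 0 := by
      rw [Complex.sub_im]
      exact sub_ne_zero.2 (hq.im_ne d.adj.ne')
    have him2 : (a * G.pos e.snd - a * G.pos e.fst).im ≠ 0 := by
      rw [Complex.sub_im]
      exact sub_ne_zero.2 (hq.im_ne e.adj.ne')
    have hneg : -(a * G.pos d.snd - a * G.pos d.fst) = a * G.pos d.fst - a * G.pos e.fst := by
      rw [h]; ring
    have key := exp_half_arg_div him1 him2 (by rwa [hneg])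
    rw [hneg] at key
    have hturn : (a * G.pos e.snd - a * G.pos e.fst) / (a * G.pos d.snd - a * G.pos d.fst) =
        (G.pos e.snd - G.pos d.snd) / (G.pos d.snd - G.pos d.fst) := by
      rw [← mul_sub, ← mul_sub, mul_div_mul_left _ _ ha, h]
    rw [hturn] at key
    have hF : G.fullMatrix x d e = x d.edge *
        Complex.exp (Complex.I / 2 * (G.turn d.fst d.snd e.snd : ℂ)) := by
      simp [fullMatrix, h, h2]
    rw [hF, turn, key, Complex.sub_im]
    simp only [sub_pos]
    rcases lt_or_gt_of_ne hne with h3 | h3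
    · simp only [h3, h3.not_gt, if_true, if_false]
      split_ifs <;> ring
    · simp only [h3, if_true]
      split_ifs <;> ring
  · have : dartSign hq d.symm e = 0 := by
      simp only [dartSign, orderSign, Matrix.of_apply]
      exact if_neg h
    simp [fullMatrix, h, this]

variable (G)

/-- The Kac–Ward formula for the graph in which all edges are representative. -/
theorem Z_sq_eq_det_fullMatrix [Fintype V] [Fintype G.graph.Dart] [DecidableEq G.graph.Dart]
    (x : Sym2 V → ℂ) : G.Z x ^ 2 = (1 - G.fullMatrix x).det := by
  classical
  obtain ⟨a, ha, hq⟩ := G.exists_isGenericDrawing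
  rw [Z_eq_upDartZ ha hq, upDartZ_sq hq, Matrix.det_one_sub_mul_comm (dartSign hq)]
  set M := edgeMatrix (fun v => a * G.pos v) x * dartSign hq with hM
  set u : G.graph.Dart → ℂ := fun d =>
    Complex.exp (-(Complex.I / 2 * ((a * G.pos d.snd - a * G.pos d.fst).arg : ℂ))) with hu
  set w : G.graph.Dart → ℂ := fun d =>
    Complex.exp (Complex.I / 2 * ((a * G.pos d.snd - a * G.pos d.fst).arg : ℂ)) with hw
  have h1 : G.fullMatrix x = Matrix.diagonal u * (M * Matrix.diagonal w) := by
    ext d e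
    rw [fullMatrix_apply_eq ha hq, Matrix.diagonal_mul, Matrix.mul_diagonal, mul_assoc]
  have h2 : Matrix.diagonal w * Matrix.diagonal u = 1 := by
    rw [Matrix.diagonal_mul_diagonal, ← Matrix.diagonal_one]
    congr 1
    ext d
    rw [hw, hu, ← Complex.exp_add]
    simp
  rw [h1, Matrix.det_one_sub_mul_comm (Matrix.diagonal u), mul_assoc M, h2, mul_one]

end FullGraph

end PlaneGraph

namespace PlaneGraph

section AdditionalEdges

open Matrix SimpleGraph

variable {V : Type*} (G : PlaneGraph V) (x : Sym2 V → ℂ)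

/-- A directed representative edge as a dart of the whole graph. -/
def incl (e : G.representative.Dart) : G.graph.Dart := ⟨e.toProd, e.adj.1⟩

/-- A directed additional edge as a dart of the whole graph. -/
def addDart {u v : V} (h : G.additional.Adj u v) : G.graph.Dart := ⟨(u, v), G.additional_le h⟩

theorem incl_injective : Function.Injective G.incl := by
  intro d e h
  have := congrArg SimpleGraph.Dart.toProd h
  exact SimpleGraph.Dart.ext _ _ this

theorem fullMatrix_apply_of_ne {d e : G.graph.Dart} (h : d.snd ≠ e.fst) :
    G.fullMatrix x d e = 0 := by
  simp [fullMatrix, h]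

theorem fullMatrix_apply_of_eq {d e : G.graph.Dart} (h : d.fst = e.snd) :
    G.fullMatrix x d e = 0 := by
  simp [fullMatrix, h]

theorem fullMatrix_apply_of_step {d e : G.graph.Dart} (h : d.snd = e.fst) (h' : d.fst ≠ e.snd) :
    G.fullMatrix x d e =
      x d.edge * Complex.exp (Complex.I / 2 * (G.turn d.fst d.snd e.snd : ℂ)) := by
  simp [fullMatrix, h, h']

/-- The product of the transition weights along a dart, a walk and another dart. -/
noncomputable def walkWeight (e : G.graph.Dart) :
    {u w : V} → G.additional.Walk u w → G.graph.Dart → ℂ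
  | _, _, .nil, d => G.fullMatrix x d e
  | _, _, .cons h p, d => G.fullMatrix x d (G.addDart h) * walkWeight e p (G.addDart h)

open Classical in
/-- The transition weights from darts to representative darts along additional edges. -/
noncomputable def transfer : Matrix G.graph.Dart G.representative.Dart ℂ :=
  Matrix.of fun d e => if h : ∃ p : G.additional.Walk d.snd e.fst, p.IsPath then
    G.walkWeight x (G.incl e) h.choose d else 0

theorem transfer_eq {d : G.graph.Dart} {e : G.representative.Dart} {u w : V}
    (p : G.additional.Walk u w) (hp : p.IsPath) (hu : d.snd = u) (hw : e.fst = w) :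
    G.transfer x d e = G.walkWeight x (G.incl e) p d := by
  subst hu hw
  have h : ∃ p : G.additional.Walk d.snd e.fst, p.IsPath := ⟨p, hp⟩
  have := (G.additional_isAcyclic.subsingleton_path d.snd e.fst).elim
    ⟨h.choose, h.choose_spec⟩ ⟨p, hp⟩
  simp only [transfer, Matrix.of_apply, dif_pos h]
  rw [Subtype.mk.inj this]

theorem transfer_eq_zero {d : G.graph.Dart} {e : G.representative.Dart}
    (h : ¬ ∃ p : G.additional.Walk d.snd e.fst, p.IsPath) : G.transfer x d e = 0 := by
  simp [transfer, h]

open Classical in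
/-- The diagonal matrix that projects to the additional darts. -/
noncomputable def addProj : Matrix G.graph.Dart G.graph.Dart ℂ :=
  Matrix.of fun d e => if d = e ∧ G.additional.Adj e.fst e.snd then 1 else 0

open Classical in
theorem mul_addProj_apply {m : Type*} [Fintype G.graph.Dart] (M : Matrix m G.graph.Dart ℂ) (d : m)
    (e : G.graph.Dart) :
    (M * G.addProj) d e = M d e * if G.additional.Adj e.fst e.snd then 1 else 0 := by
  rw [Matrix.mul_apply, Finset.sum_eq_single e]
  · simp [addProj]
  · intro a _ ha
    simp [addProj, ha]
  · simp

open Classical in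
theorem addProj_mul_apply {m : Type*} [Fintype G.graph.Dart] (M : Matrix G.graph.Dart m ℂ)
    (d : G.graph.Dart) (e : m) :
    (G.addProj * M) d e = (if G.additional.Adj d.fst d.snd then 1 else 0) * M d e := by
  rw [Matrix.mul_apply, Finset.sum_eq_single d]
  · simp [addProj]
  · intro a _ ha
    simp [addProj, ha.symm]
  · simp

open Classical in
/-- The matrix of the inclusion of the representative darts. -/
noncomputable def inclMatrix : Matrix G.representative.Dart G.graph.Dart ℂ :=
  Matrix.of fun e d => if G.incl e = d then 1 else 0

theorem dart_eq_addDart {d : G.graph.Dart} {u v : V} (h : G.additional.Adj u v) (h1 : d.fst = u)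
    (h2 : d.snd = v) : d = G.addDart h := by
  subst h1 h2
  rfl

theorem walkWeight_cons_symm_eq_zero (e : G.graph.Dart) {u v w : V} (h : G.additional.Adj v u)
    (p : G.additional.Walk u w) {d : G.graph.Dart} (hd : d.fst = u) :
    G.walkWeight x e (.cons h p) d = 0 := by
  rw [walkWeight, fullMatrix_apply_of_eq _ _ (by exact hd), zero_mul]

open Classical in
theorem walkWeight_eq_sum [Fintype G.graph.Dart] {e : G.representative.Dart} {u w : V}
    (p : G.additional.Walk u w) (hp : p.IsPath) {d : G.graph.Dart} (hu : d.snd = u)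
    (hw : e.fst = w) :
    G.walkWeight x (G.incl e) p d = G.fullMatrix x d (G.incl e) +
      ∑ a : G.graph.Dart, G.fullMatrix x d a *
        ((if G.additional.Adj a.fst a.snd then 1 else 0) * G.transfer x a e) := by
  cases p with
  | nil =>
    rw [walkWeight, Finset.sum_eq_zero, add_zero]
    intro a _
    by_cases ha : G.additional.Adj a.fst a.snd
    · by_cases had : d.snd = a.fst
      · have hau : a.fst = u := by rw [← had, hu]
        rw [G.transfer_eq x (.cons (hau ▸ ha.symm) (.nil : G.additional.Walk u u))
          (by simpa using (hau ▸ ha.ne')) rfl hw, walkWeight_cons_symm_eq_zero _ _ _ _ _ hau]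
        simp
      · rw [fullMatrix_apply_of_ne _ _ had, zero_mul]
    · simp [ha]
  | @cons _ v _ h p' =>
    have hpath := hp
    rw [SimpleGraph.Walk.cons_isPath_iff] at hp
    have hne : d.snd ≠ (G.incl e).fst := by
      rw [hu]
      change u ≠ e.fst
      rw [hw]
      rintro rfl
      exact hp.2 p'.end_mem_support
    rw [fullMatrix_apply_of_ne _ _ hne, zero_add, Finset.sum_eq_single (G.addDart h)]
    · rw [walkWeight, G.transfer_eq x p' hp.1 rfl hw, if_pos (by exact h), one_mul]
    · intro a _ hav
      by_cases ha : G.additional.Adj a.fst a.snd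
      · by_cases had : d.snd = a.fst
        · have hau : a.fst = u := by rw [← had, hu]
          have hadj : G.additional.Adj u a.snd := hau ▸ ha
          have hnot : a.snd ∉ (SimpleGraph.Walk.cons h p').support := by
            intro hmem
            have := G.additional_isAcyclic.eq_snd_of_adj_start hpath hadj hmem
            rw [SimpleGraph.Walk.snd_cons] at this
            exact hav (G.dart_eq_addDart h hau this)
          rw [G.transfer_eq x (.cons hadj.symm (.cons h p'))
            ((SimpleGraph.Walk.cons_isPath_iff _ _).2 ⟨hpath, hnot⟩) rfl hw,
            walkWeight_cons_symm_eq_zero _ _ _ _ _ hau]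
          simp
        · rw [fullMatrix_apply_of_ne _ _ had, zero_mul]
      · simp [ha]
    · simp

theorem transfer_recursion [Fintype G.graph.Dart] :
    G.transfer x = G.fullMatrix x * G.inclMatrixᵀ + G.fullMatrix x * (G.addProj * G.transfer x) := by
  classical
  ext d e
  have h1 : (G.fullMatrix x * G.inclMatrixᵀ) d e = G.fullMatrix x d (G.incl e) := by
    simp [Matrix.mul_apply, inclMatrix]
  have h2 : (G.fullMatrix x * (G.addProj * G.transfer x)) d e = ∑ a : G.graph.Dart,
      G.fullMatrix x d a * ((if G.additional.Adj a.fst a.snd then 1 else 0) * G.transfer x a e) := by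
    rw [Matrix.mul_apply]
    refine Finset.sum_congr rfl fun a _ => ?_
    rw [addProj_mul_apply]
  rw [Matrix.add_apply, h1, h2]
  by_cases h : ∃ p : G.additional.Walk d.snd e.fst, p.IsPath
  · obtain ⟨p, hp⟩ := h
    rw [G.transfer_eq x p hp rfl rfl]
    convert G.walkWeight_eq_sum x p hp rfl rfl
  · have hne : d.snd ≠ (G.incl e).fst := by
      intro h'
      change d.snd = e.fst at h'
      refine h ?_
      rw [h']
      exact ⟨.nil, by simp⟩
    rw [G.transfer_eq_zero x h, fullMatrix_apply_of_ne _ _ hne, zero_add, Finset.sum_eq_zero]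
    intro a _
    by_cases ha : G.additional.Adj a.fst a.snd
    · by_cases had : d.snd = a.fst
      · rw [G.transfer_eq_zero x, mul_zero, mul_zero]
        rintro ⟨p, hp⟩
        refine h ?_
        rw [had]
        exact ⟨(SimpleGraph.Walk.cons ha p).bypass, SimpleGraph.Walk.bypass_isPath _⟩
      · rw [fullMatrix_apply_of_ne _ _ had, zero_mul]
    · simp [ha]

theorem walkWeight_eq_exp {e : G.representative.Dart} {u w : V} (p : G.additional.Walk u w)
    (hp : p.IsPath) {d : G.graph.Dart} (hu : d.snd = u) (hw : e.fst = w)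
    (hd : d.fst ≠ (p.support.tail ++ [e.snd]).head (by simp)) :
    G.walkWeight x (G.incl e) p d = x d.edge * (p.edges.map x).prod *
      Complex.exp (Complex.I / 2 * (G.pathAngle (d.fst :: (p.support ++ [e.snd])) : ℂ)) := by
  induction p generalizing d with
  | nil =>
    rw [walkWeight, fullMatrix_apply_of_step _ _ (by rw [hu, ← hw]; rfl) (by exact hd)]
    simp [pathAngle, hu, incl]
  | @cons u v w h p ih =>
    rw [SimpleGraph.Walk.cons_isPath_iff] at hp
    have hs := p.cons_tail_support.symm
    have hdv : d.fst ≠ v := by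
      simp only [SimpleGraph.Walk.support_cons, List.tail_cons] at hd
      rwa [List.head_append_of_ne_nil (by simp), SimpleGraph.Walk.head_support] at hd
    rw [walkWeight, fullMatrix_apply_of_step _ _ (by exact hu) (by exact hdv),
      ih hp.1 rfl hw]
    · have h1 : (G.addDart h).edge = s(u, v) := rfl
      have h2 : (G.addDart h).fst = u := rfl
      have h3 : (G.addDart h).snd = v := rfl
      rw [SimpleGraph.Walk.support_cons, SimpleGraph.Walk.edges_cons, hs, h1, h2, h3, hu]
      simp only [List.cons_append, pathAngle, List.map_cons, List.prod_cons]
      push_cast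
      rw [mul_add, Complex.exp_add]
      ring
    · cases p with
      | nil =>
        change u ≠ e.snd
        rintro rfl
        exact e.adj.2 (hw ▸ h.symm)
      | cons h' p' =>
        simp only [SimpleGraph.Walk.support_cons, List.tail_cons]
        rw [List.head_append_of_ne_nil (by simp), SimpleGraph.Walk.head_support]
        rintro rfl
        exact hp.2 (List.mem_cons_of_mem _ p'.start_mem_support)

theorem inclMatrix_mul_transfer [Fintype G.graph.Dart] :
    G.inclMatrix * G.transfer x = G.transitionMatrix x := by
  classical
  ext d e
  have h1 : (G.inclMatrix * G.transfer x) d e = G.transfer x (G.incl d) e := by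
    simp [Matrix.mul_apply, inclMatrix]
  rw [h1, transitionMatrix]
  have hfst : (G.incl d).fst = d.fst := rfl
  have hsnd : (G.incl d).snd = d.snd := rfl
  have hedge : (G.incl d).edge = d.edge := rfl
  by_cases h : d.snd = e.fst
  · rw [if_pos h, G.transfer_eq x (.nil : G.additional.Walk d.snd d.snd) (by simp) hsnd h.symm,
      walkWeight]
    split_ifs with h2
    · rw [fullMatrix_apply_of_step _ _ h h2]
      rfl
    · exact fullMatrix_apply_of_eq _ _ (not_not.1 h2)
  · rw [if_neg h]
    split_ifs with hex
    · rw [G.transfer_eq x hex.choose hex.choose_spec hsnd rfl,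
        walkWeight_eq_exp _ _ _ hex.choose_spec hsnd rfl]
      · simp [hfst, hedge]
      · generalize hex.choose = p
        revert h
        generalize hz : d.snd = z at p
        intro h
        cases p with
        | nil => exact absurd rfl h
        | cons h' p' =>
          simp only [SimpleGraph.Walk.support_cons, List.tail_cons]
          rw [hfst]
          intro h''
          rw [List.head_append_of_ne_nil (by simp), SimpleGraph.Walk.head_support] at h''
          have := d.adj.2
          apply this
          rw [h'', hz]
          exact h'.symm
    · exact G.transfer_eq_zero x hex

theorem addProj_add [Fintype G.representative.Dart] [DecidableEq G.graph.Dart] :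
    G.addProj + G.inclMatrixᵀ * G.inclMatrix = 1 := by
  classical
  ext d e
  by_cases h : G.additional.Adj d.fst d.snd
  · have : (G.inclMatrixᵀ * G.inclMatrix) d e = 0 := by
      rw [Matrix.mul_apply]
      refine Finset.sum_eq_zero fun r _ => ?_
      have : G.incl r ≠ d := by
        rintro rfl
        exact r.adj.2 h
      simp [inclMatrix, this]
    rw [Matrix.add_apply, this, add_zero, Matrix.one_apply]
    by_cases hde : d = e
    · subst hde
      simp [addProj, h]
    · simp [addProj, hde]
  · have : (G.inclMatrixᵀ * G.inclMatrix) d e = (1 : Matrix _ _ ℂ) d e := by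
      rw [Matrix.mul_apply, Finset.sum_eq_single (⟨d.toProd, d.adj, h⟩ : G.representative.Dart)]
      · have : G.incl ⟨d.toProd, d.adj, h⟩ = d := rfl
        simp [inclMatrix, this, Matrix.one_apply]
      · intro r _ hr
        have : G.incl r ≠ d := fun h' => hr (G.incl_injective h')
        simp [inclMatrix, this]
      · simp
    rw [Matrix.add_apply, this]
    by_cases hde : d = e
    · subst hde
      simp [addProj, h]
    · simp [addProj, hde]

theorem exists_walk_of_pow_apply_ne_zero [Fintype G.graph.Dart] [DecidableEq G.graph.Dart] (n : ℕ)
    {d e : G.graph.Dart} (h : ((G.fullMatrix x * G.addProj) ^ n) d e ≠ 0) :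
    ∃ w, ∃ p : G.additional.Walk d.snd w, p.length = n ∧ (d.edge :: p.edges).IsChain (· ≠ ·) := by
  classical
  induction n generalizing d with
  | zero => exact ⟨_, .nil, rfl, by simp⟩
  | succ n ih =>
    rw [pow_succ', Matrix.mul_apply] at h
    obtain ⟨a, -, ha⟩ := Finset.exists_ne_zero_of_sum_ne_zero h
    have h1 : (G.fullMatrix x * G.addProj) d a ≠ 0 := left_ne_zero_of_mul ha
    obtain ⟨w, p, hp, hchain⟩ := ih (right_ne_zero_of_mul ha)
    have h2 : G.fullMatrix x d a ≠ 0 ∧ G.additional.Adj a.fst a.snd := by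
      rw [mul_addProj_apply] at h1
      refine ⟨left_ne_zero_of_mul h1, ?_⟩
      by_contra h3
      simp [h3] at h1
    have h3 : d.snd = a.fst := by
      by_contra h3
      exact h2.1 (fullMatrix_apply_of_ne _ _ h3)
    have h4 : d.fst ≠ a.snd := fun h4 => h2.1 (fullMatrix_apply_of_eq _ _ h4)
    rw [h3]
    refine ⟨w, .cons h2.2 p, by simp [hp], ?_⟩
    rw [SimpleGraph.Walk.edges_cons]
    refine List.isChain_cons_cons.2 ⟨?_, hchain⟩
    intro h5
    have h6 : d.edge = a.edge := h5
    rcases (SimpleGraph.dart_edge_eq_iff _ _).1 h6 with rfl | rfl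
    · exact d.adj.ne h3.symm
    · exact h4 rfl

theorem fullMatrix_mul_addProj_pow_eq_zero [Fintype V] [Fintype G.graph.Dart]
    [DecidableEq G.graph.Dart] :
    (G.fullMatrix x * G.addProj) ^ Fintype.card V = 0 := by
  ext d e
  by_contra h
  obtain ⟨w, p, hp, hchain⟩ := G.exists_walk_of_pow_apply_ne_zero x _ h
  have := ((G.additional_isAcyclic.isPath_iff_isChain p).2 hchain.tail).length_lt
  omega

theorem det_one_sub_of_isNilpotent {n : Type*} [Fintype n] [DecidableEq n] {A : Matrix n n ℂ}
    (hA : IsNilpotent A) : (1 - A).det = 1 := by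
  have h := Matrix.isNilpotent_charpoly_sub_pow_of_isNilpotent hA
  have h1 : A.charpoly = Polynomial.X ^ Fintype.card n := sub_eq_zero.1 h.eq_zero
  have h2 : (1 - A).det = A.charpoly.eval 1 := by
    rw [Matrix.eval_charpoly]
    simp
  rw [h2, h1]
  simp

theorem det_one_sub_fullMatrix [Fintype V] [Fintype G.graph.Dart] [DecidableEq G.graph.Dart]
    [Fintype G.representative.Dart] [DecidableEq G.representative.Dart] :
    (1 - G.fullMatrix x).det = (1 - G.transitionMatrix x).det := by
  have h1 : 1 - G.fullMatrix x =
      (1 - G.fullMatrix x * G.addProj) * (1 - G.transfer x * G.inclMatrix) := by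
    have h2 : (1 - G.fullMatrix x * G.addProj) * G.transfer x =
        G.fullMatrix x * G.inclMatrixᵀ := by
      rw [Matrix.sub_mul, Matrix.one_mul, Matrix.mul_assoc, sub_eq_iff_eq_add]
      exact G.transfer_recursion x
    rw [Matrix.mul_sub, Matrix.mul_one, ← Matrix.mul_assoc, h2, sub_sub, Matrix.mul_assoc,
      ← Matrix.mul_add, addProj_add, Matrix.mul_one]
  rw [h1, Matrix.det_mul, det_one_sub_of_isNilpotent ⟨_, G.fullMatrix_mul_addProj_pow_eq_zero x⟩,
    one_mul, Matrix.det_one_sub_mul_comm, inclMatrix_mul_transfer]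

/-- The Kac–Ward formula. -/
theorem Z_sq_eq_det [Fintype V] [Fintype G.representative.Dart]
    [DecidableEq G.representative.Dart] : G.Z x ^ 2 = (1 - G.transitionMatrix x).det := by
  classical
  rw [Z_sq_eq_det_fullMatrix, det_one_sub_fullMatrix]

end AdditionalEdges

end PlaneGraph

section TraceExpansion

open Matrix Polynomial

theorem Matrix.map_derivative_mul {n R : Type*} [Fintype n] [CommRing R] (M N : Matrix n n R[X]) :
    (M * N).map derivative = M.map derivative * N + M * N.map derivative := by
  ext1 i j
  simp only [Matrix.map_apply, Matrix.mul_apply, Matrix.add_apply, derivative_sum, derivative_mul,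
    Finset.sum_add_distrib]

theorem Matrix.trace_map_derivative_pow_mul_pow {n R : Type*} [Fintype n] [DecidableEq n]
    [CommRing R] (M : Matrix n n R[X]) (k m : ℕ) :
    ((M ^ (k + 1)).map derivative * M ^ m).trace =
      ((k + 1 : ℕ) : R[X]) * (M.map derivative * M ^ (k + m)).trace := by
  induction k generalizing m with
  | zero => simp
  | succ k ih =>
    have h1 : (M ^ (k + 1) * M.map derivative * M ^ m).trace =
        (M.map derivative * M ^ (k + 1 + m)).trace := by
      rw [mul_assoc, Matrix.trace_mul_comm, mul_assoc, ← pow_add, add_comm m]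
    rw [pow_succ, Matrix.map_derivative_mul, add_mul, Matrix.trace_add, mul_assoc, ← pow_succ', ih,
      h1, show k + (m + 1) = k + 1 + m by ring]
    push_cast
    ring

theorem Matrix.derivative_trace_pow_succ {n R : Type*} [Fintype n] [DecidableEq n]
    [CommRing R] (M : Matrix n n R[X]) (k : ℕ) :
    derivative (M ^ (k + 1)).trace =
      ((k + 1 : ℕ) : R[X]) * (M.map derivative * M ^ k).trace := by
  have := M.trace_map_derivative_pow_mul_pow k 0
  rw [pow_zero, mul_one, add_zero] at this
  rw [← this, Matrix.trace, Matrix.trace, derivative_sum]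
  rfl

variable {n : Type*} [Fintype n]

/-- The matrix `A + X B`. -/
noncomputable def linearPencil (A B : Matrix n n ℂ) : Matrix n n ℂ[X] :=
  Matrix.of fun i j => C (A i j) + C (B i j) * X

variable [DecidableEq n]

/-- The coefficient of `X ^ r` in `(A + X B) ^ k`. -/
noncomputable def pencilCoeff (A B : Matrix n n ℂ) (k r : ℕ) : Matrix n n ℂ :=
  (linearPencil A B ^ k).map fun p => p.coeff r

variable {A B : Matrix n n ℂ}

theorem pencilCoeff_succ_zero (k : ℕ) : pencilCoeff A B (k + 1) 0 = A * pencilCoeff A B k 0 := by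
  ext i j
  simp [pencilCoeff, pow_succ', Matrix.mul_apply, linearPencil, add_mul, mul_assoc]

theorem pencilCoeff_succ_succ (k r : ℕ) : pencilCoeff A B (k + 1) (r + 1) =
    A * pencilCoeff A B k (r + 1) + B * pencilCoeff A B k r := by
  ext i j
  simp [pencilCoeff, pow_succ', Matrix.mul_apply, linearPencil, add_mul, mul_assoc,
    Finset.sum_add_distrib]

theorem pencilCoeff_zero_zero : pencilCoeff A B 0 0 = 1 := by
  ext i j
  by_cases h : i = j <;> simp [pencilCoeff, Matrix.one_apply, h]

theorem pencilCoeff_zero_succ (r : ℕ) : pencilCoeff A B 0 (r + 1) = 0 := by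
  ext i j
  by_cases h : i = j <;> simp [pencilCoeff, h, coeff_one]

theorem pencilCoeff_eq_zero {N : ℕ} (hA : A ^ N = 0) {k r : ℕ} (h : N * (r + 1) ≤ k) :
    pencilCoeff A B k r = 0 := by
  induction r generalizing k with
  | zero =>
    have h1 : ∀ k, pencilCoeff A B k 0 = A ^ k := by
      intro k
      induction k with
      | zero => rw [pencilCoeff_zero_zero, pow_zero]
      | succ k ih => rw [pencilCoeff_succ_zero, ih, pow_succ']
    rw [h1, show k = N + (k - N) by omega, pow_add, hA, zero_mul]
  | succ r ih =>
    have h1 : ∀ j, pencilCoeff A B (N * (r + 1) + j) (r + 1) =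
        A ^ j * pencilCoeff A B (N * (r + 1)) (r + 1) := by
      intro j
      induction j with
      | zero => simp
      | succ j ihj =>
        rw [← add_assoc, pencilCoeff_succ_succ, ih (by omega), ihj, mul_zero, add_zero, pow_succ',
          mul_assoc]
    have h2 : N * (r + 1 + 1) = N * (r + 1) + N := by ring
    rw [show k = N * (r + 1) + (N + (k - N * (r + 1) - N)) by omega, h1, pow_add, hA, zero_mul,
      zero_mul]

theorem sum_pencilCoeff {N : ℕ} (hA : A ^ N = 0) {T : Matrix n n ℂ} (hT : (1 - A) * T = B)
    {L r : ℕ} (h : N * (r + 1) ≤ L) :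
    ∑ k ∈ Finset.range L, pencilCoeff A B k r =
      T ^ r * ∑ k ∈ Finset.range L, pencilCoeff A B k 0 ∧
    (1 - A) * (∑ k ∈ Finset.range L, pencilCoeff A B k 0) = 1 := by
  have hshift : ∀ s ≤ r, ∑ k ∈ Finset.range L, pencilCoeff A B (k + 1) s + pencilCoeff A B 0 s =
      ∑ k ∈ Finset.range L, pencilCoeff A B k s := by
    intro s hs
    rw [← Finset.sum_range_succ' (fun k => pencilCoeff A B k s), Finset.sum_range_succ,
      pencilCoeff_eq_zero hA (le_trans (Nat.mul_le_mul_left _ (by omega)) h), add_zero]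
  have h0 : (1 - A) * (∑ k ∈ Finset.range L, pencilCoeff A B k 0) = 1 := by
    have := hshift 0 (Nat.zero_le _)
    simp only [pencilCoeff_succ_zero, pencilCoeff_zero_zero, ← Finset.mul_sum] at this
    rw [sub_mul, one_mul, sub_eq_iff_eq_add, add_comm, this]
  refine ⟨?_, h0⟩
  have key : ∀ s ≤ r, (∑ k ∈ Finset.range L, pencilCoeff A B k s) =
      T ^ s * ∑ k ∈ Finset.range L, pencilCoeff A B k 0 := by
    intro s hs
    induction s with
    | zero => simp
    | succ s ih =>
      have := hshift (s + 1) hs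
      simp only [pencilCoeff_succ_succ, pencilCoeff_zero_succ, ← Finset.mul_sum,
        Finset.sum_add_distrib, add_zero] at this
      have h1 : (1 - A) * (∑ k ∈ Finset.range L, pencilCoeff A B k (s + 1)) =
          (1 - A) * (T ^ (s + 1) * ∑ k ∈ Finset.range L, pencilCoeff A B k 0) := by
        rw [pow_succ', mul_assoc, ← mul_assoc (1 - A), hT, ← ih (by omega), sub_mul, one_mul,
          sub_eq_iff_eq_add, add_comm (B * _), this]
      have h2 := mul_eq_one_comm.1 h0
      have := congrArg (fun Y => (∑ k ∈ Finset.range L, pencilCoeff A B k 0) * Y) h1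
      simpa only [← mul_assoc, h2, one_mul] using this
  exact key r le_rfl

/-- The sum of the coefficients of `X ^ (r + 1)` in `tr (A + X B) ^ k / k`, for nilpotent `A`. -/
theorem sum_coeff_trace_linearPencil_pow {N : ℕ} (hA : A ^ N = 0) {T : Matrix n n ℂ}
    (hT : (1 - A) * T = B) {L r : ℕ} (h : N * (r + 1) ≤ L) :
    ∑ k ∈ Finset.range L, (linearPencil A B ^ (k + 1)).trace.coeff (r + 1) / ((k : ℂ) + 1) =
      (T ^ (r + 1)).trace / ((r : ℂ) + 1) := by
  have h1 : ∀ k : ℕ, (linearPencil A B ^ (k + 1)).trace.coeff (r + 1) / ((k : ℂ) + 1) =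
      (B * pencilCoeff A B k r).trace / ((r : ℂ) + 1) := by
    intro k
    have h2 := congrArg (fun p => p.coeff r) ((linearPencil A B).derivative_trace_pow_succ k)
    simp only [coeff_derivative, ← nsmul_eq_mul, coeff_smul] at h2
    have h3 : ((linearPencil A B).map derivative * linearPencil A B ^ k).trace.coeff r =
        (B * pencilCoeff A B k r).trace := by
      simp [Matrix.trace, Matrix.mul_apply, linearPencil, pencilCoeff]
    have hk : ((k : ℂ) + 1) ≠ 0 := by exact_mod_cast Nat.succ_ne_zero k
    have hr : ((r : ℂ) + 1) ≠ 0 := by exact_mod_cast Nat.succ_ne_zero r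
    rw [h3] at h2
    rw [div_eq_div_iff hk hr, h2]
    simp [mul_comm]
  obtain ⟨h2, h0⟩ := sum_pencilCoeff hA hT h
  have h3 := mul_eq_one_comm.1 h0
  have h4 : T = (∑ k ∈ Finset.range L, pencilCoeff A B k 0) * B := by
    rw [← one_mul T, ← h3, mul_assoc, hT]
  rw [Finset.sum_congr rfl fun k _ => h1 k, ← Finset.sum_div, ← Matrix.trace_sum, ← Finset.mul_sum]
  congr 1
  rw [Matrix.trace_mul_comm, h2, mul_assoc, ← h4, pow_succ]

end TraceExpansion

section ListSums

variable {α β : Type*}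

/-- The lists of a given length over a finite type. -/
def listsOfLength (α : Type*) [Fintype α] : ℕ → Finset (List α)
  | 0 => {[]}
  | n + 1 => (Finset.univ ×ˢ listsOfLength α n).map
      ⟨fun p => p.1 :: p.2, fun _ _ h => Prod.ext (List.cons.inj h).1 (List.cons.inj h).2⟩

theorem mem_listsOfLength [Fintype α] {n : ℕ} {l : List α} :
    l ∈ listsOfLength α n ↔ l.length = n := by
  induction n generalizing l with
  | zero => simp [listsOfLength]
  | succ n ih =>
    cases l with
    | nil => simp [listsOfLength]
    | cons a l =>
      rw [listsOfLength, Finset.mem_map]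
      constructor
      · rintro ⟨⟨b, l'⟩, h, heq⟩
        obtain ⟨rfl, rfl⟩ := List.cons.inj heq
        simpa [ih] using h
      · intro h
        exact ⟨(a, l), by simpa [ih] using h, rfl⟩

theorem sum_listsOfLength_succ [Fintype α] [AddCommMonoid β] (n : ℕ) (f : List α → β) :
    ∑ l ∈ listsOfLength α (n + 1), f l = ∑ a : α, ∑ l ∈ listsOfLength α n, f (a :: l) := by
  rw [listsOfLength, Finset.sum_map, Finset.sum_product]
  rfl

theorem Matrix.pow_succ_apply_eq_sum_lists {n R : Type*} [Fintype n] [DecidableEq n] [CommSemiring R]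
    (M : Matrix n n R) (k : ℕ) (i j : n) :
    (M ^ (k + 1)) i j =
      ∑ l ∈ listsOfLength n k, (List.zipWith (fun i j => M i j) (i :: l) (l ++ [j])).prod := by
  induction k generalizing i with
  | zero => simp [listsOfLength]
  | succ k ih =>
    rw [pow_succ', Matrix.mul_apply, sum_listsOfLength_succ]
    refine Finset.sum_congr rfl fun a _ => ?_
    rw [ih, Finset.mul_sum]
    rfl

/-- The trace of a power of a matrix as a sum over closed sequences. -/
theorem Matrix.trace_pow_succ_eq_sum_lists {n R : Type*} [Fintype n] [DecidableEq n] [CommSemiring R]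
    (M : Matrix n n R) (k : ℕ) :
    (M ^ (k + 1)).trace =
      ∑ l ∈ listsOfLength n (k + 1), (List.zipWith (fun i j => M i j) l (l.rotate 1)).prod := by
  rw [sum_listsOfLength_succ]
  refine Finset.sum_congr rfl fun i _ => ?_
  rw [Matrix.diag_apply, M.pow_succ_apply_eq_sum_lists]
  refine Finset.sum_congr rfl fun l _ => ?_
  rw [List.rotate_cons_succ, List.rotate_zero]

theorem List.zipWith3_eq_zipWith_zip {γ δ : Type*} (f : α → β → γ → δ) (a : List α) (b : List β)
    (c : List γ) : List.zipWith3 f a b c = List.zipWith (fun u p => f u p.1 p.2) a (b.zip c) := by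
  rw [List.zip, List.zipWith_zipWith_right]

theorem List.prod_zipWith_mul_right {R : Type*} [CommMonoid R] (f : α → β → R) (u : β → R)
    {l : List α} {l' : List β} (h : l.length = l'.length) :
    (List.zipWith (fun a b => f a b * u b) l l').prod =
      (List.zipWith f l l').prod * (l'.map u).prod := by
  induction l generalizing l' with
  | nil =>
    cases l' with
    | nil => simp
    | cons b l' => simp at h
  | cons a l ih =>
    cases l' with
    | nil => simp at h
    | cons b l' =>
      simp only [List.zipWith_cons_cons, List.prod_cons, List.map_cons]
      rw [ih (by simpa using h), mul_mul_mul_comm]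

end ListSums

namespace PlaneGraph

section ClosedPaths

open Polynomial Matrix

variable {V : Type*} (G : PlaneGraph V) (x : Sym2 V → ℂ)

theorem isClosedPath_iff {l : List V} : G.IsClosedPath l ↔ l ≠ [] ∧ ∀ (i : ℕ) (h : i < l.length),
    G.graph.Adj l[i] ((l.rotate 1)[i]'(by simpa)) ∧ (l.rotate 2)[i]'(by simpa) ≠ l[i] := by
  constructor
  · rintro ⟨hl, h⟩
    refine ⟨by rintro rfl; simp at hl, fun i hi => ?_⟩
    obtain ⟨h1, h2⟩ := h i
    have h3 := List.isChain_iff_getElem.1 h1 0 (by simp; omega)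
    have h4 := h2 0 (by simp; omega)
    simp only [List.getElem_rotate] at h3 h4 ⊢
    simp only [zero_add, Nat.mod_eq_of_lt hi] at h3 h4
    simp only [add_comm 1, add_comm 2] at h3 h4
    exact ⟨h3, h4⟩
  · rintro ⟨hne, h⟩
    have hpos := List.length_pos_iff.2 hne
    refine ⟨?_, fun k => ⟨List.isChain_iff_getElem.2 ?_, ?_⟩⟩
    · by_contra hlt
      obtain ⟨h1, h2⟩ := h 0 hpos
      simp only [List.getElem_rotate] at h1 h2
      have : l.length = 1 ∨ l.length = 2 := by omega
      rcases this with h' | h'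
      · simp [h'] at h1
      · simp [h'] at h2
    · intro i hi
      simp only [List.getElem_rotate]
      have := (h ((i + k) % l.length) (Nat.mod_lt _ hpos)).1
      simp only [List.getElem_rotate, Nat.mod_add_mod] at this
      simpa only [add_right_comm i 1 k] using this
    · intro i hi
      simp only [List.getElem_rotate]
      have := (h ((i + k) % l.length) (Nat.mod_lt _ hpos)).2
      simp only [List.getElem_rotate, Nat.mod_add_mod] at this
      simpa only [add_right_comm i 2 k] using this

/-- The weight of a closed path as a cyclic sequence of steps, without the minus sign and without
regard to multiplicity. -/
noncomputable def cyclicWeight (l : List V) : ℂ :=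
  Complex.exp (Complex.I / 2 * (G.windingAngle l : ℂ)) * ((cyclicEdges l).map x).prod

theorem exp_windingAngle (l : List V) (c : ℂ) : Complex.exp (c * (G.windingAngle l : ℂ)) =
    (List.zipWith3 (fun u v w => Complex.exp (c * (G.turn u v w : ℂ)))
      l (l.rotate 1) (l.rotate 2)).prod := by
  rw [windingAngle]
  generalize l.rotate 1 = a
  generalize l.rotate 2 = b
  induction l generalizing a b with
  | nil => simp [List.zipWith3]
  | cons u l ih =>
    rcases a with - | ⟨v, a⟩ <;> rcases b with - | ⟨w, b⟩ <;> simp [List.zipWith3]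
    rw [mul_add, Complex.exp_add, ← ih]

theorem cyclicWeight_eq (l : List V) : G.cyclicWeight x l =
    (List.zipWith3 (fun u v w => x s(u, v) * Complex.exp (Complex.I / 2 * (G.turn u v w : ℂ)))
      l (l.rotate 1) (l.rotate 2)).prod := by
  rw [cyclicWeight, exp_windingAngle, cyclicEdges]
  have h1 : (l.rotate 1).length = l.length := by simp
  have h2 : (l.rotate 2).length = l.length := by simp
  revert h1 h2
  generalize l.rotate 1 = a
  generalize l.rotate 2 = b
  intro h1 h2
  induction l generalizing a b with
  | nil => simp [List.zipWith3]
  | cons u l ih =>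
    rcases a with - | ⟨v, a⟩ <;> rcases b with - | ⟨w, b⟩ <;> simp at h1 h2
    simp only [List.zipWith3, List.zipWith_cons_cons, List.map_cons, List.prod_cons]
    rw [← ih a b h1 h2]
    ring

/-- The number of representative darts in a sequence. -/
noncomputable def repCount (D : List G.graph.Dart) : ℕ :=
  open Classical in D.countP fun d => ¬ G.additional.Adj d.fst d.snd

theorem exists_dart_list {l : List V} (h : G.IsClosedPath l) :
    ∃ D : List G.graph.Dart, D.map (fun d => d.toProd) = l.zip (l.rotate 1) := by
  have : l.zip (l.rotate 1) ∈ Set.range (List.map fun d : G.graph.Dart => d.toProd) := by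
    rw [Set.range_list_map]
    intro p hp
    obtain ⟨i, hi, rfl⟩ := List.mem_iff_getElem.1 hp
    simp only [List.getElem_zip]
    exact ⟨⟨_, ((G.isClosedPath_iff.1 h).2 i (by simpa using hi)).1⟩, rfl⟩
  exact this

theorem fst_of_dart_list {D : List G.graph.Dart} {l : List V}
    (h : D.map (fun d => d.toProd) = l.zip (l.rotate 1)) : D.map (fun d => d.fst) = l := by
  have := congrArg (List.map Prod.fst) h
  rw [List.map_map, List.map_fst_zip (by simp)] at this
  exact this

theorem snd_of_dart_list {D : List G.graph.Dart} {l : List V}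
    (h : D.map (fun d => d.toProd) = l.zip (l.rotate 1)) : D.map (fun d => d.snd) = l.rotate 1 := by
  have := congrArg (List.map Prod.snd) h
  rw [List.map_map, List.map_snd_zip (by simp)] at this
  exact this

theorem prod_zipWith_fullMatrix {D : List G.graph.Dart} {l : List V} (hl : G.IsClosedPath l)
    (h : D.map (fun d => d.toProd) = l.zip (l.rotate 1)) :
    (List.zipWith (fun d e => G.fullMatrix x d e) D (D.rotate 1)).prod = G.cyclicWeight x l := by
  rw [cyclicWeight_eq, List.zipWith3_eq_zipWith_zip]
  congr 1
  have h1 := G.fst_of_dart_list h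
  have h2 := G.snd_of_dart_list h
  have hlen : D.length = l.length := by rw [← h1, List.length_map]
  refine List.ext_getElem (by simp [hlen]) fun i hi hi' => ?_
  have hiD : i < D.length := by simpa using hi
  have hil : i < l.length := hlen ▸ hiD
  simp only [List.getElem_zipWith, List.getElem_zip]
  have e1 : D[i].fst = l[i] := by simp [← h1]
  have e2 : D[i].snd = (l.rotate 1)[i]'(by simpa) := by simp [← h2]
  have e3 : ((D.rotate 1)[i]'(by simpa)).fst = (l.rotate 1)[i]'(by simpa) := by
    simp [← h1, ← List.map_rotate]
  have e4 : ((D.rotate 1)[i]'(by simpa)).snd = (l.rotate 2)[i]'(by simpa) := by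
    have : l.rotate 2 = (D.rotate 1).map fun d => d.snd := by
      rw [List.map_rotate, h2, List.rotate_rotate]
    simp [this]
  have hcond := ((G.isClosedPath_iff.1 hl).2 i hil).2
  rw [fullMatrix_apply_of_step _ _ (e2.trans e3.symm) (by rw [e1, e4]; exact hcond.symm), e1, e2, e4]
  congr 2
  change s(D[i].fst, D[i].snd) = _
  rw [e1, e2]

theorem isClosedPath_of_prod_ne_zero {D : List G.graph.Dart} (hD : D ≠ [])
    (h : (List.zipWith (fun d e => G.fullMatrix x d e) D (D.rotate 1)).prod ≠ 0) :
    G.IsClosedPath (D.map fun d => d.fst) ∧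
      D.map (fun d => d.toProd) =
        (D.map fun d => d.fst).zip ((D.map fun d => d.fst).rotate 1) := by
  have h1 : ∀ (i : ℕ) (hi : i < D.length),
      G.fullMatrix x D[i] ((D.rotate 1)[i]'(by simpa)) ≠ 0 := by
    intro i hi h0
    refine h (List.prod_eq_zero ?_)
    refine List.mem_iff_getElem.2 ⟨i, by simpa using hi, ?_⟩
    rw [List.getElem_zipWith, h0]
  have h2 : ∀ (i : ℕ) (hi : i < D.length), D[i].snd = ((D.rotate 1)[i]'(by simpa)).fst := by
    intro i hi
    by_contra h3
    exact h1 i hi (fullMatrix_apply_of_ne _ _ h3)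
  have h3 : ∀ (i : ℕ) (hi : i < D.length), D[i].fst ≠ ((D.rotate 1)[i]'(by simpa)).snd :=
    fun i hi h3 => h1 i hi (fullMatrix_apply_of_eq _ _ h3)
  have h4 : D.map (fun d => d.snd) = (D.map fun d => d.fst).rotate 1 := by
    rw [← List.map_rotate]
    refine List.ext_getElem (by simp) fun i hi hi' => ?_
    simp only [List.getElem_map]
    exact h2 i (by simpa using hi)
  constructor
  · refine G.isClosedPath_iff.2 ⟨by simpa using hD, fun i hi => ?_⟩
    have hi' : i < D.length := by simpa using hi
    have h5 : (D.map fun d => d.fst).rotate 2 = (D.rotate 1).map fun d => d.snd := by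
      rw [List.map_rotate, h4, List.rotate_rotate]
    constructor
    · simp only [← h4, List.getElem_map]
      exact D[i].adj
    · simp only [h5, List.getElem_map]
      exact (h3 i hi').symm
  · rw [← h4, List.zip_map']

theorem loopLength_eq_repCount {D : List G.graph.Dart} {l : List V}
    (h : D.map (fun d => d.toProd) = l.zip (l.rotate 1)) : G.loopLength l = G.repCount D := by
  classical
  have h1 : cyclicEdges l = D.map fun d => d.edge := by
    rw [cyclicEdges, ← List.map_uncurry_zip_eq_zipWith, ← h, List.map_map]
    rfl
  rw [loopLength, h1, List.countP_map, repCount]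
  refine List.countP_congr fun d _ => ?_
  have : d.edge ∈ G.representative.edgeSet ↔ G.representative.Adj d.fst d.snd := Iff.rfl
  simp only [Function.comp_apply, this, decide_eq_true_eq]
  exact and_iff_right d.adj

theorem coeff_prod_zipWith_linearPencil [Fintype G.graph.Dart] [Fintype G.representative.Dart]
    (D : List G.graph.Dart) (r : ℕ) :
    (List.zipWith (fun d e => linearPencil (G.fullMatrix x * G.addProj)
      (G.fullMatrix x * (G.inclMatrixᵀ * G.inclMatrix)) d e) D (D.rotate 1)).prod.coeff r =
      if G.repCount D = r then (List.zipWith (fun d e => G.fullMatrix x d e) D (D.rotate 1)).prod else 0 := by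
  classical
  set u : G.graph.Dart → ℂ[X] := fun d => if G.additional.Adj d.fst d.snd then 1 else X with hu
  have h1 : (fun d e => linearPencil (G.fullMatrix x * G.addProj)
      (G.fullMatrix x * (G.inclMatrixᵀ * G.inclMatrix)) d e) =
      fun d e => C (G.fullMatrix x d e) * u e := by
    funext d e
    have h2 : G.inclMatrixᵀ * G.inclMatrix = 1 - G.addProj := by
      rw [← G.addProj_add, add_sub_cancel_left]
    rw [linearPencil, Matrix.of_apply, h2, Matrix.mul_sub, Matrix.mul_one, Matrix.sub_apply,
      mul_addProj_apply, hu]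
    by_cases h : G.additional.Adj e.fst e.snd <;> simp [h]
  have h3 : ∀ L : List G.graph.Dart, (L.map u).prod = X ^ G.repCount L := by
    intro L
    induction L with
    | nil => simp [repCount]
    | cons d L ih =>
      rw [List.map_cons, List.prod_cons, ih, repCount, repCount, List.countP_cons, hu]
      by_cases h : G.additional.Adj d.fst d.snd
      · simp [h]
      · simp [h, pow_succ']
  have h4 : (List.zipWith (fun d e => C (G.fullMatrix x d e)) D (D.rotate 1)).prod =
      C (List.zipWith (fun d e => G.fullMatrix x d e) D (D.rotate 1)).prod := by
    rw [map_list_prod, List.map_zipWith]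
  have h5 : G.repCount (D.rotate 1) = G.repCount D := (List.rotate_perm D 1).countP_eq _
  rw [h1, List.prod_zipWith_mul_right _ _ (by simp), h3, h4, h5, coeff_C_mul, coeff_X_pow]
  simp [eq_comm]

variable [Fintype V]

open Classical in
/-- The closed paths with `n` steps of which `r` are along representative edges. -/
noncomputable def closedPaths (n r : ℕ) : Finset (List V) :=
  (listsOfLength V n).filter fun l => G.IsClosedPath l ∧ G.loopLength l = r

theorem mem_closedPaths {n r : ℕ} {l : List V} :
    l ∈ G.closedPaths n r ↔ l.length = n ∧ G.IsClosedPath l ∧ G.loopLength l = r := by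
  simp [closedPaths, mem_listsOfLength]

/-- The trace of a power of the pencil counts the closed paths with their weights. -/
theorem coeff_trace_linearPencil_pow [Fintype G.graph.Dart] [DecidableEq G.graph.Dart]
    [Fintype G.representative.Dart] (n r : ℕ) :
    (linearPencil (G.fullMatrix x * G.addProj)
      (G.fullMatrix x * (G.inclMatrixᵀ * G.inclMatrix)) ^ (n + 1)).trace.coeff r =
      ∑ l ∈ G.closedPaths (n + 1) r, G.cyclicWeight x l := by
  classical
  rw [Matrix.trace_pow_succ_eq_sum_lists, finsetSum_coeff]
  simp only [coeff_prod_zipWith_linearPencil]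
  have hne : ∀ D ∈ listsOfLength G.graph.Dart (n + 1), D ≠ [] := by
    rintro D hD rfl
    simp [mem_listsOfLength] at hD
  refine Finset.sum_bij_ne_zero (fun D _ _ => D.map fun d => d.fst) ?_ ?_ ?_ ?_
  · intro D hD h
    rw [ne_eq, ite_eq_right_iff, Classical.not_imp] at h
    obtain ⟨h1, h2⟩ := G.isClosedPath_of_prod_ne_zero x (hne D hD) h.2
    rw [mem_closedPaths, G.loopLength_eq_repCount h2]
    exact ⟨by simpa [mem_listsOfLength] using hD, h1, h.1⟩
  · intro D hD h D' hD' h' heq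
    rw [ne_eq, ite_eq_right_iff, Classical.not_imp] at h h'
    have h1 := (G.isClosedPath_of_prod_ne_zero x (hne D hD) h.2).2
    have h2 := (G.isClosedPath_of_prod_ne_zero x (hne D' hD') h'.2).2
    rw [heq, ← h2] at h1
    exact List.map_injective_iff.2 (fun d e h => SimpleGraph.Dart.ext _ _ h) h1
  · intro l hl h
    rw [mem_closedPaths] at hl
    obtain ⟨D, hD⟩ := G.exists_dart_list hl.2.1
    have h1 := G.fst_of_dart_list hD
    refine ⟨D, ?_, ?_, h1⟩
    · rw [mem_listsOfLength, ← hl.1, ← h1, List.length_map]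
    · rw [← G.loopLength_eq_repCount hD, if_pos hl.2.2, G.prod_zipWith_fullMatrix x hl.2.1 hD]
      exact h
  · intro D hD h
    rw [ne_eq, ite_eq_right_iff, Classical.not_imp] at h
    obtain ⟨h1, h2⟩ := G.isClosedPath_of_prod_ne_zero x (hne D hD) h.2
    rw [if_pos h.1, G.prod_zipWith_fullMatrix x h1 h2]

theorem sum_cyclicWeight_div [Fintype G.representative.Dart] [DecidableEq G.representative.Dart]
    {L r : ℕ} (h : Fintype.card V * (r + 1) ≤ L) :
    ∑ k ∈ Finset.range L, (∑ l ∈ G.closedPaths (k + 1) (r + 1), G.cyclicWeight x l) / ((k : ℂ) + 1) =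
      (G.transitionMatrix x ^ (r + 1)).trace / ((r : ℂ) + 1) := by
  classical
  have h2 : (1 - G.fullMatrix x * G.addProj) * (G.transfer x * G.inclMatrix) =
      G.fullMatrix x * (G.inclMatrixᵀ * G.inclMatrix) := by
    rw [← Matrix.mul_assoc, ← Matrix.mul_assoc]
    congr 1
    rw [Matrix.sub_mul, Matrix.one_mul, Matrix.mul_assoc, sub_eq_iff_eq_add]
    exact G.transfer_recursion x
  have h3 := sum_coeff_trace_linearPencil_pow (G.fullMatrix_mul_addProj_pow_eq_zero x) h2 h
  simp only [coeff_trace_linearPencil_pow] at h3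
  rw [h3]
  congr 1
  have h4 : ∀ k, (G.transfer x * G.inclMatrix) ^ k * G.transfer x =
      G.transfer x * G.transitionMatrix x ^ k := by
    intro k
    induction k with
    | zero => simp
    | succ k ih =>
      rw [pow_succ', Matrix.mul_assoc, ih, pow_succ', Matrix.mul_assoc, ← Matrix.mul_assoc G.inclMatrix,
        inclMatrix_mul_transfer]
  rw [pow_succ, ← Matrix.mul_assoc, h4, Matrix.trace_mul_comm, ← Matrix.mul_assoc,
    inclMatrix_mul_transfer, pow_succ']

end ClosedPaths

end PlaneGraph

theorem List.length_lt_of_forall_isChain {α : Type*} {R : α → α → Prop} {p : α → Bool} {N : ℕ}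
    (hN : 0 < N) (h : ∀ l : List α, l.IsChain R → l.length = N → ∃ a ∈ l, p a) (l : List α)
    (hl : l.IsChain R) : l.length < N * (l.countP p + 1) := by
  induction hn : l.length using Nat.strong_induction_on generalizing l with
  | _ n ih =>
    by_cases hlt : n < N
    · exact lt_of_lt_of_le hlt (Nat.le_mul_of_pos_right _ (by omega))
    · have h1 := h (l.take N) (hl.take N) (by simp; omega)
      have h2 := ih (n - N) (by omega) (l.drop N) (hl.drop N) (by simp [hn])
      have h3 : 0 < (l.take N).countP p := List.countP_pos_iff.2 h1
      have h4 : l.countP p = (l.take N).countP p + (l.drop N).countP p := by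
        rw [← List.countP_append, List.take_append_drop]
      have h5 : N * ((l.drop N).countP p + 1) + N ≤ N * (l.countP p + 1) := by
        rw [← Nat.mul_succ]
        exact Nat.mul_le_mul_left _ (by omega)
      omega

theorem List.reverse_rotate_rotate {α : Type*} (l : List α) (k : ℕ) :
    (l.rotate k).reverse.rotate k = l.reverse := by
  rcases eq_or_ne l [] with rfl | hl
  · simp
  have hpos := List.length_pos_iff.2 hl
  have h1 := Nat.mod_lt k hpos
  have h2 : l.length - k % l.length + k = l.reverse.length * (k / l.length + 1) := by
    have := Nat.div_add_mod k l.length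
    rw [List.length_reverse, mul_add, mul_one]
    omega
  rw [List.reverse_rotate, List.rotate_rotate, h2, List.rotate_length_mul]

theorem List.exists_rotate_eq {α : Type*} (l : List α) (k : ℕ) :
    ∃ j, (l.rotate j).rotate k = l := by
  obtain ⟨j, hj⟩ := (List.IsRotated.forall l k)
  exact ⟨j, by rw [List.rotate_rotate, add_comm, ← List.rotate_rotate, hj]⟩

namespace PlaneGraph

section Length

variable {V : Type*} (G : PlaneGraph V)

/-- One can step from the first dart to the second one without going back. -/
def DartStep (d e : G.graph.Dart) : Prop := d.snd = e.fst ∧ d.fst ≠ e.snd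

variable {G} in
theorem DartStep.edge_ne {d e : G.graph.Dart} (h : G.DartStep d e) : d.edge ≠ e.edge := by
  intro h6
  rcases (SimpleGraph.dart_edge_eq_iff _ _).1 h6 with rfl | rfl
  · exact d.adj.ne h.1.symm
  · exact h.2 rfl

theorem exists_additional_walk (d : G.graph.Dart) (D : List G.graph.Dart)
    (hD : (d :: D).IsChain G.DartStep) (h : ∀ e ∈ d :: D, G.additional.Adj e.fst e.snd) :
    ∃ w, ∃ p : G.additional.Walk d.fst w, p.edges = (d :: D).map fun e => e.edge := by
  induction D generalizing d with
  | nil => exact ⟨_, .cons (h d (by simp)) .nil, rfl⟩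
  | cons e D ih =>
    rw [List.isChain_cons_cons] at hD
    obtain ⟨w, p, hp⟩ := ih e hD.2 fun a ha => h a (List.mem_cons_of_mem _ ha)
    refine ⟨w, .cons (h d (by simp)) (p.copy hD.1.1.symm rfl), ?_⟩
    rw [SimpleGraph.Walk.edges_cons, SimpleGraph.Walk.edges_copy, hp]
    rfl

theorem exists_representative_of_isChain [Fintype V] (D : List G.graph.Dart)
    (hD : D.IsChain G.DartStep) (hlen : D.length = Fintype.card V) (hne : D ≠ []) :
    ∃ d ∈ D, ¬ G.additional.Adj d.fst d.snd := by
  classical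
  by_contra! h
  obtain ⟨d, D, rfl⟩ := List.exists_cons_of_ne_nil hne
  obtain ⟨w, p, hp⟩ := G.exists_additional_walk d D hD h
  have h1 : p.edges.IsChain (· ≠ ·) := by
    rw [hp, List.isChain_map]
    exact hD.imp fun _ _ h => h.edge_ne
  have h2 := ((G.additional_isAcyclic.isPath_iff_isChain p).2 h1).length_lt
  rw [← SimpleGraph.Walk.length_edges, hp, List.length_map, hlen] at h2
  exact lt_irrefl _ h2

theorem isChain_dart_list {D : List G.graph.Dart} {l : List V} (hl : G.IsClosedPath l)
    (h : D.map (fun d => d.toProd) = l.zip (l.rotate 1)) : D.IsChain G.DartStep := by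
  have h1 := G.fst_of_dart_list h
  have h2 := G.snd_of_dart_list h
  have hlen : D.length = l.length := by rw [← h1, List.length_map]
  refine List.isChain_iff_getElem.2 fun i hi => ?_
  have f1 : ∀ (j : ℕ) (hj : j < D.length), D[j].fst = l[j] := fun j hj => by simp [← h1]
  have f2 : ∀ (j : ℕ) (hj : j < D.length), D[j].snd = (l.rotate 1)[j]'(by simp; omega) :=
    fun j hj => by simp [← h2]
  have h3 := ((G.isClosedPath_iff.1 hl).2 i (by omega)).2
  constructor
  · rw [f1, f2, List.getElem_rotate]
    simp only [Nat.mod_eq_of_lt (show i + 1 < l.length by omega)]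
  · rw [f1, f2]
    simp only [List.getElem_rotate] at h3 ⊢
    exact h3.symm

theorem length_lt_of_isClosedPath [Fintype V] {l : List V} (hl : G.IsClosedPath l) :
    l.length < Fintype.card V * (G.loopLength l + 1) := by
  classical
  obtain ⟨D, hD⟩ := G.exists_dart_list hl
  have hlen : D.length = l.length := by rw [← G.fst_of_dart_list hD, List.length_map]
  have hpos : 0 < Fintype.card V := by
    obtain ⟨v, hv⟩ := List.exists_mem_of_ne_nil l (G.isClosedPath_iff.1 hl).1
    exact Fintype.card_pos_iff.2 ⟨v⟩
  rw [← hlen, G.loopLength_eq_repCount hD, repCount]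
  refine List.length_lt_of_forall_isChain hpos (fun L hL hLlen => ?_) D (G.isChain_dart_list hl hD)
  obtain ⟨d, hd, h⟩ := G.exists_representative_of_isChain L hL hLlen
    (by rintro rfl; simp at hLlen; omega)
  exact ⟨d, hd, by simpa using h⟩

theorem loops_finite [Fintype V] (r : ℕ) : (G.loops r).Finite := by
  refine (List.finite_length_lt V (Fintype.card V * (r + 1))).subset fun l hl => ?_
  obtain ⟨h1, rfl⟩ := hl
  exact G.length_lt_of_isClosedPath h1.1

end Length

section Symmetry

variable {V : Type*} (G : PlaneGraph V) (x : Sym2 V → ℂ)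

theorem IsClosedPath.rotate {l : List V} (h : G.IsClosedPath l) (k : ℕ) :
    G.IsClosedPath (l.rotate k) := by
  refine ⟨by simpa using h.1, fun j => ?_⟩
  rw [List.rotate_rotate]
  exact h.2 _

theorem IsPath.reverse {l : List V} (h : G.IsPath l) : G.IsPath l.reverse := by
  refine ⟨?_, fun i hi => ?_⟩
  · rw [List.isChain_reverse]
    exact h.1.imp fun _ _ h => h.symm
  · rw [List.length_reverse] at hi
    simp only [List.getElem_reverse]
    have := h.2 (l.length - 1 - (i + 2)) (by omega)
    simp only [show l.length - 1 - (i + 2) + 2 = l.length - 1 - i by omega] at this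
    exact this.symm

theorem IsClosedPath.reverse {l : List V} (h : G.IsClosedPath l) : G.IsClosedPath l.reverse := by
  refine ⟨by simpa using h.1, fun j => ?_⟩
  rw [List.rotate_reverse]
  exact IsPath.reverse G (h.2 _)

theorem cyclicEdges_rotate (l : List V) (k : ℕ) :
    cyclicEdges (l.rotate k) = (cyclicEdges l).rotate k := by
  rw [cyclicEdges, cyclicEdges, List.zipWith_rotate_distrib _ _ _ _ (by simp), List.rotate_rotate,
    List.rotate_rotate, add_comm]

theorem zipWith3_rotate {β : Type*} (f : V → V → V → β) (l : List V) (k : ℕ) :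
    List.zipWith3 f (l.rotate k) ((l.rotate k).rotate 1) ((l.rotate k).rotate 2) =
      (List.zipWith3 f l (l.rotate 1) (l.rotate 2)).rotate k := by
  rw [List.zipWith3_eq_zipWith_zip, List.zipWith3_eq_zipWith_zip,
    List.zipWith_rotate_distrib _ _ _ _ (by simp), List.zip,
    List.zipWith_rotate_distrib _ _ _ _ (by simp)]
  simp only [List.rotate_rotate, add_comm k]

theorem windingAngle_rotate (l : List V) (k : ℕ) : G.windingAngle (l.rotate k) = G.windingAngle l := by
  rw [windingAngle, windingAngle, zipWith3_rotate]
  exact (List.rotate_perm _ _).sum_eq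

theorem cyclicEdges_reverse_perm (l : List V) : (cyclicEdges l.reverse).Perm (cyclicEdges l) := by
  obtain ⟨j, hj⟩ := l.exists_rotate_eq 1
  set m := l.rotate j with hm
  have h1 : cyclicEdges l.reverse = (cyclicEdges m).reverse := by
    rw [cyclicEdges, cyclicEdges, List.reverse_zipWith (by simp), ← hj, List.reverse_rotate_rotate,
      List.zipWith_comm]
    simp only [Sym2.eq_swap]
  rw [h1, hm, cyclicEdges_rotate]
  exact (List.reverse_perm _).trans (List.rotate_perm _ _)

theorem zipWith3_reverse {β : Type*} (f : V → V → V → β) (m : List V) :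
    List.zipWith3 f (m.rotate 2).reverse ((m.rotate 2).reverse.rotate 1)
      ((m.rotate 2).reverse.rotate 2) =
      (List.zipWith3 (fun u v w => f w v u) m (m.rotate 1) (m.rotate 2)).reverse := by
  have h1 : (m.rotate 2).reverse.rotate 1 = (m.rotate 1).reverse := by
    rw [← List.rotate_rotate m 1 1, List.reverse_rotate_rotate]
  rw [List.reverse_rotate_rotate, h1]
  have hlen1 : (m.rotate 1).length = m.length := by simp
  have hlen2 : (m.rotate 2).length = m.length := by simp
  refine List.ext_getElem ?_ fun i hi hi' => ?_
  · simp [List.zipWith3_eq_zipWith_zip]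
  · simp [List.zipWith3_eq_zipWith_zip]

theorem turn_comm [Finite V] {u v w : V} (huv : G.graph.Adj u v) (hvw : G.graph.Adj v w)
    (hne : w ≠ u) : G.turn w v u = - G.turn u v w := by
  obtain ⟨a, ha, hq⟩ := G.exists_isGenericDrawing
  have h1 : (G.pos u - G.pos v) / (G.pos v - G.pos w) =
      ((G.pos w - G.pos v) / (G.pos v - G.pos u))⁻¹ := by
    rw [inv_div, ← neg_sub (G.pos v) (G.pos u), ← neg_sub (G.pos w) (G.pos v), neg_div_neg_eq]
  have hu : G.pos v - G.pos u ≠ 0 := sub_ne_zero.2 fun h => huv.ne (G.pos_injective h).symm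
  rw [turn, turn, h1, Complex.arg_inv, if_neg]
  intro h
  rw [Complex.arg_eq_pi_iff] at h
  set z := (G.pos w - G.pos v) / (G.pos v - G.pos u) with hz
  have hzr : z = (z.re : ℂ) := by
    apply Complex.ext <;> simp [h.2]
  have h2 : a * G.pos w - a * G.pos v = ((-z.re : ℝ) : ℂ) * (a * G.pos u - a * G.pos v) := by
    push_cast
    rw [← hzr, hz]
    field_simp
    ring
  refine hne (hq.eq_of_arg_eq hvw huv.symm ?_)
  rw [h2, Complex.arg_real_mul _ (by linarith [h.1])]

theorem windingAngle_reverse [Finite V] {l : List V} (hl : G.IsClosedPath l) :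
    G.windingAngle l.reverse = - G.windingAngle l := by
  obtain ⟨j, hj⟩ := l.exists_rotate_eq 2
  set m := l.rotate j with hm
  have hmp : G.IsClosedPath m := IsClosedPath.rotate G hl j
  have h1 : List.zipWith3 (fun u v w => G.turn w v u) m (m.rotate 1) (m.rotate 2) =
      (List.zipWith3 G.turn m (m.rotate 1) (m.rotate 2)).map fun t => -t := by
    refine List.ext_getElem (by simp [List.zipWith3_eq_zipWith_zip]) fun i hi hi' => ?_
    have him : i < m.length := by simpa [List.zipWith3_eq_zipWith_zip] using hi
    simp only [List.zipWith3_eq_zipWith_zip, List.getElem_zipWith, List.getElem_zip,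
      List.getElem_map]
    obtain ⟨h2, h3⟩ := (G.isClosedPath_iff.1 hmp).2 i him
    have h4 := ((G.isClosedPath_iff.1 (IsClosedPath.rotate G hmp 1)).2 i (by simpa)).1
    simp only [List.rotate_rotate] at h4
    exact G.turn_comm h2 h4 h3
  rw [← hj, windingAngle_rotate, windingAngle, zipWith3_reverse, List.sum_reverse, h1, windingAngle,
    ← List.sum_neg]

theorem exp_turn {u v w : V} (huv : u ≠ v) (hvw : v ≠ w) :
    Complex.exp (Complex.I * (G.turn u v w : ℂ)) =
      (G.pos w - G.pos v) / ‖G.pos w - G.pos v‖ * ((G.pos v - G.pos u) / ‖G.pos v - G.pos u‖)⁻¹ := by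
  have hu : G.pos v - G.pos u ≠ 0 := sub_ne_zero.2 fun h => huv (G.pos_injective h).symm
  have hw : G.pos w - G.pos v ≠ 0 := sub_ne_zero.2 fun h => hvw (G.pos_injective h).symm
  have hu' : (‖G.pos v - G.pos u‖ : ℂ) ≠ 0 := by exact_mod_cast norm_ne_zero_iff.2 hu
  have hw' : (‖G.pos w - G.pos v‖ : ℂ) ≠ 0 := by exact_mod_cast norm_ne_zero_iff.2 hw
  have h := Complex.norm_mul_exp_arg_mul_I ((G.pos w - G.pos v) / (G.pos v - G.pos u))
  rw [norm_div, mul_comm _ Complex.I] at h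
  push_cast at h
  rw [turn]
  set E := Complex.exp (Complex.I * (Complex.arg ((G.pos w - G.pos v) / (G.pos v - G.pos u)) : ℂ))
  rw [div_mul_eq_mul_div, div_eq_div_iff hu' hu] at h
  field_simp
  linear_combination h

theorem exp_I_mul_windingAngle {l : List V} (hl : G.IsClosedPath l) :
    Complex.exp (Complex.I * (G.windingAngle l : ℂ)) = 1 := by
  rw [exp_windingAngle]
  set s : V → V → ℂ := fun u v => (G.pos v - G.pos u) / ‖G.pos v - G.pos u‖ with hs
  have hsne : ∀ {u v : V}, u ≠ v → s u v ≠ 0 := fun {u v} huv => by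
    have hu : G.pos v - G.pos u ≠ 0 := sub_ne_zero.2 fun h => huv (G.pos_injective h).symm
    have hu' : (‖G.pos v - G.pos u‖ : ℂ) ≠ 0 := by exact_mod_cast norm_ne_zero_iff.2 hu
    exact div_ne_zero hu hu'
  have hadj : ∀ (i : ℕ) (hi : i < l.length), l[i] ≠ (l.rotate 1)[i]'(by simpa) :=
    fun i hi => ((G.isClosedPath_iff.1 hl).2 i hi).1.ne
  have h1 : List.zipWith3 (fun u v w => Complex.exp (Complex.I * (G.turn u v w : ℂ)))
      l (l.rotate 1) (l.rotate 2) = List.zipWith (· * ·)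
        (List.zipWith s (l.rotate 1) (l.rotate 2))
        ((List.zipWith s l (l.rotate 1)).map fun z => z⁻¹) := by
    refine List.ext_getElem (by simp [List.zipWith3_eq_zipWith_zip]) fun i hi hi' => ?_
    have him : i < l.length := by simpa [List.zipWith3_eq_zipWith_zip] using hi
    simp only [List.zipWith3_eq_zipWith_zip, List.getElem_zipWith, List.getElem_zip,
      List.getElem_map]
    have h4 := ((G.isClosedPath_iff.1 (IsClosedPath.rotate G hl 1)).2 i (by simpa)).1.ne
    simp only [List.rotate_rotate] at h4
    exact G.exp_turn (hadj i him) h4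
  have h2 : (List.zipWith s (l.rotate 1) (l.rotate 2)).prod = (List.zipWith s l (l.rotate 1)).prod := by
    rw [← List.rotate_rotate l 1 1, ← List.zipWith_rotate_distrib _ _ _ _ (by simp)]
    exact (List.rotate_perm _ _).prod_eq
  rw [h1, ← List.prod_mul_prod_eq_prod_zipWith_of_length_eq _ _ (by simp), h2, ← List.prod_inv]
  refine mul_inv_cancel₀ (List.prod_ne_zero fun h => ?_)
  obtain ⟨i, hi, h0⟩ := List.mem_iff_getElem.1 h
  rw [List.getElem_zipWith] at h0
  exact hsne (hadj i (by simpa using hi)) h0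

theorem cyclicWeight_rotate (l : List V) (k : ℕ) :
    G.cyclicWeight x (l.rotate k) = G.cyclicWeight x l := by
  rw [cyclicWeight, cyclicWeight, windingAngle_rotate, cyclicEdges_rotate]
  congr 1
  exact ((List.rotate_perm _ _).map _).prod_eq

theorem cyclicWeight_reverse [Finite V] {l : List V} (hl : G.IsClosedPath l) :
    G.cyclicWeight x l.reverse = G.cyclicWeight x l := by
  rw [cyclicWeight, cyclicWeight, windingAngle_reverse _ hl,
    ((cyclicEdges_reverse_perm l).map _).prod_eq]
  congr 1
  have h := G.exp_I_mul_windingAngle hl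
  have h1 : Complex.I * (G.windingAngle l : ℂ) =
      Complex.I / 2 * (G.windingAngle l : ℂ) - Complex.I / 2 * ((-G.windingAngle l : ℝ) : ℂ) := by
    push_cast
    ring
  rw [h1, Complex.exp_sub, div_eq_one_iff_eq (Complex.exp_ne_zero _)] at h
  exact h.symm

theorem loopLength_rotate (l : List V) (k : ℕ) : G.loopLength (l.rotate k) = G.loopLength l := by
  rw [loopLength, loopLength, cyclicEdges_rotate]
  exact (List.rotate_perm _ _).countP_eq _

theorem loopLength_reverse (l : List V) : G.loopLength l.reverse = G.loopLength l :=
  (cyclicEdges_reverse_perm l).countP_eq _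

theorem not_isRotated_reverse {l : List V} (hl : G.IsClosedPath l) : ¬ l ~r l.reverse := by
  rw [List.isRotated_iff_mod]
  rintro ⟨k, hk, h⟩
  have hlen := hl.1
  obtain ⟨k, hk, h⟩ : ∃ k < l.length, l.rotate k = l.reverse := by
    rcases hk.lt_or_eq with h' | h'
    · exact ⟨k, h', h⟩
    · exact ⟨0, by omega, by rw [List.rotate_zero]; rwa [h', List.rotate_length] at h⟩
  have hget : ∀ (i : ℕ) (hi : i < l.length),
      l[(i + k) % l.length]'(Nat.mod_lt _ (by omega)) = l[l.length - 1 - i]'(by omega) := by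
    intro i hi
    have : (l.rotate k)[i]'(by simpa) = l.reverse[i]'(by simpa) := by simp only [h]
    rwa [List.getElem_rotate, List.getElem_reverse] at this
  have hcond := (G.isClosedPath_iff.1 hl).2
  simp only [List.getElem_rotate] at hcond
  rcases Nat.even_or_odd' (l.length - 1 - k) with ⟨m, hm | hm⟩
  · have h1 := hget (m + 1) (by omega)
    have h2 := (hcond (l.length - 1 - (m + 1)) (by omega)).2
    simp only [show l.length - 1 - (m + 1) + 2 = m + 1 + k by omega] at h2
    exact h2 h1
  · have h1 := hget m (by omega)
    have h2 := (hcond (m + k) (by omega)).1.ne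
    simp only [show m + k + 1 = l.length - 1 - m by omega,
      Nat.mod_eq_of_lt (show l.length - 1 - m < l.length by omega)] at h2
    simp only [Nat.mod_eq_of_lt (show m + k < l.length by omega)] at h1
    exact h2 h1

end Symmetry

end PlaneGraph

section Rotations

open Function

variable {α : Type*}

theorem List.iterate_rotate_one (l : List α) (k : ℕ) :
    (fun l' : List α => l'.rotate 1)^[k] l = l.rotate k := by
  induction k with
  | zero => simp
  | succ k ih => rw [iterate_succ_apply', ih, List.rotate_rotate]

/-- The smallest period of a cyclic sequence. -/
noncomputable def List.period (l : List α) : ℕ := minimalPeriod (fun l' : List α => l'.rotate 1) l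

theorem List.isPeriodicPt_length (l : List α) :
    IsPeriodicPt (fun l' : List α => l'.rotate 1) l.length l := by
  rw [IsPeriodicPt, IsFixedPt, List.iterate_rotate_one, List.rotate_length]

theorem List.period_dvd_length (l : List α) : l.period ∣ l.length :=
  l.isPeriodicPt_length.minimalPeriod_dvd

theorem List.period_pos {l : List α} (hl : 0 < l.length) : 0 < l.period :=
  l.isPeriodicPt_length.minimalPeriod_pos hl

open Classical in
/-- The rotations of a cyclic sequence. -/
noncomputable def List.rotations (l : List α) : Finset (List α) :=
  (Finset.range l.period).image l.rotate

theorem List.mem_rotations {l c : List α} (hl : 0 < l.length) : c ∈ l.rotations ↔ l ~r c := by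
  simp only [List.rotations, Finset.mem_image, Finset.mem_range]
  constructor
  · rintro ⟨k, -, rfl⟩
    exact ⟨k, rfl⟩
  · rintro ⟨k, rfl⟩
    refine ⟨k % l.period, Nat.mod_lt _ (l.period_pos hl), ?_⟩
    rw [← List.iterate_rotate_one, ← List.iterate_rotate_one l k]
    exact iterate_mod_minimalPeriod_eq

theorem List.card_rotations (l : List α) : l.rotations.card = l.period := by
  classical
  rw [List.rotations, Finset.card_image_of_injOn, Finset.card_range]
  intro i hi j hj h
  simp only [Finset.coe_range, Set.mem_Iio] at hi hj
  refine iterate_injOn_Iio_minimalPeriod (f := fun l' : List α => l'.rotate 1) (x := l) hi hj ?_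
  simpa only [List.iterate_rotate_one] using h

open Classical in
/-- The rotations of a cyclic sequence and of its reversal. -/
noncomputable def List.dihedralOrbit (l : List α) : Finset (List α) :=
  l.rotations ∪ l.rotations.image List.reverse

theorem List.mem_dihedralOrbit {l c : List α} (hl : 0 < l.length) :
    c ∈ l.dihedralOrbit ↔ l ~r c ∨ l ~r c.reverse := by
  simp only [List.dihedralOrbit, Finset.mem_union, Finset.mem_image, List.mem_rotations hl]
  refine or_congr_right ⟨?_, fun h => ⟨_, h, List.reverse_reverse c⟩⟩
  rintro ⟨d, hd, rfl⟩
  rwa [List.reverse_reverse]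

theorem List.mem_dihedralOrbit_comm {l c : List α} (hl : 0 < l.length) (h : c ∈ l.dihedralOrbit) :
    l ∈ c.dihedralOrbit := by
  have hc : 0 < c.length := by
    rcases (List.mem_dihedralOrbit hl).1 h with h | h
    · rwa [← h.perm.length_eq]
    · rwa [← List.length_reverse, ← h.perm.length_eq]
  rw [List.mem_dihedralOrbit hl] at h
  rw [List.mem_dihedralOrbit hc]
  rcases h with h | h
  · exact .inl h.symm
  · exact .inr (List.isRotated_reverse_comm_iff.1 h.symm)

theorem List.card_dihedralOrbit {l : List α} (hl : 0 < l.length) (h : ¬ l ~r l.reverse) :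
    l.dihedralOrbit.card = 2 * l.period := by
  classical
  rw [List.dihedralOrbit, Finset.card_union_of_disjoint, Finset.card_image_of_injective _
    List.reverse_injective, List.card_rotations, two_mul]
  rw [Finset.disjoint_left]
  intro c hc hc'
  obtain ⟨d, hd, rfl⟩ := Finset.mem_image.1 hc'
  rw [List.mem_rotations hl] at hc hd
  exact h (hc.trans hd.symm.reverse)

end Rotations

namespace PlaneGraph

section LoopSums

variable {V : Type*} (G : PlaneGraph V) (x : Sym2 V → ℂ)

theorem key_injective : Function.Injective G.key := by
  refine List.map_injective_iff.2 fun u v h => G.pos_injective ?_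
  have := toLex.injective h
  exact Complex.ext (Prod.mk.inj this).1 (Prod.mk.inj this).2

variable {G} in
theorem IsClosedPath.length_pos {l : List V} (hl : G.IsClosedPath l) : 0 < l.length :=
  lt_of_lt_of_le (by norm_num) hl.1

variable {G} in
theorem IsClosedPath.of_mem_dihedralOrbit {l c : List V} (hl : G.IsClosedPath l)
    (h : c ∈ l.dihedralOrbit) : G.IsClosedPath c := by
  rcases (List.mem_dihedralOrbit hl.length_pos).1 h with ⟨k, rfl⟩ | ⟨k, h⟩
  · exact IsClosedPath.rotate G hl k
  · rw [← List.reverse_reverse c, ← h]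
    exact IsClosedPath.reverse G (IsClosedPath.rotate G hl k)

variable {G} in
theorem IsLoop.key_le {l c : List V} (hl : G.IsLoop l) (h : c ∈ l.dihedralOrbit) :
    G.key l ≤ G.key c := by
  rcases (List.mem_dihedralOrbit hl.1.length_pos).1 h with ⟨k, rfl⟩ | h
  · exact (hl.2 k).1
  · obtain ⟨k, rfl⟩ := List.isRotated_reverse_comm_iff.2 h
    exact (hl.2 k).2

theorem exists_isLoop {l : List V} (hl : G.IsClosedPath l) :
    ∃ c ∈ l.dihedralOrbit, G.IsLoop c := by
  have hself : l ∈ l.dihedralOrbit := (List.mem_dihedralOrbit hl.length_pos).2 (.inl (.refl l))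
  obtain ⟨c, hc, hmin⟩ := l.dihedralOrbit.exists_min_image G.key ⟨l, hself⟩
  refine ⟨c, hc, hl.of_mem_dihedralOrbit hc, fun k => ⟨hmin _ ?_, hmin _ ?_⟩⟩
  · rw [List.mem_dihedralOrbit hl.length_pos] at hc ⊢
    rcases hc with hc | hc
    · exact .inl (hc.trans ⟨k, rfl⟩)
    · refine .inr (hc.trans (List.IsRotated.reverse ⟨k, rfl⟩))
  · rw [List.mem_dihedralOrbit hl.length_pos] at hc ⊢
    rcases hc with hc | hc
    · refine .inr (List.isRotated_reverse_comm_iff.1 (hc.reverse.trans ⟨k, rfl⟩))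
    · exact .inl (hc.trans ⟨k, rfl⟩)

theorem loopWeight_eq {l : List V} (hl : 0 < l.length) : G.loopWeight x l =
    -((l.period : ℂ) * G.cyclicWeight x l / (l.length : ℂ)) := by
  obtain ⟨k, hk⟩ := l.period_dvd_length
  have hp := l.period_pos hl
  have hm : multiplicity l = k := by
    change l.length / l.period = k
    rw [hk, Nat.mul_div_cancel_left _ hp]
  have hk0 : (k : ℂ) ≠ 0 := by
    rintro h
    rw [Nat.cast_eq_zero.1 h] at hk
    omega
  have hp0 : (l.period : ℂ) ≠ 0 := by exact_mod_cast hp.ne'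
  rw [loopWeight, hm, sign, cyclicWeight, hk]
  push_cast
  field_simp

variable [Fintype V]

theorem mem_closedPaths_of_mem_dihedralOrbit {n r : ℕ} {l c : List V} (hl : l ∈ G.closedPaths n r)
    (h : c ∈ l.dihedralOrbit) : c ∈ G.closedPaths n r := by
  rw [mem_closedPaths] at hl ⊢
  refine ⟨?_, hl.2.1.of_mem_dihedralOrbit h, ?_⟩
  · rcases (List.mem_dihedralOrbit hl.2.1.length_pos).1 h with ⟨k, rfl⟩ | ⟨k, h⟩
    · simpa using hl.1
    · rw [← List.length_reverse, ← h, List.length_rotate]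
      exact hl.1
  · rcases (List.mem_dihedralOrbit hl.2.1.length_pos).1 h with ⟨k, rfl⟩ | ⟨k, h⟩
    · rw [loopLength_rotate]
      exact hl.2.2
    · rw [← loopLength_reverse, ← h, loopLength_rotate]
      exact hl.2.2

theorem cyclicWeight_of_mem_dihedralOrbit {l c : List V} (hl : G.IsClosedPath l)
    (h : c ∈ l.dihedralOrbit) : G.cyclicWeight x c = G.cyclicWeight x l := by
  have hc := hl.of_mem_dihedralOrbit h
  rcases (List.mem_dihedralOrbit hl.length_pos).1 h with ⟨k, rfl⟩ | ⟨k, h⟩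
  · rw [cyclicWeight_rotate]
  · rw [← cyclicWeight_reverse G x hc, ← h, cyclicWeight_rotate]

open Classical in
theorem sum_closedPaths_eq (n r : ℕ) : ∑ l ∈ G.closedPaths n r, G.cyclicWeight x l =
    2 * ∑ l ∈ (G.closedPaths n r).filter G.IsLoop, (l.period : ℂ) * G.cyclicWeight x l := by
  have hU : G.closedPaths n r =
      ((G.closedPaths n r).filter G.IsLoop).biUnion List.dihedralOrbit := by
    ext l
    simp only [Finset.mem_biUnion, Finset.mem_filter]
    constructor
    · intro hl
      have hl' := ((G.mem_closedPaths).1 hl).2.1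
      obtain ⟨c, hc, hloop⟩ := G.exists_isLoop hl'
      exact ⟨c, ⟨G.mem_closedPaths_of_mem_dihedralOrbit hl hc, hloop⟩,
        List.mem_dihedralOrbit_comm hl'.length_pos hc⟩
    · rintro ⟨c, ⟨hc, -⟩, h⟩
      exact G.mem_closedPaths_of_mem_dihedralOrbit hc h
  have hdisj : Set.PairwiseDisjoint (((G.closedPaths n r).filter G.IsLoop : Finset (List V)) :
      Set (List V)) List.dihedralOrbit := by
    intro l hl l' hl' hne
    simp only [Finset.coe_filter, Set.mem_ofPred_eq] at hl hl'
    rw [Function.onFun, Finset.disjoint_left]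
    intro c hc hc'
    have htrans : ∀ {l l' : List V}, G.IsLoop l → G.IsLoop l' → c ∈ l.dihedralOrbit →
        c ∈ l'.dihedralOrbit → l' ∈ l.dihedralOrbit := by
      intro l l' hl hl' h h'
      rw [List.mem_dihedralOrbit hl.1.length_pos] at h ⊢
      rw [List.mem_dihedralOrbit hl'.1.length_pos] at h'
      rcases h with h | h <;> rcases h' with h' | h'
      · exact .inl (h.trans h'.symm)
      · refine .inr (h.trans (List.isRotated_reverse_comm_iff.2 ?_).symm)
        simpa using h'
      · exact .inr (h.trans h'.symm.reverse)
      · exact .inl (h.trans h'.symm)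
    exact hne (G.key_injective (le_antisymm (hl.2.key_le (htrans hl.2 hl'.2 hc hc'))
      (hl'.2.key_le (htrans hl'.2 hl.2 hc' hc))))
  conv_lhs => rw [hU]
  rw [Finset.sum_biUnion hdisj, Finset.mul_sum]
  refine Finset.sum_congr rfl fun l hl => ?_
  have hl' := (Finset.mem_filter.1 hl).2.1
  rw [Finset.sum_congr rfl fun c hc => G.cyclicWeight_of_mem_dihedralOrbit x hl' hc,
    Finset.sum_const, List.card_dihedralOrbit hl'.length_pos (G.not_isRotated_reverse hl'),
    nsmul_eq_mul]
  push_cast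
  ring

/-- The loop sums in terms of the transition matrix. -/
theorem f_succ_eq [Fintype G.representative.Dart] [DecidableEq G.representative.Dart] (r : ℕ) :
    G.f (r + 1) x = -((G.transitionMatrix x ^ (r + 1)).trace / (2 * ((r : ℂ) + 1))) := by
  classical
  set L := Fintype.card V * (r + 1 + 1) with hL
  have hset : G.loops (r + 1) = (((Finset.range L).biUnion fun k =>
      (G.closedPaths (k + 1) (r + 1)).filter G.IsLoop : Finset (List V)) : Set (List V)) := by
    ext l
    simp only [Finset.coe_biUnion, Finset.coe_range, Set.mem_iUnion, Finset.coe_filter,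
      Set.mem_ofPred_eq, Set.mem_Iio, mem_closedPaths, loops, exists_prop]
    constructor
    · rintro ⟨h1, h2⟩
      have h3 := G.length_lt_of_isClosedPath h1.1
      have h4 := h1.1.length_pos
      rw [h2] at h3
      exact ⟨l.length - 1, by omega, ⟨by omega, h1.1, h2⟩, h1⟩
    · rintro ⟨k, -, ⟨-, -, h2⟩, h1⟩
      exact ⟨h1, h2⟩
  rw [f, hset, finsum_mem_coe_finset, Finset.sum_biUnion]
  · have h1 := G.sum_cyclicWeight_div x (L := L) (r := r)
      (Nat.mul_le_mul_left _ (by omega))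
    have h2 : ∀ k ∈ Finset.range L,
        ∑ l ∈ (G.closedPaths (k + 1) (r + 1)).filter G.IsLoop, G.loopWeight x l =
        -(1 / 2) * ((∑ l ∈ G.closedPaths (k + 1) (r + 1), G.cyclicWeight x l) / ((k : ℂ) + 1)) := by
      intro k _
      rw [sum_closedPaths_eq, ← mul_div_assoc, mul_div_right_comm, Finset.mul_sum, Finset.mul_sum]
      refine Finset.sum_congr rfl fun l hl => ?_
      have h3 := G.mem_closedPaths.1 (Finset.mem_filter.1 hl).1
      rw [G.loopWeight_eq x h3.2.1.length_pos, h3.1]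
      push_cast
      ring
    rw [Finset.sum_congr rfl h2, ← Finset.mul_sum, h1]
    have hr : ((r : ℂ) + 1) ≠ 0 := by exact_mod_cast Nat.succ_ne_zero r
    field_simp
  · intro i _ j _ hij
    rw [Function.onFun, Finset.disjoint_left]
    intro l hl hl'
    have h1 := (G.mem_closedPaths.1 (Finset.mem_filter.1 hl).1).1
    have h2 := (G.mem_closedPaths.1 (Finset.mem_filter.1 hl').1).1
    omega

end LoopSums

end PlaneGraph

section Eigenvalues

open Polynomial

variable {n : Type*} [Fintype n] [DecidableEq n]

theorem Matrix.det_aeval_eq_prod_roots (M : Matrix n n ℂ) (p : ℂ[X]) :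
    (aeval M p).det = (M.charpoly.roots.map fun μ => p.eval μ).prod := by
  have hcard : M.charpoly.roots.card = Fintype.card n := by
    rw [← (IsAlgClosed.splits M.charpoly).natDegree_eq_card_roots, M.charpoly_natDegree_eq_dim]
  have hlin : ∀ a : ℂ, (aeval M (X - C a)).det = (M.charpoly.roots.map fun μ => μ - a).prod := by
    intro a
    have h1 : aeval M (X - C a) = -(Matrix.scalar n a - M) := by
      simp [Matrix.algebraMap_eq_diagonal]
    have h2 : M.charpoly.eval a = (M.charpoly.roots.map fun μ => a - μ).prod := by
      conv_lhs => rw [(IsAlgClosed.splits M.charpoly).eq_prod_roots_of_monic M.charpoly_monic]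
      rw [eval_multiset_prod, Multiset.map_map]
      simp
    rw [h1, Matrix.det_neg, ← Matrix.eval_charpoly, h2, ← hcard]
    generalize M.charpoly.roots = s
    induction s using Multiset.induction with
    | empty => simp
    | cons μ s ih =>
      rw [Multiset.map_cons, Multiset.prod_cons, Multiset.map_cons, Multiset.prod_cons, ← ih,
        Multiset.card_cons]
      ring
  have hp := (IsAlgClosed.splits p).eq_prod_roots
  rw [hp]
  simp only [eval_mul, eval_C, eval_multiset_prod, Multiset.map_map, Function.comp_def, eval_sub,
    eval_X, map_mul, aeval_C, Matrix.det_mul, Multiset.prod_map_mul, Multiset.map_const',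
    Multiset.prod_replicate, hcard]
  congr 1
  · simp [Matrix.algebraMap_eq_diagonal]
  · generalize p.roots = s
    induction s using Multiset.induction with
    | empty => simp
    | cons a s ih =>
      simp only [Multiset.map_cons, Multiset.prod_cons, map_mul, Matrix.det_mul, hlin,
        Multiset.prod_map_mul]
      rw [ih]

theorem Matrix.roots_charpoly_pow (M : Matrix n n ℂ) (k : ℕ) :
    (M ^ k).charpoly.roots = M.charpoly.roots.map fun μ => μ ^ k := by
  have h1 : (M ^ k).charpoly = ((M.charpoly.roots.map fun μ => μ ^ k).map fun a => X - C a).prod := by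
    refine Polynomial.funext fun z => ?_
    have h2 := M.det_aeval_eq_prod_roots (C z - X ^ k)
    rw [Matrix.eval_charpoly, eval_multiset_prod, Multiset.map_map, Multiset.map_map]
    simp only [Function.comp_def, eval_sub, eval_X, eval_C, eval_pow] at h2 ⊢
    rw [← h2]
    simp [Matrix.algebraMap_eq_diagonal]
    rfl
  rw [h1, roots_multiset_prod_X_sub_C]

theorem Matrix.trace_pow_eq_sum_roots (M : Matrix n n ℂ) (k : ℕ) :
    (M ^ k).trace = (M.charpoly.roots.map fun μ => μ ^ k).sum := by
  rw [Matrix.trace_eq_sum_roots_charpoly, M.roots_charpoly_pow]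

theorem Matrix.det_one_sub_smul_eq_prod_roots (M : Matrix n n ℂ) (t : ℂ) :
    (1 - t • M).det = (M.charpoly.roots.map fun μ => 1 - t * μ).prod := by
  have := M.det_aeval_eq_prod_roots (1 - C t * X)
  simpa [Algebra.smul_def] using this

theorem Matrix.norm_lt_one_of_mem_roots {M : Matrix n n ℂ} (hM : spectralRadius ℂ M < 1) {μ : ℂ}
    (hμ : μ ∈ M.charpoly.roots) : ‖μ‖ < 1 := by
  have h1 : μ ∈ spectrum ℂ M := by
    rw [Matrix.mem_spectrum_iff_isRoot_charpoly]
    exact isRoot_of_mem_roots hμ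
  have h2 : (‖μ‖₊ : ENNReal) ≤ spectralRadius ℂ M := le_iSup₂ (f := fun k _ => (‖k‖₊ : ENNReal)) μ h1
  exact_mod_cast lt_of_le_of_lt h2 hM

theorem hasSum_multiset_taylorSeries_neg_log (s : Multiset ℂ) (hs : ∀ μ ∈ s, ‖μ‖ < 1) :
    HasSum (fun k : ℕ => (s.map fun μ => μ ^ (k + 1)).sum / ((k : ℂ) + 1))
      (-(s.map fun μ => Complex.log (1 - μ)).sum) ∧
    Summable fun k : ℕ => ‖(s.map fun μ => μ ^ (k + 1)).sum / ((k : ℂ) + 1)‖ := by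
  induction s using Multiset.induction with
  | empty => simp [hasSum_zero]
  | cons μ s ih =>
    obtain ⟨h1, h2⟩ := ih fun ν hν => hs ν (Multiset.mem_cons_of_mem hν)
    have hμ := hs μ (Multiset.mem_cons_self μ s)
    have h3 : HasSum (fun k : ℕ => μ ^ (k + 1) / ((k : ℂ) + 1)) (-Complex.log (1 - μ)) := by
      have := (hasSum_nat_add_iff' 1).2 (Complex.hasSum_taylorSeries_neg_log hμ)
      simpa using this
    have h4 : Summable fun k : ℕ => ‖μ ^ (k + 1) / ((k : ℂ) + 1)‖ := h3.summable.norm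
    simp only [Multiset.map_cons, Multiset.sum_cons, add_div, neg_add]
    exact ⟨h3.add h1, (h4.add h2).of_nonneg_of_le (fun _ => norm_nonneg _) fun _ => norm_add_le _ _⟩

theorem exp_half_sum_log (s : Multiset ℂ) (hs : ∀ μ ∈ s, ‖μ‖ < 1) :
    Complex.exp ((s.map fun μ => Complex.log (1 - μ)).sum / 2) =
      (s.map fun μ => (1 - μ) ^ (1 / 2 : ℂ)).prod := by
  induction s using Multiset.induction with
  | empty => simp
  | cons μ s ih =>
    have hμ := hs μ (Multiset.mem_cons_self μ s)
    have h1 : 1 - μ ≠ 0 := by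
      intro h
      rw [← sub_eq_zero.1 h] at hμ
      simp at hμ
    rw [Multiset.map_cons, Multiset.sum_cons, Multiset.map_cons, Multiset.prod_cons, add_div,
      Complex.exp_add, ih fun ν hν => hs ν (Multiset.mem_cons_of_mem hν), Complex.cpow_def_of_ne_zero h1,
      mul_one_div]

theorem continuous_prod_cpow_half (s : Multiset ℂ) (hs : ∀ μ ∈ s, ‖μ‖ < 1) :
    ContinuousOn (fun t : ℝ => (s.map fun μ : ℂ => (1 - (t : ℂ) * μ) ^ (1 / 2 : ℂ)).prod) (Set.Icc 0 1) := by
  induction s using Multiset.induction with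
  | empty => simpa using continuousOn_const
  | cons μ s ih =>
    simp only [Multiset.map_cons, Multiset.prod_cons]
    refine ContinuousOn.mul ?_ (ih fun ν hν => hs ν (Multiset.mem_cons_of_mem hν))
    refine ContinuousOn.cpow_const (by fun_prop) fun t ht => ?_
    have hμ := hs μ (Multiset.mem_cons_self μ s)
    refine Or.inl ?_
    have h1 : ((t : ℂ) * μ).re ≤ ‖μ‖ := by
      refine (Complex.re_le_norm _).trans ?_
      rw [norm_mul, Complex.norm_real, Real.norm_of_nonneg ht.1]
      exact mul_le_of_le_one_left (norm_nonneg _) ht.2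
    rw [Complex.sub_re, Complex.one_re]
    linarith

theorem prod_cpow_half_sq (s : Multiset ℂ) (t : ℂ) :
    (s.map fun μ => (1 - t * μ) ^ (1 / 2 : ℂ)).prod ^ 2 = (s.map fun μ => 1 - t * μ).prod := by
  rw [← Multiset.prod_map_pow]
  congr 1
  refine Multiset.map_congr rfl fun μ _ => ?_
  rw [one_div]
  exact_mod_cast Complex.cpow_nat_inv_pow (1 - t * μ) two_ne_zero

theorem prod_one_sub_ne_zero (s : Multiset ℂ) (hs : ∀ μ ∈ s, ‖μ‖ < 1) {t : ℝ}
    (ht : t ∈ Set.Icc (0 : ℝ) 1) : (s.map fun μ : ℂ => 1 - (t : ℂ) * μ).prod ≠ 0 := by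
  rw [ne_eq, Multiset.prod_eq_zero_iff, Multiset.mem_map]
  rintro ⟨μ, hμ, h⟩
  have h1 : ‖(t : ℂ) * μ‖ < 1 := by
    rw [norm_mul, Complex.norm_real, Real.norm_of_nonneg ht.1]
    exact lt_of_le_of_lt (mul_le_of_le_one_left (norm_nonneg _) ht.2) (hs μ hμ)
  rw [← sub_eq_zero.1 h] at h1
  simp at h1

end Eigenvalues

namespace PlaneGraph

section Branch

variable {V : Type*} (G : PlaneGraph V) (x : Sym2 V → ℂ)

open Classical in
/-- The weights `x` with the weights of representative edges multiplied by `t`. -/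
noncomputable def scaleRep (t : ℂ) (e : Sym2 V) : ℂ :=
  if e ∈ G.additional.edgeSet then x e else t * x e

theorem scaleRep_one : G.scaleRep x 1 = x := by
  funext e
  simp [scaleRep]

theorem transitionMatrix_scaleRep (t : ℂ) :
    G.transitionMatrix (G.scaleRep x t) = t • G.transitionMatrix x := by
  ext d e
  have h1 : G.scaleRep x t d.edge = t * x d.edge := if_neg d.adj.2
  rw [Matrix.smul_apply, smul_eq_mul, transitionMatrix, transitionMatrix, h1]
  split_ifs with h2 h3 h4
  · ring
  · simp
  · have h5 : h4.choose.edges.map (G.scaleRep x t) = h4.choose.edges.map x :=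
      List.map_congr_left fun a ha => if_pos (SimpleGraph.Walk.edges_subset_edgeSet _ ha)
    rw [h5]
    ring
  · simp

variable [Fintype V]

theorem continuous_Z : Continuous G.Z := by
  unfold Z
  fun_prop

theorem Z_zero : G.Z 0 = 1 := by
  classical
  rw [Z, Finset.sum_eq_single ∅]
  · have : G.crossings ∅ = 0 := by
      rw [crossings, Finset.card_eq_zero, Finset.filter_eq_empty_iff]
      intro P hP
      rw [Finset.mem_powersetCard, Finset.subset_empty] at hP
      rw [hP.1] at hP
      simp at hP
    simp [this]
  · intro F _ hF
    obtain ⟨e, he⟩ := Finset.nonempty_iff_ne_empty.2 hF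
    rw [Finset.prod_eq_zero he (by rfl), mul_zero]
  · intro h
    exact absurd (Finset.mem_filter.2 ⟨Finset.empty_mem_powerset _, fun v => by simp⟩) h

theorem Z_scaleRep_zero : G.Z (G.scaleRep x 0) = 1 := by
  classical
  have hcont : Continuous fun s : ℝ => G.Z ((s : ℂ) • G.scaleRep x 0) :=
    G.continuous_Z.comp (by fun_prop)
  have hsq : ∀ s : ℝ, G.Z ((s : ℂ) • G.scaleRep x 0) ^ 2 = 1 := by
    intro s
    have h1 : (s : ℂ) • G.scaleRep x 0 = G.scaleRep ((s : ℂ) • x) 0 := by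
      funext e
      simp [scaleRep]
    rw [h1, Z_sq_eq_det, transitionMatrix_scaleRep]
    simp
  rcases isPreconnected_univ.eq_or_eq_neg_of_sq_eq (f := fun s : ℝ => G.Z ((s : ℂ) • G.scaleRep x 0))
    (g := fun _ => 1) hcont.continuousOn continuousOn_const (fun s _ => (hsq s).trans (one_pow 2).symm)
    (fun _ => one_ne_zero) with h | h
  · simpa using h (Set.mem_univ 1)
  · have := h (Set.mem_univ 0)
    simp [Z_zero] at this
    norm_num at this

theorem continuous_Z_scaleRep : Continuous fun t : ℝ => G.Z (G.scaleRep x t) := by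
  refine G.continuous_Z.comp (continuous_pi fun e => ?_)
  unfold scaleRep
  split_ifs <;> fun_prop

theorem Z_im_eq_zero (hx : ∀ e ∈ G.graph.edgeSet, (x e).im = 0) : (G.Z x).im = 0 := by
  classical
  rw [Z, Complex.im_sum]
  refine Finset.sum_eq_zero fun F hF => ?_
  have hF' := Finset.mem_powerset.1 (Finset.mem_filter.1 hF).1
  have h1 : ∏ e ∈ F, x e = ((∏ e ∈ F, (x e).re : ℝ) : ℂ) := by
    push_cast
    refine Finset.prod_congr rfl fun e he => ?_
    apply Complex.ext <;> simp [hx e (SimpleGraph.mem_edgeFinset.1 (hF' he))]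
  have h2 : ((-1 : ℂ) ^ G.crossings F) = (((-1 : ℝ) ^ G.crossings F : ℝ) : ℂ) := by push_cast; rfl
  rw [h1, h2, ← Complex.ofReal_mul, Complex.ofReal_im]

variable [Fintype G.representative.Dart] [DecidableEq G.representative.Dart]

theorem Z_scaleRep_sq (t : ℂ) : G.Z (G.scaleRep x t) ^ 2 =
    ((G.transitionMatrix x).charpoly.roots.map fun μ => 1 - t * μ).prod := by
  rw [Z_sq_eq_det, transitionMatrix_scaleRep, Matrix.det_one_sub_smul_eq_prod_roots]

theorem Z_eq_prod_cpow_half (hρ : spectralRadius ℂ (G.transitionMatrix x) < 1) :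
    G.Z x = ((G.transitionMatrix x).charpoly.roots.map fun μ : ℂ => (1 - μ) ^ (1 / 2 : ℂ)).prod := by
  set s := (G.transitionMatrix x).charpoly.roots with hs
  have hnorm : ∀ μ ∈ s, ‖μ‖ < 1 := fun μ hμ => Matrix.norm_lt_one_of_mem_roots hρ hμ
  have key := isPreconnected_Icc.eq_or_eq_neg_of_sq_eq (S := Set.Icc (0 : ℝ) 1)
    (f := fun t : ℝ => G.Z (G.scaleRep x t))
    (g := fun t : ℝ => (s.map fun μ : ℂ => (1 - (t : ℂ) * μ) ^ (1 / 2 : ℂ)).prod)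
    (G.continuous_Z_scaleRep x).continuousOn (continuous_prod_cpow_half s hnorm)
    (fun t _ => by simp only [Pi.pow_apply, Z_scaleRep_sq, prod_cpow_half_sq, hs])
    (fun {t} ht h0 => by
      have := prod_cpow_half_sq s (t : ℂ)
      rw [h0, zero_pow two_ne_zero] at this
      exact prod_one_sub_ne_zero s hnorm ht this.symm)
  rcases key with h | h
  · have := h (Set.right_mem_Icc.2 zero_le_one)
    simpa [scaleRep_one] using this
  · have := h (Set.left_mem_Icc.2 zero_le_one)
    simp [Z_scaleRep_zero] at this
    norm_num at this

theorem f_succ_hasSum (hρ : spectralRadius ℂ (G.transitionMatrix x) < 1) :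
    HasSum (fun r : ℕ => G.f (r + 1) x)
      (((G.transitionMatrix x).charpoly.roots.map fun μ => Complex.log (1 - μ)).sum / 2) ∧
    Summable (fun r : ℕ => ‖G.f (r + 1) x‖) := by
  obtain ⟨h1, h2⟩ := hasSum_multiset_taylorSeries_neg_log (G.transitionMatrix x).charpoly.roots
    fun μ hμ => Matrix.norm_lt_one_of_mem_roots hρ hμ
  have h3 : ∀ r : ℕ, G.f (r + 1) x = -(1 / 2) *
      (((G.transitionMatrix x).charpoly.roots.map fun μ => μ ^ (r + 1)).sum / ((r : ℂ) + 1)) := by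
    intro r
    have hr : ((r : ℂ) + 1) ≠ 0 := by exact_mod_cast Nat.succ_ne_zero r
    rw [f_succ_eq, Matrix.trace_pow_eq_sum_roots]
    field_simp
  simp only [h3]
  constructor
  · have h4 := h1.mul_left (-(1 / 2))
    rwa [neg_mul_neg, one_div_mul_eq_div] at h4
  · simp only [norm_mul]
    exact h2.mul_left _

theorem Z_re_pos (hρ : spectralRadius ℂ (G.transitionMatrix x) < 1)
    (hx : ∀ e ∈ G.graph.edgeSet, (x e).im = 0) : 0 < (G.Z x).re := by
  classical
  have hreal : ∀ t : ℝ, (G.Z (G.scaleRep x t)).im = 0 := by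
    intro t
    refine G.Z_im_eq_zero _ fun e he => ?_
    rw [scaleRep]
    split_ifs <;> simp [hx e he]
  have hne : ∀ t ∈ Set.Icc (0 : ℝ) 1, (G.Z (G.scaleRep x t)).re ≠ 0 := by
    intro t ht h0
    have h1 : G.Z (G.scaleRep x t) = 0 := Complex.ext h0 (hreal t)
    have h2 := G.Z_scaleRep_sq x t
    rw [h1, zero_pow two_ne_zero] at h2
    exact prod_one_sub_ne_zero _ (fun μ hμ => Matrix.norm_lt_one_of_mem_roots hρ hμ) ht h2.symm
  by_contra! hle
  have hcont : ContinuousOn (fun t : ℝ => (G.Z (G.scaleRep x t)).re) (Set.Icc 0 1) :=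
    (Complex.continuous_re.comp (G.continuous_Z_scaleRep x)).continuousOn
  have hmem : (0 : ℝ) ∈ Set.Icc (G.Z (G.scaleRep x ((1 : ℝ) : ℂ))).re
      (G.Z (G.scaleRep x ((0 : ℝ) : ℂ))).re := by
    rw [Complex.ofReal_one, scaleRep_one, Complex.ofReal_zero, Z_scaleRep_zero]
    exact ⟨hle, by simp⟩
  obtain ⟨t, ht, h0⟩ := intermediate_value_Icc' zero_le_one hcont hmem
  exact hne t ht h0

end Branch

end PlaneGraph

theorem theorem2 {V : Type*} [Fintype V] [DecidableEq V] (G : PlaneGraph V)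
    [DecidableRel G.graph.Adj] [DecidableRel G.additional.Adj] (x : Sym2 V → ℂ)
    (hρ : spectralRadius ℂ (G.transitionMatrix x) < 1) :
    (∀ r : ℕ, (G.loops r).Finite) ∧
    Summable (fun r : ℕ => ‖G.f (r + 1) x‖) ∧
    G.Z x = Complex.exp (∑' r : ℕ, G.f (r + 1) x) ∧
    -- the square root of the determinant, the branch being given by the principal square roots of
    -- the factors `1 - μ`, where `μ` runs over the eigenvalues
    G.Z x ^ 2 = (1 - G.transitionMatrix x).det ∧
    G.Z x = ((G.transitionMatrix x).charpoly.roots.map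
      (fun μ : ℂ => (1 - μ) ^ (1 / 2 : ℂ))).prod ∧
    -- for real edge weights it is the usual square root of a positive number
    ((∀ e ∈ G.graph.edgeSet, (x e).im = 0) →
      ∃ D : ℝ, 0 < D ∧ (1 - G.transitionMatrix x).det = (D : ℂ) ∧ G.Z x = (Real.sqrt D : ℂ)) := by
  obtain ⟨hsum, hnorm⟩ := G.f_succ_hasSum x hρ
  refine ⟨G.loops_finite, hnorm, ?_, G.Z_sq_eq_det x, G.Z_eq_prod_cpow_half x hρ, fun hx => ?_⟩
  · rw [hsum.tsum_eq, exp_half_sum_log _ fun μ hμ => Matrix.norm_lt_one_of_mem_roots hρ hμ,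
      G.Z_eq_prod_cpow_half x hρ]
  · have hpos := G.Z_re_pos x hρ hx
    have hZ : G.Z x = ((G.Z x).re : ℂ) := Complex.ext (by simp) (by simp [G.Z_im_eq_zero x hx])
    refine ⟨(G.Z x).re ^ 2, by positivity, ?_, ?_⟩
    · rw [← G.Z_sq_eq_det x]
      push_cast
      rw [← hZ]
    · rw [Real.sqrt_sq hpos.le, ← hZ]
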